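/- Let $p\ge 2$ and $p'\ge 1$ be coprime integers, $a:=p'/p$, and $\varepsilon,\varepsilon'\in\{0,1\}$. For $\tau\in\mathbb H$ and $u,t\in\mathbb C$ put $(q,z,w)=(e^{2\pi i\tau},e^{2\pi iu},e^{2\pi it})$, with $q^\alpha=e^{2\pi i\alpha\tau}$, $z^\alpha=e^{2\pi i\alpha u}$, $w^\alpha=e^{2\pi i\alpha t}$. Let $\eta(\tau)=q^{1/24}\prod_{n>0}(1-q^n)$, $$\vartheta_{\varepsilon,\varepsilon'}(u;\tau)=z^{\frac{\varepsilon}{2}}q^{\frac{\varepsilon}{8}}\prod_{n>0}(1-q^n)\bigl(1+(-1)^{\varepsilon'}zq^{n-\frac{1-\varepsilon}{2}}\bigr)\bigl(1+(-1)^{\varepsilon'}z^{-1}q^{n-\frac{1+\varepsilon}{2}}\bigr),$$ $\lambda_{r,s}=\frac{r-1}{2}-\frac{s}{2a}$, and $$\chi_{r,s}(\tau)=\frac1{\eta(\tau)}\sum_{n\in\mathbb Z}\Bigl(q^{pp'(n+\frac{rp'-sp}{2pp'})^2}-q^{pp'(n+\frac{-rp'-sp}{2pp'})^2}\Bigr),$$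 $$\Psi_{r,s}(u;\tau)=\sum_{n\in\mathbb Z}\left(\frac{q^{pp'(n+\frac{rp'-sp}{2pp'})^2}}{1-zq^{pn}}-\frac{q^{pp'(n+\frac{-rp'-sp}{2pp'})^2}}{1-zq^{pn-r}}\right).$$ Let $K_{p,p'}=\{(m,n)\in\mathbb Z^2: 1\le m\le p-1,\ 1\le n\le p'-1,\ mp'+np\le pp'\}$, and let $\mathscr S_{p,p'}$ be the finite set of integer triples $(r,s;\theta)$ with $1\le r\le p-1$, $0\le s\le p'-1$ for which $2m+2p'-p=2(r-2\theta)p'-(2s+1)p$ for some integer $0\le m\le p-1$. The typical functions are $$\mathbf T^{\varepsilon,\varepsilon'}_{r,s;x}(\tau,u,t)=(-1)^{\varepsilon\varepsilon'}q^{a(x-\frac{i\varepsilon}{2})^2}z^{2ia(x-\frac{i\varepsilon}{2})}w^{3(1-2a)}\frac{\vartheta_{\varepsilon,\varepsilon'}(u;\tau)}{\eta(\tau)^2}\chi_{r,s}(\tau),$$ and the atypical functions are the meromorphic functions $$\mathbf A^{\varepsilon,\varepsilon'}_{r,s;\theta}(\tau,u,t)=(-1)^{\varepsilon\varepsilon'}q^{-a(\lambda_{r,s}-\theta+\frac{\varepsilon}{2})^2}z^{2a(\lambda_{r,s}-\theta+\frac{\varepsilon}{2})}w^{3(1-2a)}\frac{\vartheta_{\varepsilon,\varepsilon'}(u;\tau)}{\eta(\tau)^3}\Psi_{r,s}(u_{\varepsilon,\varepsilon'}+\theta\tau;\tau),$$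 with $u_{\varepsilon,\varepsilon'}=u+\frac{1-\varepsilon}{2}\tau+\frac{1-\varepsilon'}{2}$. Put $$S^{aa,(\varepsilon,\varepsilon')}_{(r,s;\theta),(r',s';\theta')}=i^{-\varepsilon\varepsilon'}(-1)^{(1-\varepsilon')s+(1-\varepsilon)s'}\frac2p\sin(\pi arr')\,e^{\pi ia(r-2\theta-1+\varepsilon)(r'-2\theta'-1+\varepsilon')},$$ $$S^{at,(\varepsilon,\varepsilon')}_{(r,s;\theta),(r',s';x)}=-\,i^{-\varepsilon\varepsilon'}(-1)^{r's+rs'}\frac2p\sin(\pi arr')\,\frac{\sin\bigl(\frac{\pi ss'}{a}\bigr)e^{2\pi x}+\sin(2\pi\lambda_{r',(1+s)s'})}{\cosh(2\pi x)-\cos(2\pi\lambda_{r',s'})}\,e^{-4\pi a(\lambda_{r,s}-\theta+\frac{\varepsilon}{2})(x-\frac{i\varepsilon'}{2})}.$$ **Theorem.** Let $1\le r\le p-1$, $0\le s\le p'-1$, $\theta\in\mathbb Z$. For all $\tau\in\mathbb H$ and $u,t\in\mathbb C$, the singularity (if any) at $u$ of the expression defining $\mathbf A^{\varepsilon,\varepsilon'}_{r,s;\theta}(\tau,\cdot,t)$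 is removable, so that $\mathbf A$ has a value at every point, given by the limit; the integrals below converge absolutely; and $$\mathbf A^{\varepsilon,\varepsilon'}_{r,s;\theta}\Bigl(-\frac1\tau,\frac u\tau,t-\frac{u^2}{6\tau}\Bigr)=\sum_{(r',s';\theta')\in\mathscr S_{p,p'}}S^{aa,(\varepsilon,\varepsilon')}_{(r,s;\theta),(r',s';\theta')}\mathbf A^{\varepsilon',\varepsilon}_{r',s';\theta'}(\tau,u,t)+\sum_{(r'',s'')\in K_{p,p'}}\int_{\mathbb R}S^{at,(\varepsilon,\varepsilon')}_{(r,s;\theta),(r'',s'';x)}\mathbf T^{\varepsilon',\varepsilon}_{r'',s'';x}(\tau,u,t)\,dx,$$ $$\mathbf A^{\varepsilon,\varepsilon'}_{r,s;\theta}(\tau+1,u,t)=e^{2\pi i\left[(ar-s)(\theta+\frac{1-\varepsilon}{2})-a(\theta+\frac{1-\varepsilon}{2})^2-\frac{1-\varepsilon}{8}\right]}\mathbf A^{\varepsilon,\varepsilon\varepsilon'+(1-\varepsilon)(1-\varepsilon')}_{r,s;\theta}(\tau,u,t).$$ -/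

import Mathlib

open Complex Filter Topology MeasureTheory

noncomputable section

namespace N2Char

/-- `expTwoPi x = e^{2 π i x}`; so `q ^ α = expTwoPi (α * τ)`, `z ^ α = expTwoPi (α * u)` and
`w ^ α = expTwoPi (α * t)` for `(q, z, w) = (e^{2 π i τ}, e^{2 π i u}, e^{2 π i t})`. -/
def expTwoPi (x : ℂ) : ℂ := cexp (2 * Real.pi * I * x)

/-- The theta functions
`z^{ε/2} q^{ε/8} ∏_{n>0} (1 - q^n) (1 + (-1)^{ε'} z q^{n-(1-ε)/2}) (1 + (-1)^{ε'} z⁻¹ q^{n-(1+ε)/2})`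
for `ε, ε' ∈ {0, 1}`. -/
def theta (ε ε' : ℤ) (u τ : ℂ) : ℂ :=
  expTwoPi (ε / 2 * u) * expTwoPi (ε / 8 * τ) *
    ∏' k : ℕ,
      ((1 - expTwoPi ((k + 1) * τ)) *
        (1 + (-1) ^ ε' * expTwoPi (u + ((k + 1) - (1 - ε) / 2) * τ)) *
        (1 + (-1) ^ ε' * expTwoPi (-u + ((k + 1) - (1 + ε) / 2) * τ)))

/-- The ratio `a = p' / p`. -/
def ratio (p p' : ℕ) : ℂ := (p' : ℂ) / (p : ℂ)

/-- `λ_{r,s} = (r - 1) / 2 - s / (2 a)`. -/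
def lam (p p' : ℕ) (r s : ℤ) : ℂ := ((r : ℂ) - 1) / 2 - (s : ℂ) / (2 * ratio p p')

/-- The finite set `K_{p,p'}`. -/
def kacSet (p p' : ℕ) : Finset (ℤ × ℤ) :=
  (Finset.Icc (1 : ℤ) (p - 1) ×ˢ Finset.Icc (1 : ℤ) (p' - 1)).filter
    fun μ => μ.1 * p' + μ.2 * p ≤ p * p'

open Classical in
/-- The discrete spectra: all `(r, s, θ)` with `1 ≤ r ≤ p - 1`, `0 ≤ s ≤ p' - 1`, `θ ∈ ℤ` that
solve `2 m + 2 p' - p = 2 (r - 2 θ) p' - (2 s + 1) p` for some `0 ≤ m ≤ p - 1`. The bound on `θ`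
is only there to have a `Finset`: see `mem_discreteSpectra`. -/
def discreteSpectra (p p' : ℕ) : Finset (ℤ × ℤ × ℤ) :=
  (Finset.Icc (1 : ℤ) (p - 1) ×ˢ Finset.Icc (0 : ℤ) (p' - 1) ×ˢ Finset.Icc (-(p : ℤ)) p).filter
    fun l => ∃ m : ℤ, (0 ≤ m ∧ m ≤ p - 1) ∧
      2 * m + 2 * (p' : ℤ) - p = 2 * (l.1 - 2 * l.2.2) * p' - (2 * l.2.1 + 1) * p

theorem mem_discreteSpectra (p p' : ℕ) (r s θ : ℤ) :
    (r, s, θ) ∈ discreteSpectra p p' ↔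
      (1 ≤ r ∧ r ≤ p - 1) ∧ (0 ≤ s ∧ s ≤ p' - 1) ∧
        ∃ m : ℤ, (0 ≤ m ∧ m ≤ p - 1) ∧
          2 * m + 2 * (p' : ℤ) - p = 2 * (r - 2 * θ) * p' - (2 * s + 1) * p := by
  simp only [discreteSpectra, Finset.mem_filter, Finset.mem_product, Finset.mem_Icc]
  constructor
  · rintro ⟨⟨hr, hs, -⟩, m, hm, h⟩
    exact ⟨hr, hs, m, hm, h⟩
  · rintro ⟨hr, hs, m, hm, h⟩
    refine ⟨⟨hr, hs, ?_, ?_⟩, m, hm, h⟩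
    · by_contra hc
      have h1 : θ + p + 1 ≤ 0 := by omega
      have h2 : (0 : ℤ) < p' := by omega
      nlinarith [mul_nonneg (sub_nonneg.2 hs.2) (by omega : (0 : ℤ) ≤ p),
        mul_nonneg (by omega : (0 : ℤ) ≤ r) h2.le, mul_nonneg (neg_nonneg.2 h1) h2.le]
    · by_contra hc
      have h1 : 0 ≤ θ - p - 1 := by omega
      have h2 : (0 : ℤ) < p' := by omega
      nlinarith [mul_nonneg hs.1 (by omega : (0 : ℤ) ≤ p),
        mul_nonneg (by omega : (0 : ℤ) ≤ p - 1 - r) h2.le, mul_nonneg h1 h2.le]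

/-- The normalized character `χ_{r,s}(τ)` of the BPZ minimal series. -/
def chi (p p' : ℕ) (r s : ℤ) (τ : ℂ) : ℂ :=
  1 / ModularForm.eta τ *
    ∑' n : ℤ,
      (expTwoPi ((p * p' : ℂ) * (n + ((r : ℂ) * p' - s * p) / (2 * p * p')) ^ 2 * τ) -
        expTwoPi ((p * p' : ℂ) * (n + (-(r : ℂ) * p' - s * p) / (2 * p * p')) ^ 2 * τ))

/-- The typical character function `T^{ε,ε'}_{r,s;x}(τ, u, t)`. -/
def typicalChar (p p' : ℕ) (ε ε' : ℤ) (r s : ℤ) (x : ℂ) (τ u t : ℂ) : ℂ :=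
  (-1) ^ (ε * ε') * expTwoPi (ratio p p' * (x - I * ε / 2) ^ 2 * τ) *
    expTwoPi (2 * I * ratio p p' * (x - I * ε / 2) * u) *
    expTwoPi (3 * (1 - 2 * ratio p p') * t) *
    (theta ε ε' u τ / ModularForm.eta τ ^ 2) * chi p p' r s τ

/-- The meromorphic function `Ψ_{p,p';r,s}(u; τ)`. -/
def Psi (p p' : ℕ) (r s : ℤ) (u τ : ℂ) : ℂ :=
  ∑' n : ℤ,
    (expTwoPi ((p * p' : ℂ) * (n + ((r : ℂ) * p' - s * p) / (2 * p * p')) ^ 2 * τ) /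
        (1 - expTwoPi (u + (p * n : ℂ) * τ)) -
      expTwoPi ((p * p' : ℂ) * (n + (-(r : ℂ) * p' - s * p) / (2 * p * p')) ^ 2 * τ) /
        (1 - expTwoPi (u + ((p * n : ℂ) - r) * τ)))

/-- The explicit expression for the atypical character function, with
`u_{ε,ε'} = u + (1 - ε) / 2 * τ + (1 - ε') / 2`. It is literally correct away from the poles of
`Psi`. -/
def atypicalExpr (p p' : ℕ) (ε ε' : ℤ) (r s θ : ℤ) (τ u t : ℂ) : ℂ :=
  (-1) ^ (ε * ε') * expTwoPi (-ratio p p' * (lam p p' r s - θ + ε / 2) ^ 2 * τ) *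
    expTwoPi (2 * ratio p p' * (lam p p' r s - θ + ε / 2) * u) *
    expTwoPi (3 * (1 - 2 * ratio p p') * t) *
    (theta ε ε' u τ / ModularForm.eta τ ^ 3) *
    Psi p p' r s (u + (1 - ε) / 2 * τ + (1 - ε') / 2 + θ * τ) τ

/-- The atypical character function `A^{ε,ε'}_{r,s;θ}(τ, u, t)`: the meromorphic function given by
`atypicalExpr`. The poles of `Psi` are cancelled by zeros of `theta`, so its value at every point is
the limit of the explicit expression along `v → u`, `v ≠ u`. -/
def atypicalChar (p p' : ℕ) (ε ε' : ℤ) (r s θ : ℤ) (τ u t : ℂ) : ℂ :=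
  limUnder (𝓝[≠] u) fun v => atypicalExpr p p' ε ε' r s θ τ v t

/-- The atypical-atypical `S`-data. -/
def sAA (p p' : ℕ) (ε ε' : ℤ) (r s θ r' s' θ' : ℤ) : ℂ :=
  I ^ (-(ε * ε')) * (-1) ^ ((1 - ε') * s + (1 - ε) * s') * (2 / (p : ℂ)) *
    Complex.sin (Real.pi * ratio p p' * r * r') *
    cexp (Real.pi * I * ratio p p' * (r - 2 * θ - 1 + ε) * (r' - 2 * θ' - 1 + ε'))

/-- The atypical-typical `S`-data. -/
def sAT (p p' : ℕ) (ε ε' : ℤ) (r s θ r' s' : ℤ) (x : ℝ) : ℂ :=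
  -(I ^ (-(ε * ε')) * (-1) ^ (r' * s + r * s') * (2 / (p : ℂ)) *
    Complex.sin (Real.pi * ratio p p' * r * r') *
    ((Complex.sin (Real.pi * s * s' / ratio p p') * cexp (2 * Real.pi * x) +
        Complex.sin (2 * Real.pi * lam p p' r' ((1 + s) * s'))) /
      (Complex.cosh (2 * Real.pi * x) - Complex.cos (2 * Real.pi * lam p p' r' s'))) *
    cexp (-4 * Real.pi * ratio p p' * (lam p p' r s - θ + ε / 2) * (x - I * ε' / 2)))

end N2Char

end

noncomputable section

namespace N2Char

/-! Write a = p'/p and y = u + (1-ε)τ/2 + (1-ε')/2. Up to an explicit exponential, every atypical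
function is `thetaEta y τ * psiBlock p p' r s θ y τ` (`atypicalExpr_eq`). The first factor is
ϑ₁₁/η³; the second is Ψ renormalized, a difference of two Appell–Lerch series over the residue
classes x ≡ θ and x ≡ θ - r mod p, with numerators q^{ax²} e^{2πiμ(y+xτ)} for the same μ = a(r-2θ) -
s. The zeros of the theta factor cancel the poles of the block, so singularities are removable and
identities need only be proved on punctured neighbourhoods.

The analytic core is `appell_inversion`: an Appell–Lerch series at modulus -1/T equals one at
modulus T minus i times a finite sum of Mordell integrals weighted by theta constants. Both the
failure of quasi-periodicity of the series and that of the Mordell sum are theta series. Under V ↦ V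
+ T the Mordell contour crosses one pole per summand; under V ↦ V + 1 Gaussian integrals appear, and
Jacobi inversion turns their sum into a theta series. The defects cancel, so the difference D of the
two sides, times `thetaEta`, is entire with multipliers -1 and const · e^{2πi(2N-1)V}. Since 2N - 1
> 0, Liouville's theorem forces it to vanish (`quasiperiodic_const`). The same argument with trivial
multipliers gives `thetaEta_inversion`.

The formula is applied with N = p', T = τ/p, V = (v-θ)/p and V = (v-θ+r)/p. In the Appell part, 1/(1
- e^{2πi(Y/p)}) is expanded as a geometric sum of p terms over 1 - e^{2πiY}. Its exponents m = 0,
..., p-1 index fibres of the discrete spectrum, and on each fibre a finite sine sum selects the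
right residue classes (`sum_discreteSpectra_fiber`, `sum_discreteSpectra_psiBlock`).

In the Mordell part, the sum runs over residues n mod 2pp', written n = Ap' + Bp by the Chinese
remainder theorem. Symmetries fold it onto `kacSet` (`sum_fold_kacSet`). The theta constants combine
into -ηχ (`eta_mul_chi`), and the two Mordell kernels, moved to the line Im = -1/2, combine by
partial fractions into the hyperbolic kernel of the S-data (`kacKernel_eq`, `mordell_grid_sub`).
Both parts meet in `psiBlock_inversion`; what remains is bookkeeping of phases.

The T-transformation is termwise: τ ↦ τ + 1 multiplies both blocks by the same root of unity and at
most translates y by a half period. -/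

/-! ### The exponential e^{2πix}. -/

theorem expTwoPi_add (x y : ℂ) : expTwoPi (x + y) = expTwoPi x * expTwoPi y := by
  rw [expTwoPi, expTwoPi, expTwoPi, ← Complex.exp_add]; ring_nf

theorem expTwoPi_zero : expTwoPi 0 = 1 := by simp [expTwoPi]

theorem expTwoPi_ne_zero (x : ℂ) : expTwoPi x ≠ 0 := Complex.exp_ne_zero _

theorem expTwoPi_neg (x : ℂ) : expTwoPi (-x) = (expTwoPi x)⁻¹ := by
  rw [expTwoPi, expTwoPi, ← Complex.exp_neg]; ring_nf

theorem expTwoPi_sub (x y : ℂ) : expTwoPi (x - y) = expTwoPi x / expTwoPi y := by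
  rw [sub_eq_add_neg, expTwoPi_add, expTwoPi_neg, div_eq_mul_inv]

theorem expTwoPi_intCast (n : ℤ) : expTwoPi n = 1 := by
  rw [expTwoPi, Complex.exp_eq_one_iff]; exact ⟨n, by ring⟩

theorem expTwoPi_one : expTwoPi 1 = 1 := by simpa using expTwoPi_intCast 1

theorem expTwoPi_add_int (x : ℂ) (n : ℤ) : expTwoPi (x + n) = expTwoPi x := by
  rw [expTwoPi_add, expTwoPi_intCast, mul_one]

theorem expTwoPi_eq_of_sub_int {x y : ℂ} (n : ℤ) (h : x = y + n) : expTwoPi x = expTwoPi y := by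
  rw [h, expTwoPi_add_int]

theorem expTwoPi_eq_one_iff (x : ℂ) : expTwoPi x = 1 ↔ ∃ n : ℤ, x = n := by
  rw [expTwoPi, Complex.exp_eq_one_iff]
  refine exists_congr fun n => ?_
  rw [mul_comm (n : ℂ), mul_right_inj' Complex.two_pi_I_ne_zero]

theorem expTwoPi_half : expTwoPi (1 / 2) = -1 := by
  rw [expTwoPi, show 2 * (Real.pi : ℂ) * I * (1 / 2) = Real.pi * I by ring, Complex.exp_pi_mul_I]

theorem expTwoPi_quarter : expTwoPi (1 / 4) = I := by
  rw [expTwoPi, show 2 * (Real.pi : ℂ) * I * (1 / 4) = Real.pi / 2 * I by ring,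
    Complex.exp_pi_div_two_mul_I]

theorem expTwoPi_nat_mul (n : ℕ) (x : ℂ) : expTwoPi (n * x) = expTwoPi x ^ n := by
  rw [expTwoPi, expTwoPi, ← Complex.exp_nat_mul]; ring_nf

theorem expTwoPi_int_mul (n : ℤ) (x : ℂ) : expTwoPi (n * x) = expTwoPi x ^ n := by
  rw [expTwoPi, expTwoPi, ← Complex.exp_int_mul]; ring_nf

theorem norm_expTwoPi (x : ℂ) : ‖expTwoPi x‖ = Real.exp (-2 * Real.pi * x.im) := by
  rw [expTwoPi, Complex.norm_exp]
  simp

@[fun_prop]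
theorem differentiable_expTwoPi : Differentiable ℂ expTwoPi := by
  unfold expTwoPi; fun_prop

@[fun_prop]
theorem continuous_expTwoPi : Continuous expTwoPi := differentiable_expTwoPi.continuous

theorem hasDerivAt_expTwoPi (x : ℂ) :
    HasDerivAt expTwoPi (2 * Real.pi * I * expTwoPi x) x := by
  have := ((hasDerivAt_id x).const_mul (2 * Real.pi * I : ℂ)).cexp
  refine this.congr_deriv ?_
  simp [expTwoPi, mul_comm]

/-- `1 / (1 - e^{2πiw})` is bounded on `|Im w| ≥ δ`. -/
theorem norm_inv_one_sub_expTwoPi_le {δ : ℝ} (hδ : 0 < δ) {w : ℂ} (hw : δ ≤ |w.im|) :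
    ‖(1 - expTwoPi w)⁻¹‖ ≤ (1 - Real.exp (-2 * Real.pi * δ))⁻¹ := by
  have hπ := Real.pi_pos
  have h1 : Real.exp (-2 * Real.pi * δ) < 1 := by
    rw [Real.exp_lt_one_iff]; nlinarith [mul_pos hπ hδ]
  rw [norm_inv]
  refine inv_anti₀ (by linarith) ?_
  rcases le_abs'.1 hw with h | h
  · have h2 : Real.exp (2 * Real.pi * δ) ≤ ‖expTwoPi w‖ := by
      rw [norm_expTwoPi]; apply Real.exp_le_exp.2; nlinarith
    have h3 := norm_sub_norm_le (expTwoPi w) 1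
    rw [norm_sub_rev] at h3
    have h4 : Real.exp (-2 * Real.pi * δ) * Real.exp (2 * Real.pi * δ) = 1 := by
      rw [← Real.exp_add]; simp
    have h5 := Real.exp_pos (-2 * Real.pi * δ)
    have h6 : 1 ≤ Real.exp (2 * Real.pi * δ) := Real.one_le_exp (by positivity)
    simp only [norm_one] at h3
    nlinarith
  · have h2 : ‖expTwoPi w‖ ≤ Real.exp (-2 * Real.pi * δ) := by
      rw [norm_expTwoPi]; apply Real.exp_le_exp.2; nlinarith
    have h3 := norm_sub_norm_le 1 (expTwoPi w)
    simp only [norm_one] at h3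
    linarith

/-! ### Removable singularities and punctured limits. -/

/-- `H` agrees near `z`, away from `z`, with a function that is analytic at `z`. -/
def RemovableAt (H : ℂ → ℂ) (z : ℂ) : Prop :=
  ∃ h : ℂ → ℂ, AnalyticAt ℂ h z ∧ H =ᶠ[𝓝[≠] z] h

theorem RemovableAt.tendsto_limUnder {H : ℂ → ℂ} {z : ℂ} (hH : RemovableAt H z) :
    Tendsto H (𝓝[≠] z) (𝓝 (limUnder (𝓝[≠] z) H)) := by
  obtain ⟨h, ha, he⟩ := hH
  exact tendsto_nhds_limUnder
    ⟨h z, (ha.continuousAt.tendsto.mono_left nhdsWithin_le_nhds).congr' he.symm⟩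

theorem RemovableAt.congr {H K : ℂ → ℂ} {z : ℂ} (hH : RemovableAt H z)
    (h : K =ᶠ[𝓝[≠] z] H) : RemovableAt K z := by
  obtain ⟨g, ha, he⟩ := hH
  exact ⟨g, ha, h.trans he⟩

theorem AnalyticAt.removableAt {H : ℂ → ℂ} {z : ℂ} (hH : AnalyticAt ℂ H z) : RemovableAt H z :=
  ⟨H, hH, EventuallyEq.rfl⟩

/-- The values at points v ≠ z near z are also covered because `H = h` on a whole neighbourhood of
such v; hence the function of punctured limits is itself analytic at z. -/
theorem eventually_eq_limUnder {H h : ℂ → ℂ} {z : ℂ} (ha : AnalyticAt ℂ h z)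
    (he : H =ᶠ[𝓝[≠] z] h) : (fun v => limUnder (𝓝[≠] v) H) =ᶠ[𝓝 z] h := by
  have h1 : ∀ᶠ v in 𝓝 z, H =ᶠ[𝓝[≠] v] h := by
    rw [Filter.EventuallyEq, eventually_nhdsWithin_iff] at he
    have h2 := he.eventually_nhds
    filter_upwards [h2, (eventually_eventually_nhds (x := z)).2 he] with v hv _
    by_cases hvz : v = z
    · subst hvz
      exact eventually_nhdsWithin_iff.2 hv
    · have h3 : ∀ᶠ y in 𝓝 v, y ≠ z := isOpen_ne.mem_nhds hvz
      filter_upwards [mem_nhdsWithin_of_mem_nhds hv, mem_nhdsWithin_of_mem_nhds h3] with y hy hy'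
      exact hy hy'
  filter_upwards [h1, ha.eventually_analyticAt] with v hv hav
  exact ((hav.continuousAt.tendsto.mono_left nhdsWithin_le_nhds).congr' hv.symm).limUnder_eq

theorem differentiable_limUnder {H : ℂ → ℂ} (hH : ∀ z, RemovableAt H z) :
    Differentiable ℂ fun v => limUnder (𝓝[≠] v) H := by
  intro z
  obtain ⟨h, ha, he⟩ := hH z
  exact (ha.congr (eventually_eq_limUnder ha he).symm).differentiableAt

theorem eventuallyEq_limUnder_punctured {H : ℂ → ℂ} {z : ℂ} (hH : RemovableAt H z) :
    H =ᶠ[𝓝[≠] z] fun v => limUnder (𝓝[≠] v) H := by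
  obtain ⟨h, ha, he⟩ := hH
  filter_upwards [he, mem_nhdsWithin_of_mem_nhds (eventually_eq_limUnder ha he)] with v h1 h2
  rw [h1, h2]

theorem map_add_punctured (z w : ℂ) : map (fun v => v + w) (𝓝[≠] z) = 𝓝[≠] (z + w) := by
  have := (Homeomorph.addRight w).isEmbedding.map_nhdsWithin_eq {z}ᶜ z
  rwa [Set.image_compl_eq (Homeomorph.addRight w).bijective, Set.image_singleton] at this

theorem map_mul_punctured {c : ℂ} (hc : c ≠ 0) (z : ℂ) :
    map (fun v => c * v) (𝓝[≠] z) = 𝓝[≠] (c * z) := by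
  have := (Homeomorph.mulLeft₀ c hc).isEmbedding.map_nhdsWithin_eq {z}ᶜ z
  rwa [Set.image_compl_eq (Homeomorph.mulLeft₀ c hc).bijective, Set.image_singleton] at this

/-! ### Liouville's theorem for quasi-periodic functions. -/

/-- A function that is doubly periodic up to factors making its growth at most bounded is constant. -/
theorem entire_quasiperiodic_const {T : ℂ} (hT : 0 < T.im) {H : ℂ → ℂ} (hH : Differentiable ℂ H)
    {u c : ℂ} {m : ℝ} (hu : ‖u‖ = 1) (hc : c ≠ 0) (hm : 0 < m ∨ m = 0 ∧ ‖c‖ = 1)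
    (h1 : ∀ v, H (v + 1) = u * H v) (h2 : ∀ v, H (v + T) = c * expTwoPi (m * v) * H v) :
    ∃ C, ∀ v, H v = C := by
  have hπ := Real.pi_pos
  -- β is the solution of Q(y + Im T) = Q(y) + 2πmy - log‖c‖, which makes ‖H‖ e^{Q(Im v)} periodic
  -- under both 1 and T, hence bounded.
  set β : ℝ := (-Real.log ‖c‖ - Real.pi * m * T.im) / T.im with hβ
  set Q : ℝ → ℝ := fun y => Real.pi * m / T.im * y ^ 2 + β * y with hQ
  set B : ℂ → ℝ := fun v => ‖H v‖ * Real.exp (Q v.im) with hB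
  have hc' : 0 < ‖c‖ := norm_pos_iff.2 hc
  have hQT : ∀ y, Q (y + T.im) = Q y + 2 * Real.pi * m * y - Real.log ‖c‖ := by
    intro y
    simp only [hQ, hβ]
    field_simp
    ring
  have hB1 : Function.Periodic B 1 := by
    intro v
    simp [hB, h1, hu]
  have hBT : Function.Periodic B T := by
    intro v
    simp only [hB, h2, norm_mul, norm_expTwoPi, Complex.add_im, hQT]
    rw [show Q v.im + 2 * Real.pi * m * v.im - Real.log ‖c‖ =
      Q v.im + (2 * Real.pi * m * v.im) + (- Real.log ‖c‖) by ring, Real.exp_add, Real.exp_add,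
      Real.exp_neg (Real.log _), Real.exp_log hc', show (-2 * Real.pi * ((m : ℂ) * v).im) =
        -(2 * Real.pi * m * v.im) by simp; ring, Real.exp_neg]
    field_simp
  have hBc : Continuous B := by
    have := hH.continuous
    simp only [hB, hQ]
    fun_prop
  obtain ⟨M, hM⟩ := (isCompact_closedBall (0 : ℂ) (1 + T.im)).exists_bound_of_continuousOn
    hBc.continuousOn
  have hBM : ∀ v, B v ≤ M := by
    intro v
    set b : ℤ := ⌊v.im / T.im⌋ with hb
    set a : ℤ := ⌊(v - b * T).re⌋ with ha
    have e1 : B v = B (v - b * T - a) := by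
      have := hB1.sub_zsmul_eq (x := v - b * T) a
      have h' := hBT.sub_zsmul_eq (x := v) b
      simp only [zsmul_eq_mul, mul_one] at this h'
      rw [this, h']
    rw [e1]
    refine (le_abs_self _).trans (hM _ ?_)
    rw [mem_closedBall_zero_iff]
    refine (Complex.norm_le_abs_re_add_abs_im _).trans (add_le_add ?_ ?_)
    · have h3 := Int.floor_le (v - b * T).re
      have h4 := Int.lt_floor_add_one (v - b * T).re
      rw [Complex.sub_re, Complex.intCast_re, abs_le]
      constructor <;> linarith
    · have h3 := Int.floor_le (v.im / T.im)
      have h4 := Int.lt_floor_add_one (v.im / T.im)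
      rw [le_div_iff₀ hT] at h3
      rw [div_lt_iff₀ hT] at h4
      simp only [Complex.sub_im, Complex.mul_im, Complex.intCast_re, Complex.intCast_im, zero_mul,
        add_zero, sub_zero]
      rw [abs_le]
      constructor <;> nlinarith
  -- A lower bound for Q turns the bound on B into a bound on H. For m > 0 it comes from completing
  -- the square; for m = 0 and ‖c‖ = 1 both coefficients of Q vanish.
  have hQ0 : ∃ q, ∀ y, q ≤ Q y := by
    rcases hm with hm | ⟨rfl, hc1⟩
    · set α := Real.pi * m / T.im with hα
      have hα0 : 0 < α := by positivity
      refine ⟨-(β ^ 2 / (4 * α)), fun y => ?_⟩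
      have : Q y + β ^ 2 / (4 * α) = α * (y + β / (2 * α)) ^ 2 := by
        simp only [hQ]; field_simp; ring
      nlinarith [mul_nonneg hα0.le (sq_nonneg (y + β / (2 * α)))]
    · refine ⟨0, fun y => ?_⟩
      simp [hQ, hβ, hc1]
  obtain ⟨q, hq⟩ := hQ0
  have hbd : Bornology.IsBounded (Set.range H) := by
    rw [isBounded_iff_forall_norm_le]
    refine ⟨M * Real.exp (-q), ?_⟩
    rintro _ ⟨v, rfl⟩
    have h3 := hBM v
    have h4 : Real.exp q ≤ Real.exp (Q v.im) := Real.exp_le_exp.2 (hq _)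
    have h5 : ‖H v‖ * Real.exp q ≤ M :=
      (mul_le_mul_of_nonneg_left h4 (norm_nonneg _)).trans h3
    rw [Real.exp_neg, ← div_eq_mul_inv, le_div_iff₀ (Real.exp_pos _)]
    exact h5
  exact hH.exists_const_forall_eq_of_bounded hbd

theorem quasiperiodic_const {T : ℂ} (hT : 0 < T.im) {H : ℂ → ℂ} (hH : ∀ z, RemovableAt H z)
    {u c : ℂ} {m : ℝ} (hu : ‖u‖ = 1) (hc : c ≠ 0) (hm : 0 < m ∨ m = 0 ∧ ‖c‖ = 1)
    (h1 : ∀ z, ∀ᶠ v in 𝓝[≠] z, H (v + 1) = u * H v)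
    (h2 : ∀ z, ∀ᶠ v in 𝓝[≠] z, H (v + T) = c * expTwoPi (m * v) * H v) :
    ∃ C, (∀ z, ∀ᶠ v in 𝓝[≠] z, H v = C) ∧ (0 < m → C = 0) := by
  set K : ℂ → ℂ := fun v => limUnder (𝓝[≠] v) H with hK
  have hKd : Differentiable ℂ K := differentiable_limUnder hH
  have hHK : ∀ z, H =ᶠ[𝓝[≠] z] K := fun z => eventuallyEq_limUnder_punctured (hH z)
  have shift : ∀ w : ℂ, ∀ F : ℂ → ℂ, Continuous F →
      (∀ z, ∀ᶠ v in 𝓝[≠] z, H (v + w) = F v * H v) → ∀ v, K (v + w) = F v * K v := by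
    intro w F hF h z
    have e1 : ∀ᶠ v in 𝓝[≠] z, H (v + w) = K (v + w) := by
      have := hHK (z + w)
      rw [← map_add_punctured] at this
      exact this
    have e2 : (fun v => K (v + w)) =ᶠ[𝓝[≠] z] fun v => F v * K v := by
      filter_upwards [e1, hHK z, h z] with v a b d
      rw [← a, d, b]
    have t1 : Tendsto (fun v => K (v + w)) (𝓝[≠] z) (𝓝 (K (z + w))) :=
      ((hKd.continuous.comp (continuous_add_const w)).tendsto z).mono_left nhdsWithin_le_nhds
    have t2 : Tendsto (fun v => F v * K v) (𝓝[≠] z) (𝓝 (F z * K z)) :=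
      ((hF.mul hKd.continuous).tendsto z).mono_left nhdsWithin_le_nhds
    exact tendsto_nhds_unique (t1.congr' e2) t2
  have k1 := shift 1 (fun _ => u) continuous_const h1
  have k2 := shift T (fun v => c * expTwoPi (m * v)) (by fun_prop) h2
  obtain ⟨C, hC⟩ := entire_quasiperiodic_const hT hKd hu hc hm k1 k2
  refine ⟨C, fun z => (hHK z).mono fun v hv => by rw [hv, hC], fun hm0 => ?_⟩
  -- A nonzero constant would force c e^{2πimv} = 1 for all v; the points v = 0 and v = i/m
  -- contradict this.
  by_contra hC0
  have h0 := k2 0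
  have h3 := k2 (I / m)
  rw [hC, hC, mul_zero, expTwoPi_zero, mul_one] at h0
  have hc1 : c = 1 := mul_right_cancel₀ hC0 (by rw [one_mul]; exact h0.symm)
  have hm' : (m : ℂ) ≠ 0 := by exact_mod_cast hm0.ne'
  rw [hC, hC, hc1, one_mul, mul_div_cancel₀ _ hm'] at h3
  have h4 : expTwoPi I = 1 := mul_right_cancel₀ hC0 (by rw [one_mul]; exact h3.symm)
  have h5 := norm_expTwoPi I
  rw [h4, norm_one, eq_comm, Real.exp_eq_one_iff, Complex.I_im] at h5
  linarith [Real.pi_pos]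

/-! ### The function ϑ₁₁/η³ and its modular inversion. -/

/-- The `q`-Pochhammer symbol `(e^{2πiv}; e^{2πiτ})_∞`. -/
def qPoch (v τ : ℂ) : ℂ := ∏' k : ℕ, (1 - expTwoPi (v + k * τ))

theorem summable_norm_expTwoPi_add_nat_mul (v : ℂ) {τ : ℂ} (hτ : 0 < τ.im) :
    Summable fun k : ℕ => ‖expTwoPi (v + k * τ)‖ := by
  have h : ‖expTwoPi τ‖ < 1 := by
    rw [norm_expTwoPi, Real.exp_lt_one_iff]
    nlinarith [mul_pos Real.pi_pos hτ]
  refine ((summable_geometric_of_lt_one (norm_nonneg _) h).mul_left ‖expTwoPi v‖).congr fun k => ?_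
  rw [expTwoPi_add, expTwoPi_nat_mul, norm_mul, norm_pow]

theorem multipliable_qPoch (v : ℂ) {τ : ℂ} (hτ : 0 < τ.im) :
    Multipliable fun k : ℕ => (1 - expTwoPi (v + k * τ)) := by
  simp only [sub_eq_add_neg]
  exact multipliable_one_add_of_summable (by
    simpa using summable_norm_expTwoPi_add_nat_mul v hτ)

theorem qPoch_eq (v : ℂ) {τ : ℂ} (hτ : 0 < τ.im) :
    qPoch v τ = (1 - expTwoPi v) * qPoch (v + τ) τ := by
  have h : ∀ k : ℕ, v + ((k + 1 : ℕ) : ℂ) * τ = v + τ + k * τ := fun k => by push_cast; ring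
  rw [qPoch, tprod_eq_zero_mul', qPoch]
  · simp only [h]; simp
  · simp only [h]
    exact multipliable_qPoch _ hτ

theorem qPoch_ne_zero {v τ : ℂ} (hτ : 0 < τ.im) (h : ∀ k : ℕ, expTwoPi (v + k * τ) ≠ 1) :
    qPoch v τ ≠ 0 := by
  rw [qPoch]
  simp only [sub_eq_add_neg]
  refine tprod_one_add_ne_zero_of_summable (fun k => ?_) ?_
  · rw [← sub_eq_add_neg, sub_ne_zero]; exact (h k).symm
  · simpa using summable_norm_expTwoPi_add_nat_mul v hτ

theorem qPoch_eq_zero {v τ : ℂ} (k : ℕ) (h : expTwoPi (v + k * τ) = 1) : qPoch v τ = 0 :=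
  tprod_of_exists_eq_zero ⟨k, by rw [h, sub_self]⟩

theorem qPoch_self_ne_zero {τ : ℂ} (hτ : 0 < τ.im) : qPoch τ τ ≠ 0 := by
  refine qPoch_ne_zero hτ fun k h => ?_
  have := norm_expTwoPi (τ + k * τ)
  rw [h, norm_one, eq_comm, Real.exp_eq_one_iff] at this
  have h1 : (τ + k * τ).im = (1 + k) * τ.im := by simp; ring
  have h2 : 0 < (1 + (k : ℝ)) * τ.im := by positivity
  rw [h1] at this
  nlinarith [mul_pos Real.pi_pos h2]

theorem qPoch_add_one (v τ : ℂ) : qPoch (v + 1) τ = qPoch v τ := by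
  rw [qPoch, qPoch]
  refine tprod_congr fun k => ?_
  rw [show v + 1 + k * τ = (v + k * τ) + 1 by ring, expTwoPi_add _ 1, expTwoPi_one, mul_one]

theorem differentiable_qPoch {τ : ℂ} (hτ : 0 < τ.im) : Differentiable ℂ fun v => qPoch v τ := by
  intro z
  have hopen : IsOpen {v : ℂ | z.im - 1 < v.im} := isOpen_lt continuous_const Complex.continuous_im
  -- On the half-plane Im v > Im z - 1 every term is dominated by its value at z - i.
  have key := Summable.hasProdLocallyUniformlyOn_nat_one_add (R := ℂ)
    (f := fun (k : ℕ) (v : ℂ) => -expTwoPi (v + k * τ)) hopen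
    (summable_norm_expTwoPi_add_nat_mul (z - I) hτ)
    (Eventually.of_forall fun k v hv => by
      rw [norm_neg, norm_expTwoPi, norm_expTwoPi]
      apply Real.exp_le_exp.2
      have : z.im - 1 < v.im := hv
      simp only [Complex.add_im, Complex.sub_im, Complex.I_im]
      nlinarith [Real.pi_pos])
    (fun k => by fun_prop)
  have h2 := key.differentiableOn
    (Eventually.of_forall fun s => by
      simpa [Finset.prod_fn] using DifferentiableOn.finsetProd (fun _ _ => by fun_prop)) hopen
  have h3 := h2.differentiableAt (hopen.mem_nhds (show z.im - 1 < z.im by linarith))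
  simpa only [qPoch, sub_eq_add_neg] using h3

/-- `ϑ_{1,1}(v; τ) / η(τ)³`. -/
def thetaEta (v τ : ℂ) : ℂ :=
  (expTwoPi (v / 2) - expTwoPi (-v / 2)) * qPoch (τ + v) τ * qPoch (τ - v) τ / qPoch τ τ ^ 2

theorem differentiable_thetaEta {τ : ℂ} (hτ : 0 < τ.im) : Differentiable ℂ fun v => thetaEta v τ := by
  have h := differentiable_qPoch hτ
  have h1 : Differentiable ℂ fun v => qPoch (τ + v) τ := h.comp (by fun_prop)
  have h2 : Differentiable ℂ fun v => qPoch (τ - v) τ := h.comp (by fun_prop)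
  unfold thetaEta
  fun_prop

theorem thetaEta_eq (v : ℂ) {τ : ℂ} (hτ : 0 < τ.im) :
    thetaEta v τ = expTwoPi (v / 2) * qPoch (v + τ) τ * qPoch (-v) τ / qPoch τ τ ^ 2 := by
  rw [thetaEta, qPoch_eq (-v) hτ, show -v + τ = τ - v by ring, add_comm τ v]
  have : expTwoPi (-v / 2) = expTwoPi (v / 2) * expTwoPi (-v) := by
    rw [← expTwoPi_add]; ring_nf
  rw [this]; ring

theorem thetaEta_add_one (v : ℂ) {τ : ℂ} (hτ : 0 < τ.im) : thetaEta (v + 1) τ = -thetaEta v τ := by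
  rw [thetaEta_eq _ hτ, thetaEta_eq _ hτ, show v + 1 + τ = v + τ + 1 by ring, qPoch_add_one,
    ← qPoch_add_one (-(v + 1)), show -(v + 1) + 1 = -v by ring, add_div, expTwoPi_add, expTwoPi_half]
  ring

/-- An entire function that is not identically zero has isolated zeros. -/
theorem eventually_ne_zero_of_differentiable {f : ℂ → ℂ} (hf : Differentiable ℂ f) {w : ℂ}
    (hw : f w ≠ 0) (z : ℂ) : ∀ᶠ v in 𝓝[≠] z, f v ≠ 0 := by
  by_contra h
  have h1 : ∃ᶠ v in 𝓝[≠] z, f v = 0 := (Filter.not_eventually.1 h).mono fun v hv => not_not.1 hv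
  have h2 := (analyticOnNhd_univ_iff_differentiable.2 hf).eqOn_zero_of_preconnected_of_frequently_eq_zero
    isPreconnected_univ (Set.mem_univ z) h1
  exact hw (h2 (Set.mem_univ w))

theorem eventually_expTwoPi_ne_one {α : ℂ} (hα : α ≠ 0) (c z : ℂ) :
    ∀ᶠ v in 𝓝[≠] z, expTwoPi (α * v + c) ≠ 1 := by
  have h := eventually_ne_zero_of_differentiable (f := fun v => expTwoPi (α * v + c) - 1)
    (by fun_prop) (w := (1 / 2 - c) / α) (by
      rw [mul_div_cancel₀ _ hα, sub_add_cancel, expTwoPi_half]; norm_num) z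
  exact h.mono fun v hv => sub_ne_zero.1 hv

theorem eq_of_eventually_punctured {F G : ℂ → ℂ} {z : ℂ} (hF : ContinuousAt F z)
    (hG : ContinuousAt G z) (h : ∀ᶠ v in 𝓝[≠] z, F v = G v) : F z = G z :=
  tendsto_nhds_unique ((hF.tendsto.mono_left nhdsWithin_le_nhds).congr' h)
    (hG.tendsto.mono_left nhdsWithin_le_nhds)

theorem thetaEta_add_self (v : ℂ) {τ : ℂ} (hτ : 0 < τ.im) :
    thetaEta (v + τ) τ = -expTwoPi (-v - τ / 2) * thetaEta v τ := by
  have hd := differentiable_thetaEta hτ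
  refine eq_of_eventually_punctured (F := fun v => thetaEta (v + τ) τ)
    (G := fun v => -expTwoPi (-v - τ / 2) * thetaEta v τ) (z := v)
    (hd.continuous.comp (continuous_add_const τ)).continuousAt
    (Continuous.continuousAt (by have := hd.continuous; fun_prop)) ?_
  filter_upwards [eventually_expTwoPi_ne_one one_ne_zero τ v] with w hw
  rw [one_mul] at hw
  have hw' : 1 - expTwoPi (w + τ) ≠ 0 := sub_ne_zero.2 hw.symm
  apply mul_left_cancel₀ hw'
  rw [thetaEta_eq _ hτ, thetaEta_eq _ hτ, qPoch_eq (w + τ) hτ, qPoch_eq (-(w + τ)) hτ,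
    show -(w + τ) + τ = -w by ring, add_div, expTwoPi_add (w / 2)]
  have h1 : expTwoPi (τ / 2) = expTwoPi (-w - τ / 2) * expTwoPi (w + τ) := by
    rw [← expTwoPi_add]; ring_nf
  have h2 : expTwoPi (-(w + τ)) * expTwoPi (w + τ) = 1 := by
    rw [← expTwoPi_add, neg_add_cancel, expTwoPi_zero]
  rw [h1]
  linear_combination (1 - expTwoPi (w + τ)) * (- expTwoPi (-w - τ / 2) * expTwoPi (w / 2) *
    qPoch (w + τ + τ) τ * qPoch (-w) τ / qPoch τ τ ^ 2) * h2

theorem thetaEta_ne_zero {v τ : ℂ} (hτ : 0 < τ.im) (h : ∀ x : ℤ, expTwoPi (v + x * τ) ≠ 1) :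
    thetaEta v τ ≠ 0 := by
  rw [thetaEta_eq _ hτ]
  refine div_ne_zero (mul_ne_zero (mul_ne_zero (expTwoPi_ne_zero _) (qPoch_ne_zero hτ fun k hk => ?_))
    (qPoch_ne_zero hτ fun k hk => ?_)) (pow_ne_zero _ (qPoch_self_ne_zero hτ))
  · refine h (k + 1) ?_
    rw [← hk]; push_cast; ring_nf
  · refine h (-k) ?_
    have : v + ((-k : ℤ) : ℂ) * τ = -(-v + k * τ) := by push_cast; ring
    rw [this, expTwoPi_neg, hk, inv_one]

theorem thetaEta_eq_zero {v τ : ℂ} (hτ : 0 < τ.im) (x : ℤ) (h : expTwoPi (v + x * τ) = 1) :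
    thetaEta v τ = 0 := by
  rw [thetaEta_eq _ hτ]
  rcases lt_or_ge 0 x with hx | hx
  · rw [qPoch_eq_zero (v := v + τ) (x - 1).toNat]
    · simp
    · rw [← h]
      have : (((x - 1).toNat : ℤ) : ℂ) = x - 1 := by
        rw [Int.toNat_of_nonneg (by omega)]; push_cast; ring
      rw [Int.cast_natCast] at this
      rw [this]; ring_nf
  · rw [qPoch_eq_zero (v := -v) (-x).toNat]
    · simp
    · have : (((-x).toNat : ℤ) : ℂ) = -x := by
        rw [Int.toNat_of_nonneg (by omega)]; push_cast; ring
      rw [Int.cast_natCast] at this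
      rw [this, show -v + -(x : ℂ) * τ = -(v + x * τ) by ring, expTwoPi_neg, h, inv_one]

/-- `(e^{πiv} - e^{-πiv}) / v`, continued to `v = 0`. -/
def sinSlope : ℂ → ℂ := dslope (fun v => expTwoPi (v / 2) - expTwoPi (-v / 2)) 0

theorem differentiable_sinSlope : Differentiable ℂ sinSlope := by
  have h : DifferentiableOn ℂ (fun v => expTwoPi (v / 2) - expTwoPi (-v / 2)) Set.univ := by fun_prop
  have := (Complex.differentiableOn_dslope (c := (0 : ℂ)) univ_mem).2 h
  exact differentiableOn_univ.1 this

theorem sinSlope_zero : sinSlope 0 = 2 * Real.pi * I := by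
  rw [sinSlope, dslope_same]
  have h1 := (hasDerivAt_expTwoPi ((0 : ℂ) / 2)).comp (0 : ℂ) ((hasDerivAt_id (0 : ℂ)).div_const 2)
  have h2 := (hasDerivAt_expTwoPi (-(0 : ℂ) / 2)).comp (0 : ℂ)
    ((hasDerivAt_id (0 : ℂ)).neg.div_const 2)
  have h3 := (h1.sub h2).deriv
  have h4 : (fun v : ℂ => expTwoPi (v / 2) - expTwoPi (-v / 2)) =
    (expTwoPi ∘ (fun x => id x / 2)) - (expTwoPi ∘ fun x => (-id) x / 2) := by
    ext v; simp
  rw [h4, h3]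
  simp [expTwoPi_zero]; ring

theorem mul_sinSlope (v : ℂ) : v * sinSlope v = expTwoPi (v / 2) - expTwoPi (-v / 2) := by
  have := sub_smul_dslope (fun v : ℂ => expTwoPi (v / 2) - expTwoPi (-v / 2)) 0 v
  simpa [sinSlope] using this

/-- The lattice is the zero set of the entire function `thetaEta`, which is nonzero at 1/2, so
isolation of zeros gives discreteness. -/
theorem eventually_lattice_ne {τ : ℂ} (hτ : 0 < τ.im) (z : ℂ) :
    ∀ᶠ v in 𝓝[≠] z, ∀ x : ℤ, expTwoPi (v + x * τ) ≠ 1 := by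
  have hw : thetaEta (1 / 2) τ ≠ 0 := by
    refine thetaEta_ne_zero hτ fun x hx => ?_
    obtain ⟨n, hn⟩ := (expTwoPi_eq_one_iff _).1 hx
    have h1 := congrArg Complex.im hn
    simp at h1
    rcases h1 with h1 | h1
    · subst h1
      have h2 := congrArg Complex.re hn
      simp at h2
      have h3 : (2 * n : ℝ) = 1 := by rw [← h2]; norm_num
      have h4 : 2 * n = 1 := by exact_mod_cast h3
      omega
    · exact hτ.ne' h1
  refine (eventually_ne_zero_of_differentiable (differentiable_thetaEta hτ) hw z).mono
    fun v hv x hx => hv (thetaEta_eq_zero hτ x hx)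

theorem RemovableAt.comp_add {H : ℂ → ℂ} {z w : ℂ} (h : RemovableAt H (z + w)) :
    RemovableAt (fun v => H (v + w)) z := by
  obtain ⟨g, hg, he⟩ := h
  refine ⟨fun v => g (v + w), hg.fun_comp (f := fun v => v + w) (by fun_prop), ?_⟩
  rw [← map_add_punctured] at he
  exact he

theorem im_neg_one_div_pos {τ : ℂ} (hτ : 0 < τ.im) : 0 < (-1 / τ).im := by
  have hn : 0 < Complex.normSq τ := Complex.normSq_pos.2 (by rintro rfl; simp at hτ)
  rw [neg_div, one_div, Complex.neg_im, Complex.inv_im]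
  rw [neg_div, neg_neg]; positivity

/-- The modular inversion formula of `ϑ_{1,1} / η³`. -/
theorem thetaEta_inversion (v : ℂ) {τ : ℂ} (hτ : 0 < τ.im) :
    thetaEta (v / τ) (-1 / τ) = 1 / τ * expTwoPi (v ^ 2 / (2 * τ)) * thetaEta v τ := by
  have hτ0 : τ ≠ 0 := by rintro rfl; simp at hτ
  have hτ' := im_neg_one_div_pos hτ
  set σ := -1 / τ with hσ
  -- F has the same multipliers under 1 and τ as `thetaEta · τ`, so the quotient R is elliptic.
  set F : ℂ → ℂ := fun v => τ * expTwoPi (-v ^ 2 / (2 * τ)) * thetaEta (v / τ) σ with hF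
  have hd := differentiable_thetaEta hτ
  have hd' := differentiable_thetaEta hτ'
  have hFd : Differentiable ℂ F := by
    have : Differentiable ℂ fun v : ℂ => thetaEta (v / τ) σ := hd'.comp (by fun_prop)
    fun_prop
  have F1 : ∀ v, F (v + 1) = -F v := by
    intro v
    have h1 := thetaEta_add_self ((v + 1) / τ) hτ'
    have h2 : (v + 1) / τ + σ = v / τ := by rw [hσ]; field_simp; ring
    rw [h2] at h1
    simp only [hF]
    rw [h1]
    have h3 : expTwoPi (-v ^ 2 / (2 * τ)) * expTwoPi (-((v + 1) / τ) - σ / 2) =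
        expTwoPi (-(v + 1) ^ 2 / (2 * τ)) := by
      rw [← expTwoPi_add]; congr 1; rw [hσ]; field_simp; ring
    rw [← h3]; ring
  have F2 : ∀ v, F (v + τ) = -expTwoPi (-v - τ / 2) * F v := by
    intro v
    have h2 : (v + τ) / τ = v / τ + 1 := by field_simp
    simp only [hF]
    rw [h2, thetaEta_add_one _ hτ']
    have h3 : expTwoPi (-v ^ 2 / (2 * τ)) * expTwoPi (-v - τ / 2) =
        expTwoPi (-(v + τ) ^ 2 / (2 * τ)) := by
      rw [← expTwoPi_add]; congr 1; field_simp; ring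
    rw [← h3]; ring
  set R : ℂ → ℂ := fun v => F v / thetaEta v τ with hR
  have R1 : ∀ v, R (v + 1) = R v := by
    intro v; simp only [hR]; rw [F1, thetaEta_add_one _ hτ, neg_div_neg_eq]
  have R2 : ∀ v, R (v + τ) = R v := by
    intro v; simp only [hR]; rw [F2, thetaEta_add_self _ hτ, mul_div_mul_left]
    exact neg_ne_zero.2 (expTwoPi_ne_zero _)
  have Rn1 : ∀ (n : ℤ) v, R (v + n) = R v := by
    intro n v
    have := (show Function.Periodic R 1 from R1).int_mul n v
    simpa using this
  have Rn2 : ∀ (n : ℤ) v, R (v + n * τ) = R v := fun n v =>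
    (show Function.Periodic R τ from R2).int_mul n v
  -- Division by η³ normalizes `thetaEta` to slope 2πi at 0 for every modulus. The factor τ in F
  -- compensates the argument v/τ, so R extends to 0 with value 1, and this fixes the constant.
  have R0 : ∃ h : ℂ → ℂ, AnalyticAt ℂ h 0 ∧ R =ᶠ[𝓝[≠] 0] h ∧ h 0 = 1 := by
    have hq := differentiable_qPoch hτ
    have hq' := differentiable_qPoch hτ'
    have ha : AnalyticAt ℂ (fun v => expTwoPi (-v ^ 2 / (2 * τ)) * sinSlope (v / τ) *
        qPoch (σ + v / τ) σ * qPoch (σ - v / τ) σ / qPoch σ σ ^ 2) 0 := by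
      have e1 : Differentiable ℂ fun v => qPoch (σ + v / τ) σ := hq'.comp (by fun_prop)
      have e2 : Differentiable ℂ fun v => qPoch (σ - v / τ) σ := hq'.comp (by fun_prop)
      have e3 : Differentiable ℂ fun v : ℂ => sinSlope (v / τ) :=
        differentiable_sinSlope.comp (by fun_prop)
      refine Differentiable.analyticAt ?_ _
      fun_prop
    have hb : AnalyticAt ℂ (fun v => sinSlope v *
        qPoch (τ + v) τ * qPoch (τ - v) τ / qPoch τ τ ^ 2) 0 := by
      have e1 : Differentiable ℂ fun v => qPoch (τ + v) τ := hq.comp (by fun_prop)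
      have e2 : Differentiable ℂ fun v => qPoch (τ - v) τ := hq.comp (by fun_prop)
      have e3 := differentiable_sinSlope
      refine Differentiable.analyticAt ?_ _
      fun_prop
    have p1 := qPoch_self_ne_zero hτ
    have p2 := qPoch_self_ne_zero hτ'
    have hpi : (2 * Real.pi * I : ℂ) ≠ 0 := Complex.two_pi_I_ne_zero
    refine ⟨_, ha.div hb ?_, ?_, ?_⟩
    · simp only [add_zero, sub_zero, sinSlope_zero]
      refine div_ne_zero ?_ (pow_ne_zero _ p1)
      exact mul_ne_zero (mul_ne_zero hpi p1) p1
    · filter_upwards [self_mem_nhdsWithin] with v hv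
      have hv : v ≠ 0 := hv
      simp only [hR, hF, thetaEta, Pi.div_apply]
      rw [← mul_sinSlope v, show -(v / τ) / 2 = -(v / τ) / 2 from rfl, ← mul_sinSlope (v / τ)]
      rw [show v * sinSlope v * qPoch (τ + v) τ * qPoch (τ - v) τ / qPoch τ τ ^ 2 =
        v * (sinSlope v * qPoch (τ + v) τ * qPoch (τ - v) τ / qPoch τ τ ^ 2) by ring]
      rw [← mul_div_mul_left _ (sinSlope v * qPoch (τ + v) τ * qPoch (τ - v) τ / qPoch τ τ ^ 2) hv]
      congr 1
      field_simp
    · simp only [Pi.div_apply]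
      simp only [add_zero, sub_zero, zero_div, sinSlope_zero, neg_zero, ne_eq, OfNat.ofNat_ne_zero,
        not_false_eq_true, zero_pow, expTwoPi_zero]
      field_simp
  obtain ⟨h0, h0a, h0e, h01⟩ := R0
  have hRrem : ∀ z, RemovableAt R z := by
    intro z
    by_cases hz : thetaEta z τ = 0
    · by_cases hx : ∀ x : ℤ, expTwoPi (z + x * τ) ≠ 1
      · exact absurd hz (thetaEta_ne_zero hτ hx)
      -- Every zero of the denominator is a lattice translate of 0, so periodicity of R carries the
      -- computation at 0 there.
      · push Not at hx
        obtain ⟨x, hx⟩ := hx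
        obtain ⟨n, hn⟩ := (expTwoPi_eq_one_iff _).1 hx
        have hR0 : RemovableAt R (z + (x * τ - n)) := by
          rw [show z + (x * τ - n) = 0 by linear_combination hn]
          exact ⟨h0, h0a, h0e⟩
        refine hR0.comp_add.congr (Eventually.of_forall fun v => ?_)
        have := Rn1 n (v + (x * τ - n))
        rw [show v + (x * τ - n) + n = v + x * τ by ring, Rn2] at this
        exact this
    · exact AnalyticAt.removableAt ((hFd.analyticAt z).div (hd.analyticAt z) hz)
  obtain ⟨C, hC, -⟩ := quasiperiodic_const hτ hRrem (u := 1) (c := 1) (m := 0) (by simp) one_ne_zero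
    (Or.inr ⟨rfl, by simp⟩) (fun z => Eventually.of_forall fun v => by rw [R1, one_mul])
    (fun z => Eventually.of_forall fun v => by rw [R2]; simp [expTwoPi_zero])
  have hC1 : C = 1 := by
    rw [← h01]
    refine (eq_of_eventually_punctured (F := h0) (G := fun _ => C) (z := 0) h0a.continuousAt
      continuousAt_const ?_).symm
    filter_upwards [h0e, hC 0] with v a b
    rw [← a, b]
  have key : F v = thetaEta v τ := by
    refine eq_of_eventually_punctured hFd.continuous.continuousAt hd.continuous.continuousAt ?_
    filter_upwards [hC v, eventually_lattice_ne hτ v] with w hw hl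
    have := thetaEta_ne_zero hτ hl
    simp only [hR] at hw
    rw [hC1, div_eq_one_iff_eq this] at hw
    exact hw
  rw [← key]
  simp only [hF]
  have h3 : expTwoPi (v ^ 2 / (2 * τ)) * expTwoPi (-v ^ 2 / (2 * τ)) = 1 := by
    rw [← expTwoPi_add, ← add_div, add_neg_cancel, zero_div, expTwoPi_zero]
  linear_combination (-thetaEta (v / τ) σ) * h3 +
    (-thetaEta (v / τ) σ * expTwoPi (v ^ 2 / (2 * τ)) * expTwoPi (-v ^ 2 / (2 * τ))) *
      one_div_mul_cancel hτ0

/-! ### The theta functions with characteristics. -/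

theorem eta_eq_qPoch (τ : ℂ) : ModularForm.eta τ = expTwoPi (τ / 24) * qPoch τ τ := by
  rw [ModularForm.eta, qPoch]
  congr 1
  · rw [Function.Periodic.qParam, expTwoPi]; congr 1; push_cast; ring
  · refine tprod_congr fun k => ?_
    rw [ModularForm.eta_q_eq_cexp, expTwoPi]; congr 2; ring

theorem eta_pow_three (τ : ℂ) : ModularForm.eta τ ^ 3 = expTwoPi (τ / 8) * qPoch τ τ ^ 3 := by
  rw [eta_eq_qPoch, mul_pow, ← expTwoPi_nat_mul]; congr 2; push_cast; ring

theorem eta_ne_zero {τ : ℂ} (hτ : 0 < τ.im) : ModularForm.eta τ ≠ 0 := by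
  rw [eta_eq_qPoch]
  exact mul_ne_zero (expTwoPi_ne_zero _) (qPoch_self_ne_zero hτ)

/-- The sign (-1)^{ε'} is traded for a half-period shift. Both directions are needed because the
factors in z and z⁻¹ are shifted oppositely. -/
theorem neg_one_zpow_mul_expTwoPi {ε' : ℤ} (hε' : ε' = 0 ∨ ε' = 1) (y : ℂ) :
    (-1 : ℂ) ^ ε' * expTwoPi y = -expTwoPi (y + (1 - ε') / 2) ∧
      (-1 : ℂ) ^ ε' * expTwoPi y = -expTwoPi (y - (1 - ε') / 2) := by
  rcases hε' with rfl | rfl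
  · constructor
    · simp only [Int.cast_zero, sub_zero]
      rw [expTwoPi_add, expTwoPi_half]; simp
    · simp only [Int.cast_zero, sub_zero]
      rw [expTwoPi_sub, expTwoPi_half]; simp [div_neg]
  · simp

theorem theta_eq_qPoch (ε ε' : ℤ) (hε' : ε' = 0 ∨ ε' = 1) (u : ℂ) {τ : ℂ} (hτ : 0 < τ.im) {v : ℂ}
    (hv : v = u + (1 - ε) / 2 * τ + (1 - ε') / 2) :
    theta ε ε' u τ = expTwoPi (ε / 2 * u) * expTwoPi (ε / 8 * τ) *
      (qPoch τ τ * qPoch (v + ε * τ) τ * qPoch (-v + (1 - ε) * τ) τ) := by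
  rw [theta]
  congr 1
  rw [qPoch, qPoch, qPoch, ← (multipliable_qPoch _ hτ).tprod_mul (multipliable_qPoch _ hτ),
    ← ((multipliable_qPoch _ hτ).mul (multipliable_qPoch _ hτ)).tprod_mul (multipliable_qPoch _ hτ)]
  refine tprod_congr fun k => ?_
  rw [(neg_one_zpow_mul_expTwoPi hε' _).1, (neg_one_zpow_mul_expTwoPi hε' _).2, ← sub_eq_add_neg,
    ← sub_eq_add_neg, hv]
  congr 3
  all_goals ring_nf

theorem theta_one_left (ε' : ℤ) (hε' : ε' = 0 ∨ ε' = 1) (u : ℂ) {τ : ℂ} (hτ : 0 < τ.im) :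
    theta 1 ε' u τ = ModularForm.eta τ ^ 3 *
      (expTwoPi (-(1 - ε') / 4) * thetaEta (u + (1 - ε') / 2) τ) := by
  rw [theta_eq_qPoch 1 ε' hε' u hτ (v := u + (1 - ε') / 2) (by push_cast; ring), thetaEta_eq _ hτ,
    eta_pow_three]
  have h0 := qPoch_self_ne_zero hτ
  have h : expTwoPi (-(1 - ε') / 4) * expTwoPi ((u + (1 - ε') / 2) / 2) = expTwoPi (1 / 2 * u) := by
    rw [← expTwoPi_add]; ring_nf
  have h8 : expTwoPi (τ / 8) = expTwoPi (1 / 8 * τ) := by ring_nf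
  push_cast
  rw [← h, h8]
  field_simp
  ring_nf

theorem theta_zero_left (ε' : ℤ) (hε' : ε' = 0 ∨ ε' = 1) (u : ℂ) {τ : ℂ} (hτ : 0 < τ.im) :
    theta 0 ε' u τ = ModularForm.eta τ ^ 3 *
      (-expTwoPi (u / 2 + τ / 8 + (1 - ε') / 4) * thetaEta (u + τ / 2 + (1 - ε') / 2) τ) := by
  set v := u + τ / 2 + (1 - ε') / 2 with hv
  rw [theta_eq_qPoch 0 ε' hε' u hτ (v := v) (by rw [hv]; push_cast; ring), thetaEta,
    eta_pow_three]
  have h0 := qPoch_self_ne_zero hτ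
  have h : expTwoPi (τ / 8) * expTwoPi (u / 2 + τ / 8 + (1 - ε') / 4) = expTwoPi (v / 2) := by
    rw [← expTwoPi_add, hv]; ring_nf
  have h2 : expTwoPi (v / 2) * expTwoPi (-v / 2) = 1 := by
    rw [← expTwoPi_add, ← add_div, add_neg_cancel, zero_div, expTwoPi_zero]
  have h3 : expTwoPi v = expTwoPi (v / 2) * expTwoPi (v / 2) := by
    rw [← expTwoPi_add]; ring_nf
  simp only [Int.cast_zero, zero_div, zero_mul, expTwoPi_zero, add_zero, sub_zero, one_mul]
  rw [qPoch_eq v hτ, h3, show -v + τ = τ - v by ring, add_comm v τ]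
  rw [show expTwoPi (τ / 8) * qPoch τ τ ^ 3 * (-expTwoPi (u / 2 + τ / 8 + (1 - ε') / 4) *
      ((expTwoPi (v / 2) - expTwoPi (-v / 2)) * qPoch (τ + v) τ * qPoch (τ - v) τ / qPoch τ τ ^ 2)) =
      -(expTwoPi (τ / 8) * expTwoPi (u / 2 + τ / 8 + (1 - ε') / 4)) * qPoch τ τ *
      ((expTwoPi (v / 2) - expTwoPi (-v / 2)) * qPoch (τ + v) τ * qPoch (τ - v) τ) by
        field_simp, h]
  linear_combination (-qPoch τ τ * qPoch (τ + v) τ * qPoch (τ - v) τ) * h2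

/-! ### Appell–Lerch series: poles and quasi-periodicity. -/

/-- The Gaussian factor `e^{2πi(N x² T + ν x + κ (V + x T))}`. -/
def appellExp (N : ℕ) (κ ν V T : ℂ) (x : ℤ) : ℂ :=
  expTwoPi (N * x ^ 2 * T + ν * x + κ * (V + x * T))

/-- The theta series `∑ₓ e^{2πi(N x² T + ν x + κ (V + x T))}`. -/
def thetaSum (N : ℕ) (κ ν V T : ℂ) : ℂ := ∑' x : ℤ, appellExp N κ ν V T x

/-- The Appell–Lerch series `∑ₓ e^{2πi(N x² T + ν x + κ (V + x T))} / (1 - e^{2πi(V + x T)})`. -/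
def appell (N : ℕ) (κ ν V T : ℂ) : ℂ :=
  ∑' x : ℤ, appellExp N κ ν V T x / (1 - expTwoPi (V + x * T))

theorem appellExp_eq (N : ℕ) (κ ν V T : ℂ) (x : ℤ) :
    appellExp N κ ν V T x = expTwoPi (κ * V) * jacobiTheta₂_term x (ν + κ * T) (2 * N * T) := by
  rw [appellExp, jacobiTheta₂_term, expTwoPi, expTwoPi, ← Complex.exp_add]; ring_nf

theorem summable_jacobiTheta₂_term_nat {N : ℕ} (hN : 0 < N) (z : ℂ) {T : ℂ} (hT : 0 < T.im) :
    Summable fun x : ℤ => jacobiTheta₂_term x z (2 * N * T) := by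
  rw [summable_jacobiTheta₂_term_iff]
  have : (2 * (N : ℂ) * T).im = 2 * N * T.im := by simp
  rw [this]; positivity

theorem summable_appellExp {N : ℕ} (hN : 0 < N) (κ ν V : ℂ) {T : ℂ} (hT : 0 < T.im) :
    Summable (appellExp N κ ν V T) := by
  simp only [funext (appellExp_eq N κ ν V T)]
  exact (summable_jacobiTheta₂_term_nat hN _ hT).mul_left _

theorem thetaSum_eq (N : ℕ) (κ ν V T : ℂ) :
    thetaSum N κ ν V T = expTwoPi (κ * V) * jacobiTheta₂ (ν + κ * T) (2 * N * T) := by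
  rw [thetaSum, jacobiTheta₂, ← tsum_mul_left]
  exact tsum_congr fun x => appellExp_eq N κ ν V T x

/-- With n the integer nearest to -Im V / Im T, all other translates stay half a period away from
the real axis, so at most one term of an Appell–Lerch series is near a pole. -/
theorem exists_im_lattice_ge (V : ℂ) {T : ℂ} (hT : 0 < T.im) :
    ∃ n : ℤ, ∀ x : ℤ, x ≠ n → T.im / 2 ≤ |(V + x * T).im| := by
  refine ⟨round (-V.im / T.im), fun x hx => ?_⟩
  set n := round (-V.im / T.im) with hn
  have h1 := abs_sub_round (-V.im / T.im)
  rw [← hn, abs_le] at h1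
  have h2 : -V.im = -V.im / T.im * T.im := by field_simp
  have him : (V + x * T).im = V.im + x * T.im := by simp
  rw [him, le_abs]
  rcases lt_or_gt_of_ne hx with h | h
  · right
    have h3 : (x : ℝ) + 1 ≤ n := by exact_mod_cast h
    nlinarith
  · left
    have h3 : (n : ℝ) + 1 ≤ x := by exact_mod_cast h
    nlinarith

theorem norm_appell_term_le {N : ℕ} (κ ν : ℂ) {V T : ℂ} {x : ℤ} {δ : ℝ} (hδ : 0 < δ)
    (hx : δ ≤ |(V + x * T).im|) :
    ‖appellExp N κ ν V T x / (1 - expTwoPi (V + x * T))‖ ≤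
      ‖expTwoPi (κ * V)‖ * ‖jacobiTheta₂_term x (ν + κ * T) (2 * N * T)‖ *
        (1 - Real.exp (-2 * Real.pi * δ))⁻¹ := by
  rw [div_eq_mul_inv, norm_mul, appellExp_eq, norm_mul]
  exact mul_le_mul_of_nonneg_left (norm_inv_one_sub_expTwoPi_le hδ hx) (by positivity)

theorem summable_appell {N : ℕ} (hN : 0 < N) (κ ν V : ℂ) {T : ℂ} (hT : 0 < T.im) :
    Summable fun x : ℤ => appellExp N κ ν V T x / (1 - expTwoPi (V + x * T)) := by
  obtain ⟨n, hn⟩ := exists_im_lattice_ge V hT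
  refine Summable.of_norm_bounded_eventually
    (((summable_jacobiTheta₂_term_nat hN (ν + κ * T) hT).norm.mul_left ‖expTwoPi (κ * V)‖).mul_right
      (1 - Real.exp (-2 * Real.pi * (T.im / 2)))⁻¹) ?_
  have : ∀ᶠ x : ℤ in cofinite, x ≠ n := (Set.finite_singleton n).eventually_cofinite_notMem
  filter_upwards [this] with x hx
  exact norm_appell_term_le κ ν (by positivity) (hn x hx)

/-- Near every point, an Appell–Lerch series is the sum of a holomorphic function and one of its
terms. -/
theorem appell_eq_analytic_add_term {N : ℕ} (hN : 0 < N) (κ ν V₀ : ℂ) {T : ℂ} (hT : 0 < T.im) :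
    ∃ (R : ℂ → ℂ) (n : ℤ), AnalyticAt ℂ R V₀ ∧ ∀ V, appell N κ ν V T =
      R V + appellExp N κ ν V T n / (1 - expTwoPi (V + n * T)) := by
  obtain ⟨n, hn⟩ := exists_im_lattice_ge V₀ hT
  set t : ℤ → ℂ → ℂ := fun x V => appellExp N κ ν V T x / (1 - expTwoPi (V + x * T)) with ht
  have him : ∀ V ∈ Metric.ball V₀ (T.im / 4), ∀ x : ℤ, x ≠ n → T.im / 4 ≤ |(V + x * T).im| := by
    intro V hV x hx
    have h1 := hn x hx
    have h2 : |(V - V₀).im| < T.im / 4 :=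
      (Complex.abs_im_le_norm _).trans_lt (by simpa [dist_eq_norm] using hV)
    have h3 : (V₀ + x * T).im = (V + x * T).im - (V - V₀).im := by
      simp; ring
    rw [h3] at h1
    have h4 := abs_sub (V + x * T).im (V - V₀).im
    linarith
  have hne : ∀ V ∈ Metric.ball V₀ (T.im / 4), ∀ x : ℤ, x ≠ n → 1 - expTwoPi (V + x * T) ≠ 0 := by
    intro V hV x hx h0
    obtain ⟨k, hk⟩ := (expTwoPi_eq_one_iff _).1 (sub_eq_zero.1 h0).symm
    have h1 := him V hV x hx
    rw [hk, Complex.intCast_im, abs_zero] at h1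
    linarith
  refine ⟨fun V => ∑' x : ℤ, if x = n then 0 else t x V, n, ?_, fun V => ?_⟩
  -- B bounds |e^{2πiκV}| uniformly on the ball, which makes the majorant independent of V.
  · set B := Real.exp (2 * Real.pi * (‖κ‖ * (‖V₀‖ + T.im / 4))) with hB
    have hd : DifferentiableOn ℂ (fun V => ∑' x : ℤ, if x = n then 0 else t x V)
        (Metric.ball V₀ (T.im / 4)) := by
      refine differentiableOn_tsum_of_summable_norm (((summable_jacobiTheta₂_term_nat hN (ν + κ * T)
        hT).norm.mul_left B).mul_right (1 - Real.exp (-2 * Real.pi * (T.im / 4)))⁻¹)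
        (fun x => ?_) Metric.isOpen_ball (fun x V hV => ?_)
      · by_cases hx : x = n
        · simp [hx]
        · simp only [hx, if_false, ht]
          refine DifferentiableOn.div ?_ (by fun_prop) fun V hV => hne V hV x hx
          unfold appellExp
          fun_prop
      · have hpos : 0 < 1 - Real.exp (-2 * Real.pi * (T.im / 4)) := by
          rw [sub_pos, Real.exp_lt_one_iff]; nlinarith [Real.pi_pos]
        by_cases hx : x = n
        · simp only [hx, if_true, norm_zero]; positivity
        · simp only [hx, if_false]
          refine (norm_appell_term_le κ ν (by positivity) (him V hV x hx)).trans ?_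
          refine mul_le_mul_of_nonneg_right ?_ (inv_nonneg.2 hpos.le)
          refine mul_le_mul_of_nonneg_right ?_ (norm_nonneg _)
          rw [norm_expTwoPi]
          apply Real.exp_le_exp.2
          have h1 : |(κ * V).im| ≤ ‖κ‖ * (‖V₀‖ + T.im / 4) := by
            refine (Complex.abs_im_le_norm _).trans ?_
            rw [norm_mul]
            refine mul_le_mul_of_nonneg_left ?_ (norm_nonneg _)
            have h2 : ‖V - V₀‖ < T.im / 4 := by simpa [dist_eq_norm] using hV
            have h3 := norm_add_le V₀ (V - V₀)
            rw [add_sub_cancel] at h3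
            linarith
          nlinarith [neg_abs_le (κ * V).im, Real.pi_pos]
    exact hd.analyticAt (Metric.ball_mem_nhds _ (by positivity))
  · rw [appell, (summable_appell hN κ ν V hT).tsum_eq_add_tsum_ite n, add_comm]

theorem RemovableAt.add {H K : ℂ → ℂ} {z : ℂ} (hH : RemovableAt H z) (hK : RemovableAt K z) :
    RemovableAt (fun v => H v + K v) z := by
  obtain ⟨h, ha, he⟩ := hH
  obtain ⟨k, ka, ke⟩ := hK
  exact ⟨fun v => h v + k v, ha.add ka, by filter_upwards [he, ke] with v a b; rw [a, b]⟩

theorem RemovableAt.mul {H K : ℂ → ℂ} {z : ℂ} (hH : RemovableAt H z) (hK : RemovableAt K z) :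
    RemovableAt (fun v => H v * K v) z := by
  obtain ⟨h, ha, he⟩ := hH
  obtain ⟨k, ka, ke⟩ := hK
  exact ⟨fun v => h v * k v, ha.mul ka, by filter_upwards [he, ke] with v a b; rw [a, b]⟩

theorem _root_.Differentiable.removableAt {H : ℂ → ℂ} (hH : Differentiable ℂ H) (z : ℂ) :
    RemovableAt H z := AnalyticAt.removableAt (hH.analyticAt z)

theorem RemovableAt.comp_mul {H : ℂ → ℂ} {c z : ℂ} (hc : c ≠ 0) (h : RemovableAt H (c * z)) :
    RemovableAt (fun v => H (c * v)) z := by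
  obtain ⟨g, hg, he⟩ := h
  refine ⟨fun v => g (c * v), hg.fun_comp (f := fun v => c * v) (by fun_prop), ?_⟩
  rw [← map_mul_punctured hc] at he
  exact he

/-- A factor that vanishes on the lattice cancels the poles of an Appell–Lerch series. -/
theorem removableAt_mul_appell {N : ℕ} (hN : 0 < N) (κ ν : ℂ) {T : ℂ} (hT : 0 < T.im) {F : ℂ → ℂ}
    (hF : Differentiable ℂ F) (h0 : ∀ V, ∀ x : ℤ, expTwoPi (V + x * T) = 1 → F V = 0) (V₀ : ℂ) :
    RemovableAt (fun V => F V * appell N κ ν V T) V₀ := by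
  obtain ⟨R, n, hR, hRn⟩ := appell_eq_analytic_add_term hN κ ν V₀ hT
  have hE : Differentiable ℂ fun V => appellExp N κ ν V T n := by unfold appellExp; fun_prop
  simp only [hRn, mul_add]
  refine RemovableAt.add (AnalyticAt.removableAt ((hF.analyticAt V₀).mul hR)) ?_
  have hd : Differentiable ℂ fun V => 1 - expTwoPi (V + n * T) := by fun_prop
  -- If the exceptional term has a pole at V₀, then F vanishes there. Both F and the denominator
  -- lose a factor V - V₀ through `dslope`, and the denominator's slope is nonzero because the pole
  -- is simple.
  by_cases hV : expTwoPi (V₀ + n * T) = 1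
  · have hF0 := h0 V₀ n hV
    have a1 : AnalyticAt ℂ (dslope F V₀) V₀ :=
      (differentiableOn_univ.1 ((Complex.differentiableOn_dslope (c := V₀) univ_mem).2
        (differentiableOn_univ.2 hF))).analyticAt V₀
    have a2 : AnalyticAt ℂ (dslope (fun V => 1 - expTwoPi (V + n * T)) V₀) V₀ :=
      (differentiableOn_univ.1 ((Complex.differentiableOn_dslope (c := V₀) univ_mem).2
        (differentiableOn_univ.2 hd))).analyticAt V₀
    have a3 : dslope (fun V => 1 - expTwoPi (V + n * T)) V₀ V₀ ≠ 0 := by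
      rw [dslope_same]
      have h1 := ((hasDerivAt_expTwoPi (V₀ + n * T)).comp V₀
        ((hasDerivAt_id V₀).add_const (n * T))).const_sub 1
      have h2 : deriv (fun V => 1 - expTwoPi (V + n * T)) V₀ = _ := h1.deriv
      rw [h2, hV]
      simp [Real.pi_ne_zero, Complex.I_ne_zero]
    refine ⟨_, (a1.mul (hE.analyticAt V₀)).div a2 a3, ?_⟩
    filter_upwards [self_mem_nhdsWithin] with V hVne
    have hVne : V - V₀ ≠ 0 := sub_ne_zero.2 hVne
    have e1 := sub_smul_dslope F V₀ V
    have e2 := sub_smul_dslope (fun V => 1 - expTwoPi (V + n * T)) V₀ V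
    simp only [smul_eq_mul, hF0, hV, sub_self, sub_zero] at e1 e2
    simp only [Pi.div_apply, Pi.mul_apply]
    rw [← e1, ← e2, ← mul_div_assoc, mul_assoc, mul_div_mul_left _ _ hVne]
  · refine AnalyticAt.removableAt ?_
    refine (hF.analyticAt V₀).mul ((hE.analyticAt V₀).div (hd.analyticAt V₀) ?_)
    exact sub_ne_zero.2 (Ne.symm hV)

theorem appell_add_one (N : ℕ) (κ ν V T : ℂ) :
    appell N κ ν (V + 1) T = expTwoPi κ * appell N κ ν V T := by
  rw [appell, appell, ← tsum_mul_left]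
  refine tsum_congr fun x => ?_
  rw [show V + 1 + x * T = V + x * T + 1 by ring, expTwoPi_add _ 1, expTwoPi_one, mul_one,
    ← mul_div_assoc, appellExp, appellExp, ← expTwoPi_add]
  congr 2; ring

/-- Reindexing x ↦ x - 1 leaves V + xT fixed in the denominators; completing the square in the
numerators lowers κ by 2N. -/
theorem appell_add_period (N : ℕ) (κ ν V T : ℂ) :
    appell N κ ν (V + T) T =
      expTwoPi (N * T + 2 * N * V - ν) * appell N (κ - 2 * N) ν V T := by
  rw [appell, appell, ← tsum_mul_left, ← (Equiv.subRight (1 : ℤ)).tsum_eq]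
  refine tsum_congr fun x => ?_
  simp only [Equiv.subRight_apply]
  have h : V + T + ((x - 1 : ℤ) : ℂ) * T = V + x * T := by push_cast; ring
  rw [h, ← mul_div_assoc, appellExp, appellExp, ← expTwoPi_add, h]
  congr 2; push_cast; ring

/-- With y = e^{2πi(V+xT)}, changing κ by M multiplies the numerator by y^M, and (1 - y^M)/(1 - y)
is a finite geometric sum. Thus the defect of quasi-periodicity is a sum of theta series without
poles. -/
theorem appell_sub_nat {N : ℕ} (hN : 0 < N) (κ ν : ℂ) {V T : ℂ} (hT : 0 < T.im)
    (hV : ∀ x : ℤ, expTwoPi (V + x * T) ≠ 1) (M : ℕ) :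
    appell N (κ - M) ν V T = appell N κ ν V T +
      ∑ j ∈ Finset.range M, thetaSum N (κ - M + j) ν V T := by
  simp only [appell, thetaSum]
  rw [← Summable.tsum_finsetSum fun j _ => summable_appellExp hN _ ν V hT,
    ← (summable_appell hN κ ν V hT).tsum_add (summable_sum fun j _ => summable_appellExp hN _ ν V hT)]
  refine tsum_congr fun x => ?_
  set y := expTwoPi (V + x * T) with hy
  have hy1 : 1 - y ≠ 0 := sub_ne_zero.2 (hV x).symm
  have h1 : ∀ j : ℕ, appellExp N (κ - M + j) ν V T x = appellExp N (κ - M) ν V T x * y ^ j := by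
    intro j
    rw [hy, ← expTwoPi_nat_mul, appellExp, appellExp, ← expTwoPi_add]; congr 1; ring
  have h2 : appellExp N κ ν V T x = appellExp N (κ - M) ν V T x * y ^ M := by
    rw [← h1]; congr 1; ring
  rw [Finset.sum_congr rfl fun j _ => h1 j, ← Finset.mul_sum, h2, div_add' _ _ _ hy1]
  congr 1
  have := geom_sum_mul_neg y M
  rw [mul_assoc, this]; ring

/-! ### Contour shifts between horizontal lines. -/

/-- Cauchy's theorem on a horizontal strip, for functions that decay at its two ends. -/
theorem tendsto_integral_sub_of_strip {F : ℂ → ℂ} {y₁ y₂ : ℝ} (hy : y₁ ≤ y₂)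
    (hF : ∀ z : ℂ, y₁ ≤ z.im → z.im ≤ y₂ → DifferentiableAt ℂ F z) {b : ℝ → ℝ}
    (hb : Tendsto b atTop (𝓝 0))
    (hFb : ∀ x y : ℝ, 1 ≤ |x| → y₁ ≤ y → y ≤ y₂ → ‖F (x + y * I)‖ ≤ b |x|) :
    Tendsto (fun R : ℝ => (∫ x in -R..R, F (x + y₁ * I)) - ∫ x in -R..R, F (x + y₂ * I)) atTop
      (𝓝 0) := by
  have key : ∀ᶠ R : ℝ in atTop, ‖(∫ x in -R..R, F (x + y₁ * I)) - ∫ x in -R..R, F (x + y₂ * I)‖ ≤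
      2 * (b R * |y₂ - y₁|) := by
    filter_upwards [eventually_ge_atTop 1] with R hR
    have h := Complex.integral_boundary_rect_eq_zero_of_differentiableOn F (-R + y₁ * I) (R + y₂ * I)
      (by
        intro z hz
        refine (hF z ?_ ?_).differentiableWithinAt
        · have := (Complex.mem_reProdIm.1 hz).2
          simp [Set.uIcc_of_le hy] at this
          exact this.1
        · have := (Complex.mem_reProdIm.1 hz).2
          simp [Set.uIcc_of_le hy] at this
          exact this.2)
    simp only [Complex.add_re, Complex.neg_re, Complex.ofReal_re, Complex.mul_re, Complex.I_re,
      mul_zero, Complex.ofReal_im, Complex.I_im, mul_one, sub_self, add_zero, Complex.add_im,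
      Complex.neg_im, neg_zero, Complex.mul_im, zero_add] at h
    have hv : ∀ s : ℝ, |s| = R → ‖∫ y in y₁..y₂, F (s + y * I)‖ ≤ b R * |y₂ - y₁| := by
      intro s hs
      refine intervalIntegral.norm_integral_le_of_norm_le_const fun y hy' => ?_
      rw [Set.uIoc_of_le hy] at hy'
      rw [← hs]
      exact hFb s y (by rw [hs]; exact hR) hy'.1.le hy'.2
    have h1 := hv R (abs_of_nonneg (by linarith))
    have h2 := hv (-R) (by rw [abs_neg, abs_of_nonneg (by linarith)])
    have e : (∫ x in -R..R, F (x + y₁ * I)) - ∫ x in -R..R, F (x + y₂ * I) =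
        I * (∫ y in y₁..y₂, F (((-R : ℝ) : ℂ) + y * I)) - I * ∫ y in y₁..y₂, F (R + y * I) := by
      simp only [smul_eq_mul] at h
      push_cast
      push_cast at h
      linear_combination h
    rw [e]
    refine (norm_sub_le _ _).trans ?_
    rw [norm_mul, norm_mul, Complex.norm_I, one_mul, one_mul]
    linarith
  rw [tendsto_zero_iff_norm_tendsto_zero]
  refine tendsto_of_tendsto_of_tendsto_of_le_of_le' tendsto_const_nhds ?_
    (Eventually.of_forall fun _ => norm_nonneg _) key
  simpa using (hb.mul_const (|y₂ - y₁|)).const_mul 2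

theorem integral_eq_of_strip {F : ℂ → ℂ} {y₁ y₂ : ℝ} (hy : y₁ ≤ y₂)
    (hF : ∀ z : ℂ, y₁ ≤ z.im → z.im ≤ y₂ → DifferentiableAt ℂ F z) {b : ℝ → ℝ}
    (hb : Tendsto b atTop (𝓝 0))
    (hFb : ∀ x y : ℝ, 1 ≤ |x| → y₁ ≤ y → y ≤ y₂ → ‖F (x + y * I)‖ ≤ b |x|)
    (h₁ : Integrable fun x : ℝ => F (x + y₁ * I)) (h₂ : Integrable fun x : ℝ => F (x + y₂ * I)) :
    ∫ x : ℝ, F (x + y₁ * I) = ∫ x : ℝ, F (x + y₂ * I) := by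
  have t := tendsto_integral_sub_of_strip hy hF hb hFb
  have t1 := intervalIntegral_tendsto_integral h₁ tendsto_neg_atTop_atBot tendsto_id
  have t2 := intervalIntegral_tendsto_integral h₂ tendsto_neg_atTop_atBot tendsto_id
  exact sub_eq_zero.1 (tendsto_nhds_unique (t1.sub t2) t)

/-- The antiderivative ½ log(x²+y²) - i arctan(x/y) avoids choosing a branch of the complex
logarithm; its logarithmic part cancels between ±R. -/
theorem integral_inv_add_mul_I {y : ℝ} (hy : y ≠ 0) (R : ℝ) :
    ∫ x in -R..R, ((x : ℂ) + y * I)⁻¹ = -2 * I * Real.arctan (R / y) := by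
  have hne : ∀ x : ℝ, x ^ 2 + y ^ 2 ≠ 0 := fun x => by positivity
  have hne' : ∀ x : ℝ, (x : ℂ) + y * I ≠ 0 := fun x h => hy (by simpa using congrArg Complex.im h)
  have hder : ∀ x : ℝ, HasDerivAt (fun x : ℝ => ((1 / 2 * Real.log (x ^ 2 + y ^ 2) : ℝ) : ℂ) -
      I * (Real.arctan (x / y) : ℝ)) (((x : ℂ) + y * I)⁻¹) x := by
    intro x
    have h1 : HasDerivAt (fun x : ℝ => 1 / 2 * Real.log (x ^ 2 + y ^ 2)) (x / (x ^ 2 + y ^ 2)) x := by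
      have := (((hasDerivAt_id x).pow 2).add_const (y ^ 2)).log (hne x)
      refine (this.const_mul (1 / 2)).congr_deriv ?_
      simp; ring
    have h2 : HasDerivAt (fun x : ℝ => Real.arctan (x / y)) (y / (x ^ 2 + y ^ 2)) x := by
      have := ((hasDerivAt_id x).div_const y).arctan
      refine this.congr_deriv ?_
      have := hne x
      simp only [id]
      field_simp
      ring
    refine (h1.ofReal_comp.sub (h2.ofReal_comp.const_mul I)).congr_deriv ?_
    have h3 : ((x : ℂ) ^ 2 + (y : ℂ) ^ 2) ≠ 0 := by exact_mod_cast hne x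
    have h4 : ((x : ℂ) + y * I) * (x - y * I) = x ^ 2 + y ^ 2 := by
      linear_combination (-(y : ℂ) ^ 2) * Complex.I_sq
    push_cast
    refine eq_inv_of_mul_eq_one_left ?_
    field_simp
    linear_combination h4
  rw [intervalIntegral.integral_eq_sub_of_hasDerivAt (fun x _ => hder x)]
  · rw [neg_div, Real.arctan_neg, neg_sq]
    push_cast
    ring
  · refine Continuous.intervalIntegrable ?_ _ _
    exact Continuous.inv₀ (by fun_prop) hne'

theorem tendsto_integral_inv_add_mul_I_of_pos {y : ℝ} (hy : 0 < y) :
    Tendsto (fun R : ℝ => ∫ x in -R..R, ((x : ℂ) + y * I)⁻¹) atTop (𝓝 (-(Real.pi * I))) := by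
  simp only [integral_inv_add_mul_I hy.ne']
  have h : Tendsto (fun R : ℝ => Real.arctan (R / y)) atTop (𝓝 (Real.pi / 2)) :=
    (tendsto_nhds_of_tendsto_nhdsWithin Real.tendsto_arctan_atTop).comp
      (tendsto_id.atTop_div_const hy)
  have := ((Complex.continuous_ofReal.tendsto _).comp h).const_mul (-2 * I)
  rw [show -(Real.pi * I : ℂ) = -2 * I * ((Real.pi / 2 : ℝ) : ℂ) by push_cast; ring]
  exact this

theorem tendsto_integral_inv_add_mul_I_of_neg {y : ℝ} (hy : y < 0) :
    Tendsto (fun R : ℝ => ∫ x in -R..R, ((x : ℂ) + y * I)⁻¹) atTop (𝓝 (Real.pi * I)) := by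
  simp only [integral_inv_add_mul_I hy.ne]
  have h : Tendsto (fun R : ℝ => Real.arctan (R / y)) atTop (𝓝 (-(Real.pi / 2))) :=
    (tendsto_nhds_of_tendsto_nhdsWithin Real.tendsto_arctan_atBot).comp
      (tendsto_id.atTop_div_const_of_neg hy)
  have := ((Complex.continuous_ofReal.tendsto _).comp h).const_mul (-2 * I)
  rw [show (Real.pi * I : ℂ) = -2 * I * ((-(Real.pi / 2) : ℝ) : ℂ) by push_cast; ring]
  exact this

/-- A contour shift across one simple pole at the origin. -/
theorem integral_sub_integral_of_pole {F f₀ : ℂ → ℂ} {a : ℂ} {y₁ y₂ : ℝ} (hy₁ : y₁ < 0) (hy₂ : 0 < y₂)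
    (hF : ∀ z : ℂ, z ≠ 0 → y₁ ≤ z.im → z.im ≤ y₂ → F z = f₀ z + a / z)
    (hf₀ : ∀ z : ℂ, y₁ ≤ z.im → z.im ≤ y₂ → DifferentiableAt ℂ f₀ z) {b : ℝ → ℝ}
    (hb : Tendsto b atTop (𝓝 0))
    (hFb : ∀ x y : ℝ, 1 ≤ |x| → y₁ ≤ y → y ≤ y₂ → ‖F (x + y * I)‖ ≤ b |x|)
    (h₁ : Integrable fun x : ℝ => F (x + y₁ * I)) (h₂ : Integrable fun x : ℝ => F (x + y₂ * I)) :
    (∫ x : ℝ, F (x + y₁ * I)) - ∫ x : ℝ, F (x + y₂ * I) = 2 * Real.pi * I * a := by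
  have hy : y₁ ≤ y₂ := by linarith
  have hne : ∀ (x y : ℝ), (x ≠ 0 ∨ y ≠ 0) → (x : ℂ) + y * I ≠ 0 := by
    intro x y h h0
    have h1 := congrArg Complex.re h0
    have h2 := congrArg Complex.im h0
    simp at h1 h2
    tauto
  have him : ∀ x y : ℝ, ((x : ℂ) + y * I).im = y := by simp
  -- Removing a/z leaves a holomorphic function with decay b(R) + ‖a‖/R at the ends of the strip.
  -- The integrals of a/z on the two lines tend to πia and -πia, which accounts for the residue.
  have t0 := tendsto_integral_sub_of_strip hy hf₀ (b := fun R => b R + ‖a‖ * R⁻¹)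
    (by simpa using hb.add (tendsto_inv_atTop_zero.const_mul ‖a‖))
    (by
      intro x y hx h1 h2
      have hx0 : x ≠ 0 := by rintro rfl; simp at hx; linarith
      have e1 := hF (x + y * I) (hne x y (Or.inl hx0)) (by rwa [him]) (by rwa [him])
      rw [show f₀ (x + y * I) = F (x + y * I) - a / (x + y * I) by rw [e1]; ring]
      refine (norm_sub_le _ _).trans (add_le_add (hFb x y hx h1 h2) ?_)
      rw [norm_div, div_eq_mul_inv]
      refine mul_le_mul_of_nonneg_left (inv_anti₀ (by positivity) ?_) (norm_nonneg _)
      have := Complex.abs_re_le_norm ((x : ℂ) + y * I)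
      simpa using this)
  have split : ∀ y : ℝ, y ≠ 0 → y₁ ≤ y → y ≤ y₂ → ∀ R : ℝ, ∫ x in -R..R, F (x + y * I) =
      (∫ x in -R..R, f₀ (x + y * I)) + a * ∫ x in -R..R, ((x : ℂ) + y * I)⁻¹ := by
    intro y hy0 h1 h2 R
    rw [← intervalIntegral.integral_const_mul, ← intervalIntegral.integral_add]
    · refine intervalIntegral.integral_congr fun x _ => ?_
      change F (x + y * I) = f₀ (x + y * I) + a * ((x : ℂ) + y * I)⁻¹
      rw [hF _ (hne x y (Or.inr hy0)) (by rwa [him]) (by rwa [him]), div_eq_mul_inv]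
    · refine Continuous.intervalIntegrable ?_ _ _
      refine continuous_iff_continuousAt.2 fun x => ?_
      have c1 : ContinuousAt f₀ (x + y * I) := (hf₀ _ (by rwa [him]) (by rwa [him])).continuousAt
      exact ContinuousAt.comp (f := fun x : ℝ => (x : ℂ) + y * I) c1 (by fun_prop)
    · refine Continuous.intervalIntegrable ?_ _ _
      exact continuous_const.mul (Continuous.inv₀ (by fun_prop) fun x => hne x y (Or.inr hy0))
  have t1 := intervalIntegral_tendsto_integral h₁ tendsto_neg_atTop_atBot tendsto_id
  have t2 := intervalIntegral_tendsto_integral h₂ tendsto_neg_atTop_atBot tendsto_id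
  have t3 := (tendsto_integral_inv_add_mul_I_of_neg hy₁).const_mul a
  have t4 := (tendsto_integral_inv_add_mul_I_of_pos hy₂).const_mul a
  have t5 := t0.add (t3.sub t4)
  have t6 := t1.sub t2
  have e : (fun R : ℝ => (∫ x in -R..id R, F (x + y₁ * I)) - ∫ x in -R..id R, F (x + y₂ * I)) =
      fun R : ℝ => ((∫ x in -R..R, f₀ (x + y₁ * I)) - ∫ x in -R..R, f₀ (x + y₂ * I)) +
        ((a * ∫ x in -R..R, ((x : ℂ) + y₁ * I)⁻¹) - a * ∫ x in -R..R, ((x : ℂ) + y₂ * I)⁻¹) := by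
    funext R
    simp only [id]
    rw [split y₁ hy₁.ne le_rfl hy, split y₂ hy₂.ne' hy le_rfl]
    ring
  rw [e] at t6
  rw [tendsto_nhds_unique t6 t5]
  ring

/-! ### Mordell integrals. -/

/-- A Gaussian bound, uniform in the linear coefficient and in horizontal lines. -/
theorem exists_norm_gaussian_le {A : ℂ} (hA : 0 < A.im) (B : ℝ) :
    ∃ K, 0 < K ∧ ∀ (x y : ℝ) (β : ℂ), |y| ≤ 1 → ‖β‖ ≤ B →
      ‖expTwoPi (A * (x + y * I) ^ 2 + I * β * (x + y * I))‖ ≤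
        K * Real.exp (-(Real.pi * A.im) * x ^ 2) := by
  have hπ := Real.pi_pos
  set L := 2 * |A.re| + |B| with hL
  refine ⟨Real.exp (2 * Real.pi * (A.im + |B| + L ^ 2 / (2 * A.im))), Real.exp_pos _, ?_⟩
  intro x y β hy hβ
  rw [norm_expTwoPi, ← Real.exp_add]
  apply Real.exp_le_exp.2
  have him : (A * (x + y * I) ^ 2 + I * β * (x + y * I)).im =
      A.im * (x ^ 2 - y ^ 2) + 2 * A.re * x * y + β.re * x - β.im * y := by
    simp [pow_two]; ring
  rw [him]
  have h1 : |β.re| ≤ |B| := (Complex.abs_re_le_norm β).trans (hβ.trans (le_abs_self B))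
  have h2 : |β.im| ≤ |B| := (Complex.abs_im_le_norm β).trans (hβ.trans (le_abs_self B))
  have h3 : -(|A.re| * |x|) ≤ A.re * x * y := by
    have : |A.re * x * y| ≤ |A.re| * |x| := by
      rw [abs_mul, abs_mul]
      exact mul_le_of_le_one_right (by positivity) hy
    linarith [neg_abs_le (A.re * x * y)]
  have h4 : -(|B| * |x|) ≤ β.re * x := by
    have : |β.re * x| ≤ |B| * |x| := by
      rw [abs_mul]; exact mul_le_mul_of_nonneg_right h1 (abs_nonneg _)
    linarith [neg_abs_le (β.re * x)]
  have h5 : β.im * y ≤ |B| := by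
    have : |β.im * y| ≤ |B| * 1 := by
      rw [abs_mul]; exact mul_le_mul h2 hy (abs_nonneg _) (abs_nonneg _)
    linarith [le_abs_self (β.im * y)]
  have h6 : y ^ 2 ≤ 1 := by rw [← sq_abs]; nlinarith [abs_nonneg y]
  -- Half of the quadratic decay absorbs the linear terms; the other half is the rate in the final
  -- bound.
  have h7 : L * |x| ≤ A.im / 2 * x ^ 2 + L ^ 2 / (2 * A.im) := by
    have : A.im / 2 * x ^ 2 + L ^ 2 / (2 * A.im) - L * |x| = A.im / 2 * (|x| - L / A.im) ^ 2 := by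
      rw [← sq_abs x]; field_simp; ring
    nlinarith [mul_nonneg (half_pos hA).le (sq_nonneg (|x| - L / A.im))]
  have h8 : A.im * y ^ 2 ≤ A.im := by nlinarith
  have h9 : A.im / 2 * x ^ 2 - (A.im + |B| + L ^ 2 / (2 * A.im)) ≤
      A.im * (x ^ 2 - y ^ 2) + 2 * A.re * x * y + β.re * x - β.im * y := by
    rw [hL, add_mul] at h7
    rw [hL]
    linarith
  nlinarith

/-- The kernel `1 / (1 - e^{2πi(ix + θ)})` is bounded on the real line unless it has a pole. -/
theorem exists_norm_inv_kernel_le {θ : ℂ} (hθ : ∀ x : ℝ, expTwoPi (I * x + θ) ≠ 1)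
    (hθi : θ.im = 0) : ∃ C, 0 < C ∧ ∀ x : ℝ, ‖(1 - expTwoPi (I * x + θ))⁻¹‖ ≤ C := by
  have hc : Continuous fun x : ℝ => (1 - expTwoPi (I * x + θ))⁻¹ :=
    Continuous.inv₀ (by fun_prop) fun x => sub_ne_zero.2 (hθ x).symm
  obtain ⟨M, hM⟩ := (isCompact_Icc (a := (-1 : ℝ)) (b := 1)).exists_bound_of_continuousOn
    hc.continuousOn
  refine ⟨max 1 (max M (1 - Real.exp (-2 * Real.pi * 1))⁻¹), by positivity, fun x => ?_⟩
  by_cases hx : |x| ≤ 1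
  · exact (hM x (abs_le.1 hx)).trans ((le_max_left _ _).trans (le_max_right _ _))
  · refine (norm_inv_one_sub_expTwoPi_le one_pos ?_).trans ((le_max_right _ _).trans (le_max_right _ _))
    push Not at hx
    simpa [hθi] using hx.le

/-- The integrand of a Mordell integral. -/
def mordellFun (A : ℂ) (ν : ℝ) (β Y : ℂ) : ℂ :=
  expTwoPi (A * Y ^ 2 + I * β * Y) / (1 - expTwoPi (I * Y - ν))

/-- The Mordell integral over the line `Im Y = y`. -/
def mordell (A : ℂ) (ν y : ℝ) (β : ℂ) : ℂ := ∫ x : ℝ, mordellFun A ν β (x + y * I)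

theorem mordellFun_line (A : ℂ) (ν y : ℝ) (β : ℂ) (x : ℝ) :
    mordellFun A ν β (x + y * I) = expTwoPi (A * (x + y * I) ^ 2 + I * β * (x + y * I)) *
      (1 - expTwoPi (I * x + (-(ν + y) : ℝ)))⁻¹ := by
  rw [mordellFun, div_eq_mul_inv]
  congr 4
  push_cast
  linear_combination (y : ℂ) * Complex.I_sq

theorem kernel_ne_one {ν y : ℝ} (h : ∀ k : ℤ, ν + y ≠ k) (x : ℝ) :
    expTwoPi (I * x + (-(ν + y) : ℝ)) ≠ 1 := by
  intro h0
  obtain ⟨k, hk⟩ := (expTwoPi_eq_one_iff _).1 h0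
  have := congrArg Complex.re hk
  simp at this
  apply h (-k)
  push_cast
  linarith

theorem exists_norm_mordellFun_le {A : ℂ} (hA : 0 < A.im) {ν y : ℝ} (hy : |y| ≤ 1)
    (h : ∀ k : ℤ, ν + y ≠ k) (B : ℝ) : ∃ K, 0 < K ∧ ∀ (x : ℝ) (β : ℂ), ‖β‖ ≤ B →
      ‖mordellFun A ν β (x + y * I)‖ ≤ K * Real.exp (-(Real.pi * A.im) * x ^ 2) := by
  obtain ⟨K, hK, hKb⟩ := exists_norm_gaussian_le hA B
  obtain ⟨C, hC, hCb⟩ := exists_norm_inv_kernel_le (kernel_ne_one h) (Complex.ofReal_im _)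
  refine ⟨K * C, by positivity, fun x β hβ => ?_⟩
  rw [mordellFun_line, norm_mul]
  refine (mul_le_mul (hKb x y β hy hβ) (hCb x) (norm_nonneg _) (by positivity)).trans_eq ?_
  ring

theorem continuous_mordellFun_line (A : ℂ) {ν y : ℝ} (h : ∀ k : ℤ, ν + y ≠ k) (β : ℂ) :
    Continuous fun x : ℝ => mordellFun A ν β (x + y * I) := by
  simp only [mordellFun_line]
  exact Continuous.mul (by fun_prop)
    (Continuous.inv₀ (by fun_prop) fun x => sub_ne_zero.2 (kernel_ne_one h x).symm)

theorem integrable_mordellFun {A : ℂ} (hA : 0 < A.im) {ν y : ℝ} (hy : |y| ≤ 1)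
    (h : ∀ k : ℤ, ν + y ≠ k) (β : ℂ) : Integrable fun x : ℝ => mordellFun A ν β (x + y * I) := by
  obtain ⟨K, hK, hKb⟩ := exists_norm_mordellFun_le hA hy h ‖β‖
  refine Integrable.mono' ((integrable_exp_neg_mul_sq (mul_pos Real.pi_pos hA)).const_mul K)
    (continuous_mordellFun_line A h β).aestronglyMeasurable (Eventually.of_forall fun x => ?_)
  exact hKb x β le_rfl

theorem exists_strip_bound {A : ℂ} (hA : 0 < A.im) (ν : ℝ) (β : ℂ) :
    ∃ b : ℝ → ℝ, Tendsto b atTop (𝓝 0) ∧ ∀ x y : ℝ, 1 ≤ |x| → |y| ≤ 1 →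
      ‖mordellFun A ν β (x + y * I)‖ ≤ b |x| := by
  obtain ⟨K, hK, hKb⟩ := exists_norm_gaussian_le hA ‖β‖
  refine ⟨fun R => K * Real.exp (-(Real.pi * A.im) * R ^ 2) *
    (1 - Real.exp (-2 * Real.pi * 1))⁻¹, ?_, fun x y hx hy => ?_⟩
  · have h1 : Tendsto (fun R : ℝ => Real.exp (-(Real.pi * A.im) * R ^ 2)) atTop (𝓝 0) := by
      refine Real.tendsto_exp_atBot.comp ?_
      exact (tendsto_pow_atTop two_ne_zero).const_mul_atTop_of_neg
        (neg_lt_zero.2 (mul_pos Real.pi_pos hA))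
    simpa using (h1.const_mul K).mul_const (1 - Real.exp (-2 * Real.pi * 1))⁻¹
  · rw [mordellFun_line, norm_mul]
    simp only [sq_abs]
    refine mul_le_mul (hKb x y β hy le_rfl) ?_ (norm_nonneg _) (by positivity)
    refine norm_inv_one_sub_expTwoPi_le one_pos ?_
    simpa using hx

theorem mordellFun_pole {ν : ℝ} {z : ℂ} (h : expTwoPi (I * z - ν) = 1) : ∃ k : ℤ, ν + z.im = k := by
  obtain ⟨k, hk⟩ := (expTwoPi_eq_one_iff _).1 h
  have := congrArg Complex.re hk
  simp at this
  refine ⟨-k, ?_⟩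
  push_cast
  linarith

theorem mordell_shift_of_no_pole {A : ℂ} (hA : 0 < A.im) {ν y₁ y₂ : ℝ} (hy : y₁ ≤ y₂) (h₁ : -1 ≤ y₁)
    (h₂ : y₂ ≤ 1) (h : ∀ k : ℤ, ∀ y, y₁ ≤ y → y ≤ y₂ → ν + y ≠ k) (β : ℂ) :
    mordell A ν y₁ β = mordell A ν y₂ β := by
  obtain ⟨b, hb, hbb⟩ := exists_strip_bound hA ν β
  refine integral_eq_of_strip hy (fun z hz1 hz2 => ?_) hb
    (fun x y hx hy1 hy2 => hbb x y hx (abs_le.2 ⟨by linarith, by linarith⟩))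
    (integrable_mordellFun hA (abs_le.2 ⟨by linarith, by linarith⟩) (fun k => h k y₁ le_rfl hy) β)
    (integrable_mordellFun hA (abs_le.2 ⟨by linarith, by linarith⟩) (fun k => h k y₂ hy le_rfl) β)
  unfold mordellFun
  refine DifferentiableAt.div (by fun_prop) (by fun_prop) (sub_ne_zero.2 fun h0 => ?_)
  obtain ⟨k, hk⟩ := mordellFun_pole h0.symm
  exact h k z.im hz1 hz2 hk

theorem mordellFun_add_int (A : ℂ) (ν : ℝ) (k : ℤ) (β Y : ℂ) :
    mordellFun A (ν + k) β Y = mordellFun A ν β Y := by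
  rw [mordellFun, mordellFun]
  congr 2
  refine expTwoPi_eq_of_sub_int (-k) ?_
  push_cast; ring

/-- Shifting the contour of a Mordell integral by one period of its kernel. -/
theorem mordell_shift_period {A : ℂ} (hA : 0 < A.im) {ν y : ℝ} (hy : -1 ≤ y) (h₁ : y < -ν)
    (h₂ : -ν < y + 1) (hy1 : y ≤ 0) (β : ℂ) :
    mordell A ν y β - mordell A ν (y + 1) β = I * expTwoPi (-A * ν ^ 2 + β * ν) := by
  have hnp : ∀ k : ℤ, ν + y ≠ k := by
    intro k hk
    have h3 : (k : ℝ) < 0 := by linarith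
    have h4 : (-1 : ℝ) < k := by linarith
    have h5 : k < 0 := by exact_mod_cast h3
    have h6 : -1 < k := by exact_mod_cast h4
    omega
  have hnp' : ∀ k : ℤ, ν + (y + 1) ≠ k := by
    intro k hk
    apply hnp (k - 1)
    push_cast; linarith
  obtain ⟨b, hb, hbb⟩ := exists_strip_bound hA ν β
  -- The pole Y = -iν is translated to the origin. The kernel's denominator is z·k(z) with k(0) =
  -- 2π, and k has no zero for |Im z| < 1, so this is the only pole in the strip.
  set F : ℂ → ℂ := fun z => mordellFun A ν β (z - ν * I) with hF
  have hFe : ∀ z, F z = expTwoPi (A * (z - ν * I) ^ 2 + I * β * (z - ν * I)) /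
      (1 - expTwoPi (I * z)) := by
    intro z
    simp only [hF, mordellFun]
    congr 3
    linear_combination (-(ν : ℂ)) * Complex.I_sq
  set k : ℂ → ℂ := dslope (fun z => 1 - expTwoPi (I * z)) 0 with hk
  have hkd : Differentiable ℂ k :=
    differentiableOn_univ.1 ((Complex.differentiableOn_dslope (c := (0 : ℂ)) univ_mem).2
      (by fun_prop))
  have hk0 : k 0 = 2 * Real.pi := by
    rw [hk, dslope_same]
    have h1 := ((hasDerivAt_expTwoPi (I * 0)).comp (0 : ℂ)
        ((hasDerivAt_id (0 : ℂ)).const_mul I)).const_sub 1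
    have h2 : deriv (fun z => 1 - expTwoPi (I * z)) 0 = _ := h1.deriv
    rw [h2, mul_zero, expTwoPi_zero]
    linear_combination (-2 * (Real.pi : ℂ)) * Complex.I_sq
  have hkm : ∀ z, z * k z = 1 - expTwoPi (I * z) := by
    intro z
    have := sub_smul_dslope (fun z => 1 - expTwoPi (I * z)) 0 z
    simpa [expTwoPi_zero] using this
  have hk1 : ∀ z : ℂ, |z.im| < 1 → k z ≠ 0 := by
    intro z hz h0
    by_cases hz0 : z = 0
    · rw [hz0, hk0] at h0
      simp [Real.pi_ne_zero] at h0
    · have h1 := hkm z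
      rw [h0, mul_zero] at h1
      obtain ⟨m, hm⟩ := (expTwoPi_eq_one_iff _).1 (sub_eq_zero.1 h1.symm).symm
      have h2 := congrArg Complex.re hm
      have h3 := congrArg Complex.im hm
      simp at h2 h3
      have h4 : |(m : ℝ)| < 1 := by rw [← h2, abs_neg]; exact hz
      have h5 : m = 0 := by
        have : |m| < 1 := by exact_mod_cast h4
        exact Int.abs_lt_one_iff.1 this
      apply hz0
      apply Complex.ext
      · simpa using h3
      · rw [h5] at h2; simp at h2; simpa using h2
  set g : ℂ → ℂ := fun z => expTwoPi (A * (z - ν * I) ^ 2 + I * β * (z - ν * I)) / k z with hg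
  have hgd : ∀ z : ℂ, |z.im| < 1 → DifferentiableAt ℂ g z := by
    intro z hz
    simp only [hg]
    exact DifferentiableAt.div (by fun_prop) hkd.differentiableAt (hk1 z hz)
  have hopen : IsOpen {z : ℂ | |z.im| < 1} :=
    isOpen_lt (continuous_abs.comp Complex.continuous_im) continuous_const
  have hsl : DifferentiableOn ℂ (dslope g 0) {z : ℂ | |z.im| < 1} :=
    (Complex.differentiableOn_dslope (hopen.mem_nhds (by simp))).2
      fun z hz => (hgd z hz).differentiableWithinAt
  have hshift : ∀ x s : ℝ, F (x + (s + ν : ℝ) * I) = mordellFun A ν β (x + s * I) := by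
    intro x s
    simp only [hF]; congr 1; push_cast; ring
  have main := integral_sub_integral_of_pole (F := F) (f₀ := dslope g 0) (a := g 0) (b := b)
    (y₁ := y + ν) (y₂ := y + 1 + ν) (by linarith) (by linarith)
    (by
      intro z hz _ _
      have h1 := sub_smul_dslope g 0 z
      simp only [sub_zero, smul_eq_mul] at h1
      rw [hFe, ← hkm]
      have h2 : expTwoPi (A * (z - ν * I) ^ 2 + I * β * (z - ν * I)) / (z * k z) = g z / z := by
        simp only [hg]; rw [div_div, mul_comm z]
      rw [h2, div_eq_iff hz, add_mul, div_mul_cancel₀ _ hz]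
      linear_combination -h1)
    (by
      intro z h1 h2
      exact hsl.differentiableAt (hopen.mem_nhds
        (show |z.im| < 1 from abs_lt.2 ⟨by linarith, by linarith⟩)))
    hb
    (by
      intro x s hx h1 h2
      have := hshift x (s - ν)
      rw [sub_add_cancel] at this
      rw [this]
      exact hbb x (s - ν) hx (abs_le.2 ⟨by linarith, by linarith⟩))
    (by
      simp only [hshift]
      exact integrable_mordellFun hA (abs_le.2 ⟨by linarith, by linarith⟩) hnp β)
    (by
      simp only [hshift]
      exact integrable_mordellFun hA (abs_le.2 ⟨by linarith, by linarith⟩) hnp' β)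
  simp only [hshift] at main
  rw [mordell, mordell, main]
  simp only [hg, hk0]
  have hpi : (Real.pi : ℂ) ≠ 0 := by exact_mod_cast Real.pi_ne_zero
  have e : A * (0 - ν * I) ^ 2 + I * β * (0 - ν * I) = -A * ν ^ 2 + β * ν := by
    linear_combination (A * ν ^ 2 - β * ν) * Complex.I_sq
  rw [e]
  field_simp

/-- Completing the square for Y ↦ Y + i absorbs 2A into the linear coefficient, while the kernel is
unchanged because iY moves by -1. -/
theorem mordell_add_two_mul (A : ℂ) (ν y : ℝ) (β : ℂ) :
    mordell A ν y (β + 2 * A) = expTwoPi (A + β) * mordell A ν (y + 1) β := by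
  rw [mordell, mordell, ← integral_const_mul]
  congr 1
  funext x
  rw [mordellFun, mordellFun, ← mul_div_assoc, ← expTwoPi_add]
  refine congrArg₂ _ (congrArg _ ?_) (congrArg _ ?_)
  · push_cast
    linear_combination (-β - A) * Complex.I_sq
  · symm
    refine expTwoPi_eq_of_sub_int (-1) ?_
    push_cast
    linear_combination Complex.I_sq

theorem integral_gaussian_line {A : ℂ} (hA : 0 < A.im) (y : ℝ) (β : ℂ) :
    ∫ x : ℝ, expTwoPi (A * (x + y * I) ^ 2 + I * β * (x + y * I)) =
      (1 / (-2 * I * A)) ^ (1 / 2 : ℂ) * expTwoPi (β ^ 2 / (4 * A)) := by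
  have hA0 : A ≠ 0 := by rintro rfl; simp at hA
  have hb : (2 * Real.pi * I * A : ℂ).re < 0 := by
    simp; nlinarith [Real.pi_pos, mul_pos Real.pi_pos hA]
  have h := integral_cexp_quadratic hb (2 * Real.pi * I * (2 * A * y * I + I * β))
    (2 * Real.pi * I * (-A * y ^ 2 - β * y))
  have hpi : (Real.pi : ℂ) ≠ 0 := by exact_mod_cast Real.pi_ne_zero
  have e1 : (Real.pi / -(2 * Real.pi * I * A) : ℂ) = 1 / (-2 * I * A) := by
    field_simp
  rw [e1] at h
  have e2 : expTwoPi (β ^ 2 / (4 * A)) = cexp (2 * Real.pi * I * (-A * y ^ 2 - β * y) -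
      (2 * Real.pi * I * (2 * A * y * I + I * β)) ^ 2 / (4 * (2 * Real.pi * I * A))) := by
    rw [expTwoPi]
    congr 1
    field_simp
    linear_combination ((2 * A * y + β) ^ 2) * Complex.I_sq
  rw [e2, ← h]
  congr 1
  funext x
  rw [expTwoPi]
  congr 1
  linear_combination (2 * Real.pi * I * (A * y ^ 2 + β * y)) * Complex.I_sq

theorem differentiable_mordell {A : ℂ} (hA : 0 < A.im) {ν y : ℝ} (hy : |y| ≤ 1)
    (h : ∀ k : ℤ, ν + y ≠ k) : Differentiable ℂ (mordell A ν y) := by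
  intro β₀
  obtain ⟨K, hK, hKb⟩ := exists_norm_mordellFun_le hA hy h (‖β₀‖ + 1)
  have hδ := mul_pos Real.pi_pos hA
  have hc : Continuous fun x : ℝ => 2 * Real.pi * I * (I * (x + y * I)) *
      mordellFun A ν β₀ (x + y * I) :=
    Continuous.mul (by fun_prop) (continuous_mordellFun_line A h β₀)
  have key := hasDerivAt_integral_of_dominated_loc_of_deriv_le (μ := volume) (x₀ := β₀)
    (s := Metric.ball β₀ 1) (F := fun β (x : ℝ) => mordellFun A ν β (x + y * I))
    (F' := fun β (x : ℝ) => 2 * Real.pi * I * (I * (x + y * I)) * mordellFun A ν β (x + y * I))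
    (bound := fun x : ℝ => 2 * Real.pi * ((|x| + 1) * (K * Real.exp (-(Real.pi * A.im) * x ^ 2))))
    (Metric.ball_mem_nhds _ one_pos)
    (Eventually.of_forall fun β => (continuous_mordellFun_line A h β).aestronglyMeasurable)
    (integrable_mordellFun hA hy h β₀) hc.aestronglyMeasurable
    (Eventually.of_forall fun x β hβ => by
      have h1 : ‖β‖ ≤ ‖β₀‖ + 1 := by
        have := norm_add_le β₀ (β - β₀)
        rw [add_sub_cancel] at this
        have h2 : ‖β - β₀‖ < 1 := by simpa [dist_eq_norm] using hβ
        linarith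
      rw [norm_mul, norm_mul, norm_mul, norm_mul, norm_mul]
      simp only [Complex.norm_I, mul_one, one_mul, Complex.norm_real, Real.norm_eq_abs,
        abs_of_pos Real.pi_pos, Complex.norm_ofNat]
      rw [mul_assoc]
      refine mul_le_mul_of_nonneg_left (mul_le_mul ?_ (hKb x β h1) (norm_nonneg _)
        (by positivity)) (by positivity)
      refine (norm_add_le _ _).trans ?_
      simpa using hy)
    (by
      have i1 := (integrable_exp_neg_mul_sq hδ).const_mul K
      have i2 := (integrable_mul_exp_neg_mul_sq hδ).norm.const_mul K
      refine ((i2.add i1).const_mul (2 * Real.pi)).congr (Eventually.of_forall fun x => ?_)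
      simp only [Pi.add_apply, norm_mul, Real.norm_eq_abs, Real.abs_exp]
      ring)
    (Eventually.of_forall fun x β _ => by
      simp only [mordellFun]
      have h1 : HasDerivAt (fun β : ℂ => A * (x + y * I) ^ 2 + I * β * (x + y * I))
          (I * (x + y * I)) β := by
        have := (((hasDerivAt_id β).const_mul I).mul_const ((x : ℂ) + y * I)).const_add
          (A * (x + y * I) ^ 2)
        refine this.congr_deriv (by ring)
      refine (((hasDerivAt_expTwoPi _).comp β h1).div_const _).congr_deriv ?_
      ring)
  exact key.2.differentiableAt

/-- Since Mν is an integer, the factor e^{-2πMY} by which the integrand changes equals Z^M for the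
kernel variable Z = e^{2πi(iY-ν)}. The quotient (1 - Z^M)/(1 - Z) is then a geometric sum, leaving
pure Gaussians. -/
theorem mordell_add_nat {A : ℂ} (hA : 0 < A.im) {ν y : ℝ} (hy : |y| ≤ 1)
    (h : ∀ k : ℤ, ν + y ≠ k) (M : ℕ) (j : ℤ) (hj : (M : ℝ) * ν = j) (β : ℂ) :
    mordell A ν y (β + M) = mordell A ν y β - ∑ l ∈ Finset.range M, expTwoPi (-l * ν) *
      ((1 / (-2 * I * A)) ^ (1 / 2 : ℂ) * expTwoPi ((β + l) ^ 2 / (4 * A))) := by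
  have hg : ∀ l : ℕ, Integrable fun x : ℝ =>
      expTwoPi (A * (x + y * I) ^ 2 + I * (β + l) * (x + y * I)) := by
    intro l
    obtain ⟨K, hK, hKb⟩ := exists_norm_gaussian_le hA ‖β + l‖
    refine Integrable.mono' ((integrable_exp_neg_mul_sq (mul_pos Real.pi_pos hA)).const_mul K)
      (Continuous.aestronglyMeasurable (by fun_prop)) (Eventually.of_forall fun x => ?_)
    exact hKb x y _ hy le_rfl
  simp only [← integral_gaussian_line hA y, ← integral_const_mul]
  rw [← integral_finsetSum _ fun l _ => (hg l).const_mul _, mordell, mordell,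
    ← integral_sub (integrable_mordellFun hA hy h β)
      (integrable_finsetSum _ fun l _ => (hg l).const_mul _)]
  congr 1
  funext x
  set Y : ℂ := x + y * I with hY
  set Z := expTwoPi (I * Y - ν) with hZ
  have hZ1 : 1 - Z ≠ 0 := by
    intro h0
    obtain ⟨k, hk⟩ := mordellFun_pole (sub_eq_zero.1 h0).symm
    simp [hY] at hk
    exact h k hk
  have hl : ∀ l : ℕ, expTwoPi (-l * ν) * expTwoPi (A * Y ^ 2 + I * (β + l) * Y) =
      expTwoPi (A * Y ^ 2 + I * β * Y) * Z ^ l := by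
    intro l
    rw [hZ, ← expTwoPi_nat_mul, ← expTwoPi_add, ← expTwoPi_add]; congr 1; ring
  have hM : expTwoPi (A * Y ^ 2 + I * (β + M) * Y) = expTwoPi (A * Y ^ 2 + I * β * Y) * Z ^ M := by
    rw [← hl, ← expTwoPi_add]
    symm
    refine expTwoPi_eq_of_sub_int (-j) ?_
    have : (M : ℂ) * ν = j := by exact_mod_cast hj
    push_cast
    linear_combination -this
  rw [Finset.sum_congr rfl fun l _ => hl l, ← Finset.mul_sum, mordellFun, mordellFun, hM,
    eq_sub_iff_add_eq, div_add' _ _ _ hZ1]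
  congr 1
  linear_combination (expTwoPi (A * Y ^ 2 + I * β * Y)) * geom_sum_mul_neg Z M

/-! ### Modular inversion of Appell–Lerch series. -/

/-- Splitting a sum over the integers into residue classes. -/
theorem tsum_eq_sum_residues {F : ℤ → ℂ} (hF : Summable F) (a : ℤ) {M : ℕ} (hM : 0 < M) :
    ∑' n, F n = ∑ j ∈ Finset.Ico a (a + M), ∑' k : ℤ, F (j + M * k) := by
  have : NeZero M := ⟨hM.ne'⟩
  have e1 : ∑' n, F n = ∑' n, F (a + n) := ((Equiv.addLeft a).tsum_eq F).symm
  have hF' : Summable fun n => F (a + n) := (Equiv.addLeft a).summable_iff.2 hF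
  rw [e1, ← (Int.divModEquiv M).symm.tsum_eq]
  have hs := (Int.divModEquiv M).symm.summable_iff.2 hF'
  have hs' : Summable fun q : Fin M × ℤ => F (a + (q.2 * M + (q.1 : ℕ))) := by
    have := (Equiv.prodComm (Fin M) ℤ).summable_iff.2 hs
    refine this.congr fun q => ?_
    simp [Int.divModEquiv_symm_apply]
  rw [← (Equiv.prodComm (Fin M) ℤ).tsum_eq]
  have e2 : ∀ q : Fin M × ℤ, F (a + (Int.divModEquiv M).symm ((Equiv.prodComm (Fin M) ℤ) q)) =
      F (a + (q.2 * M + (q.1 : ℕ))) := fun q => by simp [Int.divModEquiv_symm_apply]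
  rw [tsum_congr e2, hs'.tsum_prod, tsum_fintype]
  rw [Fin.sum_univ_eq_sum_range (fun i => ∑' k : ℤ, F (a + (k * M + (i : ℕ)))) M]
  refine Finset.sum_bij (fun i _ => a + i) ?_ ?_ ?_ ?_
  · intro i hi
    simp at hi ⊢; omega
  · intro i _ i' _ hh
    simpa using hh
  · intro j hj
    rw [Finset.mem_Ico] at hj
    refine ⟨(j - a).toNat, ?_, ?_⟩
    · simp; omega
    · push_cast [Int.toNat_of_nonneg (show 0 ≤ j - a by omega)]; ring
  · intro i _
    refine tsum_congr fun k => ?_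
    congr 1; ring

/-- The theta constants in the modular inversion of Appell–Lerch series. -/
def thetaCoef (N : ℕ) (κ T : ℂ) (j : ℤ) : ℂ :=
  ∑' k : ℤ, expTwoPi (((j + 2 * N * k : ℤ) : ℂ) ^ 2 * T / (4 * N) -
    κ * ((j + 2 * N * k : ℤ) : ℂ) / (2 * N))

/-- The height of the contour used for the Mordell integrals. -/
def mordellLine (N : ℕ) : ℝ := -(1 / 2 - 1 / (4 * N))

/-- The sum of Mordell integrals in the modular inversion of Appell–Lerch series. -/
def mordellSum (N : ℕ) (κ V T : ℂ) : ℂ :=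
  ∑ j ∈ Finset.Ico (-(N : ℤ)) N, thetaCoef N κ T j *
    mordell (N * T) (j / (2 * N)) (mordellLine N) (2 * N * V + κ)

theorem mordellLine_bounds {N : ℕ} (hN : 0 < N) :
    -(1 / 2) < mordellLine N ∧ mordellLine N ≤ -(1 / 4) := by
  have h1 : (1 : ℝ) ≤ N := by exact_mod_cast hN
  have h2 : 0 < 1 / (4 * (N : ℝ)) := by positivity
  have h3 : 1 / (4 * (N : ℝ)) ≤ 1 / 4 := by
    apply one_div_le_one_div_of_le <;> linarith
  unfold mordellLine
  constructor <;> linarith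

theorem abs_mordellLine_le {N : ℕ} (hN : 0 < N) : |mordellLine N| ≤ 1 := by
  have := mordellLine_bounds hN
  exact abs_le.2 ⟨by linarith, by linarith⟩

/-- All poles lie at heights in (1/2N)ℤ. The offset 1/(4N) puts the line halfway between two of
them, so a single line serves every j; clearing denominators yields a parity contradiction. -/
theorem mordellLine_ne {N : ℕ} (hN : 0 < N) (j k : ℤ) :
    (j : ℝ) / (2 * N) + mordellLine N ≠ k := by
  intro h
  have hN' : (N : ℝ) ≠ 0 := by exact_mod_cast hN.ne'
  unfold mordellLine at h
  field_simp at h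
  have h2 : (2 * (2 * j) - (2 * (2 * N) - 2) : ℤ) = 2 * (2 * (2 * (N * k))) := by
    have : ((2 * (2 * j) - (2 * (2 * N) - 2) : ℤ) : ℝ) = ((2 * (2 * (2 * (N * k))) : ℤ) : ℝ) := by
      push_cast; linarith
    exact_mod_cast this
  generalize (N : ℤ) * k = m at h2
  omega

theorem summable_thetaCoef {N : ℕ} (hN : 0 < N) (κ : ℂ) {T : ℂ} (hT : 0 < T.im) :
    Summable fun n : ℤ => expTwoPi ((n : ℂ) ^ 2 * T / (4 * N) - κ * n / (2 * N)) := by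
  have hN' : (N : ℂ) ≠ 0 := by exact_mod_cast hN.ne'
  have him : 0 < (T / (2 * N) : ℂ).im := by
    have : (T / (2 * N) : ℂ).im = T.im / (2 * N) := by
      rw [show (2 * (N : ℂ)) = ((2 * N : ℝ) : ℂ) by push_cast; ring, Complex.div_ofReal_im]
    rw [this]; positivity
  refine ((summable_jacobiTheta₂_term_iff (-κ / (2 * N)) _).2 him).congr fun n => ?_
  rw [jacobiTheta₂_term, expTwoPi]
  congr 1
  field_simp
  ring

/-- The exponential is the residue of the j-th Mordell integrand. It removes j²T/(4N) from
(j+2Nk)²T/(4N), leaving Nk²T + jkT, the exponent of a theta series of Appell type. -/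
theorem thetaCoef_mul_expTwoPi {N : ℕ} (hN : 0 < N) (κ V T : ℂ) (j : ℤ) :
    thetaCoef N κ T j * expTwoPi (-(N * T) * ((j / (2 * N) : ℝ) : ℂ) ^ 2 +
      (2 * N * V + κ) * ((j / (2 * N) : ℝ) : ℂ)) = thetaSum N j (-κ) V T := by
  have hN' : (N : ℂ) ≠ 0 := by exact_mod_cast hN.ne'
  rw [thetaCoef, thetaSum, ← tsum_mul_right]
  refine tsum_congr fun k => ?_
  rw [← expTwoPi_add, appellExp]
  congr 1
  push_cast
  field_simp
  ring

theorem sum_Ico_neg_eq_sum_range {M : Type*} [AddCommMonoid M] (N : ℕ) (f : ℤ → M) :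
    ∑ j ∈ Finset.Ico (-(N : ℤ)) N, f j = ∑ i ∈ Finset.range (2 * N), f (-(N : ℤ) + i) := by
  symm
  refine Finset.sum_bij (fun i _ => -(N : ℤ) + i) ?_ ?_ ?_ ?_
  · intro i hi
    simp at hi ⊢; omega
  · intro i _ i' _ hh
    simpa using hh
  · intro j hj
    rw [Finset.mem_Ico] at hj
    refine ⟨(j + N).toNat, ?_, ?_⟩
    · simp; omega
    · push_cast [Int.toNat_of_nonneg (show 0 ≤ j + N by omega)]; ring
  · intro i _; rfl

theorem differentiable_mordellSum {N : ℕ} (hN : 0 < N) (κ : ℂ) {T : ℂ} (hT : 0 < T.im) :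
    Differentiable ℂ fun V => mordellSum N κ V T := by
  have hA : 0 < ((N : ℂ) * T).im := by simp; positivity
  unfold mordellSum
  refine Differentiable.fun_sum fun j _ => ?_
  have h := differentiable_mordell hA (abs_mordellLine_le hN) (mordellLine_ne hN j)
  exact (differentiable_const _).mul (h.comp (by fun_prop))

/-- The shift V ↦ V + T adds 2NT to the linear coefficient, which raises the contour by one unit;
returning to the original line collects one residue for each j. -/
theorem mordellSum_add_period {N : ℕ} (hN : 0 < N) (κ V : ℂ) {T : ℂ} (hT : 0 < T.im) :
    mordellSum N κ (V + T) T = expTwoPi (N * T + 2 * N * V + κ) *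
      (mordellSum N κ V T - I * ∑ j ∈ Finset.Ico (-(N : ℤ)) N, thetaSum N j (-κ) V T) := by
  have hA : 0 < ((N : ℂ) * T).im := by simp; positivity
  have hb := mordellLine_bounds hN
  have hNr : (0 : ℝ) < N := by exact_mod_cast hN
  rw [mordellSum, mordellSum, Finset.mul_sum, ← Finset.sum_sub_distrib, Finset.mul_sum]
  refine Finset.sum_congr rfl fun j hj => ?_
  rw [Finset.mem_Ico] at hj
  have h1 : (j : ℝ) + 1 ≤ N := by exact_mod_cast hj.2
  have h2 : -(N : ℝ) ≤ j := by exact_mod_cast hj.1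
  rw [← thetaCoef_mul_expTwoPi hN, show 2 * (N : ℂ) * (V + T) + κ = 2 * N * V + κ + 2 * (N * T) by ring,
    mordell_add_two_mul]
  -- For -N ≤ j < N the pole at height -j/(2N) lies between `mordellLine N` and `mordellLine N + 1`,
  -- with margin at least 1/(4N) on each side. This dictates the range of j.
  have h3 := mordell_shift_period hA (ν := (j : ℝ) / (2 * N)) (y := mordellLine N) (by linarith)
    (by
      unfold mordellLine
      rw [← sub_pos]
      have : -((j : ℝ) / (2 * N)) - -(1 / 2 - 1 / (4 * N)) = (2 * (N - (j + 1)) + 1) / (4 * N) := by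
        field_simp; ring
      rw [this]; apply div_pos <;> linarith)
    (by
      unfold mordellLine
      rw [← sub_pos]
      have : -(1 / 2 - 1 / (4 * (N : ℝ))) + 1 - -((j : ℝ) / (2 * N)) = (2 * (N + j) + 1) / (4 * N) := by
        field_simp; ring
      rw [this]; apply div_pos <;> linarith)
    (by linarith) (2 * N * V + κ)
  rw [show (N : ℂ) * T + (2 * N * V + κ) = N * T + 2 * N * V + κ by ring]
  linear_combination (-thetaCoef N κ T j * expTwoPi (N * T + 2 * N * V + κ)) * h3

/-- With z = -iT/(2N), the constants are ((2N)²z)^{-1/2} and z^{-1/2}. Since Re z > 0, the principal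
branches multiply without sign ambiguity to 1/(2Nz). -/
theorem gaussian_constant {N : ℕ} (hN : 0 < N) {T : ℂ} (hT : 0 < T.im) :
    (1 / (-2 * I * (N * T))) ^ (1 / 2 : ℂ) * (1 / (-I * (T / (2 * N))) ^ (1 / 2 : ℂ)) = I / T := by
  have hN' : (N : ℂ) ≠ 0 := by exact_mod_cast hN.ne'
  have hT0 : T ≠ 0 := by rintro rfl; simp at hT
  set z : ℂ := -I * (T / (2 * N)) with hz
  have hz0 : z ≠ 0 := by
    rw [hz]; exact mul_ne_zero (neg_ne_zero.2 Complex.I_ne_zero) (div_ne_zero hT0 (by simpa using hN'))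
  have hre : 0 < z.re := by
    have : z.re = T.im / (2 * N) := by
      rw [hz, show -I * (T / (2 * (N : ℂ))) = (((2 * N : ℝ)⁻¹ : ℝ) : ℂ) * (-I * T) by
        push_cast; field_simp, Complex.re_ofReal_mul]
      simp; field_simp
    rw [this]; positivity
  have e1 : 1 / (-2 * I * (N * T)) = ((((2 * N : ℝ) ^ 2 : ℝ) : ℂ) * z)⁻¹ := by
    rw [hz]; push_cast; field_simp
  have hpos : (0 : ℝ) < (2 * N : ℝ) ^ 2 := by positivity
  have harg : (((((2 * N : ℝ) ^ 2 : ℝ) : ℂ)) * z).arg ≠ Real.pi := by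
    rw [Complex.arg_real_mul _ hpos]
    intro h
    have := Complex.abs_arg_lt_pi_div_two_iff.2 (Or.inl hre)
    rw [h, abs_of_pos Real.pi_pos] at this
    linarith [Real.pi_pos]
  have hne : ((((2 * N : ℝ) ^ 2 : ℝ) : ℂ)) * z ≠ 0 := mul_ne_zero (by exact_mod_cast hpos.ne') hz0
  rw [e1, Complex.cpow_def_of_ne_zero (inv_ne_zero hne), Complex.log_inv _ harg,
    Complex.log_ofReal_mul hpos hz0, Complex.cpow_def_of_ne_zero hz0, one_div (cexp _), ← Complex.exp_neg,
    ← Complex.exp_add, Real.log_pow]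
  have e2 : -(((((2 : ℕ) : ℝ) * Real.log (2 * N) : ℝ) : ℂ) + Complex.log z) * (1 / 2) +
      -(Complex.log z * (1 / 2)) = -((Real.log (2 * N) : ℝ) : ℂ) + -Complex.log z := by
    push_cast; ring
  rw [e2, Complex.exp_add, Complex.exp_neg, Complex.exp_neg, Complex.exp_log hz0, ← Complex.ofReal_exp,
    Real.exp_log (by positivity), hz]
  push_cast
  field_simp
  linear_combination -Complex.I_sq

theorem jacobiTheta₂_term_eq_expTwoPi (n : ℤ) (z τ : ℂ) :
    jacobiTheta₂_term n z τ = expTwoPi (n * z + n ^ 2 * τ / 2) := by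
  rw [jacobiTheta₂_term, expTwoPi]; congr 1; ring

/-- The classes j mod 2N reassemble a full Jacobi theta series. The -2N inserted in its argument
shifts it by an integer, which is harmless, and matches the lowered parameter in
`appell_add_period`. -/
theorem sum_thetaCoef_mul {N : ℕ} (hN : 0 < N) (κ : ℂ) {T : ℂ} (hT : 0 < T.im) (l : ℤ) :
    ∑ j ∈ Finset.Ico (-(N : ℤ)) N, thetaCoef N κ T j * expTwoPi (-l * ((j / (2 * N) : ℝ) : ℂ)) =
      jacobiTheta₂ (-(κ - 2 * N + l) / (2 * N)) (T / (2 * N)) := by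
  have hN' : (N : ℂ) ≠ 0 := by exact_mod_cast hN.ne'
  have hs := summable_thetaCoef hN (κ + l) hT
  have h1 := tsum_eq_sum_residues hs (-(N : ℤ)) (M := 2 * N) (by omega)
  rw [show -(N : ℤ) + ((2 * N : ℕ) : ℤ) = N by push_cast; ring] at h1
  have h2 : jacobiTheta₂ (-(κ - 2 * N + l) / (2 * N)) (T / (2 * N)) =
      ∑' n : ℤ, expTwoPi ((n : ℂ) ^ 2 * T / (4 * N) - (κ + l) * n / (2 * N)) := by
    rw [jacobiTheta₂]
    refine tsum_congr fun n => ?_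
    rw [jacobiTheta₂_term_eq_expTwoPi]
    refine expTwoPi_eq_of_sub_int n ?_
    field_simp
    ring
  rw [h2, h1]
  refine Finset.sum_congr rfl fun j _ => ?_
  rw [thetaCoef, ← tsum_mul_right]
  refine tsum_congr fun k => ?_
  rw [← expTwoPi_add]
  refine expTwoPi_eq_of_sub_int (l * k) ?_
  push_cast
  field_simp
  ring

/-- Each Mordell integral contributes 2N Gaussians. Summed over j they form theta series at T/(2N),
and Jacobi's functional equation turns these into the defects of the Appell–Lerch series at modulus
-1/T. -/
theorem mordellSum_add_one {N : ℕ} (hN : 0 < N) (κ V : ℂ) {T : ℂ} (hT : 0 < T.im) :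
    mordellSum N κ (V + 1) T = mordellSum N κ V T - I / T * expTwoPi (N * (V + 1) ^ 2 / T) *
      ∑ l ∈ Finset.range (2 * N), thetaSum N (κ - 2 * N + l) 0 ((V + 1) / T) (-1 / T) := by
  have hN' : (N : ℂ) ≠ 0 := by exact_mod_cast hN.ne'
  have hT0 : T ≠ 0 := by rintro rfl; simp at hT
  have hA : 0 < ((N : ℂ) * T).im := by simp; positivity
  have h1 : ∀ j : ℤ, mordell (N * T) (j / (2 * N)) (mordellLine N) (2 * N * (V + 1) + κ) =
      mordell (N * T) (j / (2 * N)) (mordellLine N) (2 * N * V + κ) -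
        ∑ l ∈ Finset.range (2 * N), expTwoPi (-l * ((j / (2 * N) : ℝ) : ℂ)) *
          ((1 / (-2 * I * (N * T))) ^ (1 / 2 : ℂ) *
            expTwoPi ((2 * N * V + κ + l) ^ 2 / (4 * (N * T)))) := by
    intro j
    have hr : (((2 * N : ℕ) : ℝ)) * (j / (2 * N)) = j := by
      have : (N : ℝ) ≠ 0 := by exact_mod_cast hN.ne'
      push_cast; field_simp
    have := mordell_add_nat hA (abs_mordellLine_le hN) (mordellLine_ne hN j) (2 * N) j hr
      (2 * N * V + κ)
    rw [← this]
    congr 1; push_cast; ring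
  rw [mordellSum, mordellSum]
  simp only [h1, mul_sub, Finset.sum_sub_distrib, Finset.mul_sum]
  congr 1
  rw [Finset.sum_comm]
  refine Finset.sum_congr rfl fun l _ => ?_
  have h2 := sum_thetaCoef_mul hN κ hT l
  have h3 : ∀ j : ℤ, thetaCoef N κ T j * (expTwoPi (-l * ((j / (2 * N) : ℝ) : ℂ)) *
      ((1 / (-2 * I * (N * T))) ^ (1 / 2 : ℂ) *
        expTwoPi ((2 * N * V + κ + l) ^ 2 / (4 * (N * T))))) =
      (thetaCoef N κ T j * expTwoPi (-l * ((j / (2 * N) : ℝ) : ℂ))) *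
      ((1 / (-2 * I * (N * T))) ^ (1 / 2 : ℂ) *
        expTwoPi ((2 * N * V + κ + l) ^ 2 / (4 * (N * T)))) := fun j => by ring
  rw [Finset.sum_congr rfl fun j _ => h3 j, ← Finset.sum_mul]
  push_cast at h2 ⊢
  rw [h2, jacobiTheta₂_functional_equation, thetaSum_eq]
  have e1 : -(κ - 2 * N + l) / (2 * N) / (T / (2 * N)) = 0 + (κ - 2 * N + l) * (-1 / T) := by
    field_simp; ring
  have e2 : -1 / (T / (2 * N)) = 2 * N * (-1 / T) := by field_simp
  have e3 : cexp (-Real.pi * I * (-(κ - 2 * N + l) / (2 * N)) ^ 2 / (T / (2 * N))) =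
      expTwoPi (-(κ - 2 * N + l) ^ 2 / (4 * (N * T))) := by
    rw [expTwoPi]; congr 1; field_simp; ring
  have e4 : expTwoPi (-(κ - 2 * N + l) ^ 2 / (4 * (N * T))) *
      expTwoPi ((2 * N * V + κ + l) ^ 2 / (4 * (N * T))) =
      expTwoPi (N * (V + 1) ^ 2 / T) * expTwoPi ((κ - 2 * N + l) * ((V + 1) / T)) := by
    rw [← expTwoPi_add, ← expTwoPi_add]; congr 1; field_simp; ring
  have e5 := gaussian_constant hN hT
  rw [e1, e2, e3, ← e5]
  linear_combination (1 / (-I * (T / (2 * N))) ^ (1 / 2 : ℂ) *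
    jacobiTheta₂ (0 + (κ - 2 * N + l) * (-1 / T)) (2 * N * (-1 / T)) *
    (1 / (-2 * I * (N * T))) ^ (1 / 2 : ℂ)) * e4

theorem eventually_inverted_lattice_ne {T : ℂ} (hT : 0 < T.im) (z : ℂ) :
    ∀ᶠ V in 𝓝[≠] z, ∀ x : ℤ, expTwoPi (V / T + x * (-1 / T)) ≠ 1 := by
  have hT0 : T ≠ 0 := by rintro rfl; simp at hT
  have h := eventually_lattice_ne (im_neg_one_div_pos hT) (T⁻¹ * z)
  rw [← map_mul_punctured (inv_ne_zero hT0)] at h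
  refine (eventually_map.1 h).mono fun V hV x => ?_
  have := hV x
  rwa [inv_mul_eq_div] at this

/-- The modular inversion formula for Appell–Lerch series. -/
theorem appell_inversion {N : ℕ} (hN : 0 < N) {κ : ℝ} {T : ℂ} (hT : 0 < T.im) (z : ℂ) :
    ∀ᶠ V in 𝓝[≠] z, 1 / T * expTwoPi (N * V ^ 2 / T) * appell N κ 0 (V / T) (-1 / T) =
      appell N N (-κ) V T - I * mordellSum N κ V T := by
  have hT0 : T ≠ 0 := by rintro rfl; simp at hT
  have hσ := im_neg_one_div_pos hT
  have hN1 : (1 : ℝ) ≤ N := by exact_mod_cast hN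
  set L : ℂ → ℂ := fun V => 1 / T * expTwoPi (N * V ^ 2 / T) * appell N κ 0 (V / T) (-1 / T) with hL
  -- D is the difference of the two sides. The theta-series defects of its three terms cancel, so D
  -- is quasi-periodic; multiplying by `thetaEta` clears the poles at both moduli.
  set D : ℂ → ℂ := fun V => L V - appell N N (-κ) V T + I * mordellSum N κ V T with hD
  have hθ := differentiable_thetaEta hT
  have hrem : ∀ z, RemovableAt (fun V => thetaEta V T * D V) z := by
    intro z
    have r1 := removableAt_mul_appell hN κ 0 hσ (differentiable_thetaEta hσ)
      (fun V x hx => thetaEta_eq_zero hσ x hx) (T⁻¹ * z)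
    have r1' := r1.comp_mul (inv_ne_zero hT0)
    have r2 := removableAt_mul_appell hN N (-κ) hT hθ (fun V x hx => thetaEta_eq_zero hT x hx) z
    have r3 : RemovableAt (fun V => expTwoPi (N * V ^ 2 / T) * expTwoPi (-V ^ 2 / (2 * T))) z :=
      Differentiable.removableAt (by fun_prop) z
    have r4 : RemovableAt (fun V => thetaEta V T * (I * mordellSum N κ V T)) z := by
      have := differentiable_mordellSum hN κ hT
      exact Differentiable.removableAt (by fun_prop) z
    have r5 : RemovableAt (fun _ => (-1 : ℂ)) z := Differentiable.removableAt (by fun_prop) z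
    refine (((r3.mul r1').add (r5.mul r2)).add r4).congr (Eventually.of_forall fun V => ?_)
    have h1 : thetaEta (V / T) (-1 / T) = _ := thetaEta_inversion V hT
    have h2 : expTwoPi (-V ^ 2 / (2 * T)) * expTwoPi (V ^ 2 / (2 * T)) = 1 := by
      rw [← expTwoPi_add, ← add_div, neg_add_cancel, zero_div, expTwoPi_zero]
    simp only [hD, hL]
    rw [inv_mul_eq_div, h1]
    linear_combination (-(1 / T * expTwoPi (N * V ^ 2 / T) * appell N κ 0 (V / T) (-1 / T) *
      thetaEta V T)) * h2
  have hD1 : ∀ z, ∀ᶠ V in 𝓝[≠] z, D (V + 1) = D V := by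
    intro z
    have h := eventually_inverted_lattice_ne hT (z + 1)
    rw [← map_add_punctured, eventually_map] at h
    filter_upwards [h] with V hV
    have e1 := appell_add_period N κ 0 ((V + 1) / T) (-1 / T)
    rw [show (V + 1) / T + -1 / T = V / T by ring, sub_zero] at e1
    have e2 := appell_sub_nat hN κ 0 hσ hV (2 * N)
    push_cast at e2
    rw [e2] at e1
    have e3 : expTwoPi (N * V ^ 2 / T) * expTwoPi (N * (-1 / T) + 2 * N * ((V + 1) / T)) =
        expTwoPi (N * (V + 1) ^ 2 / T) := by
      rw [← expTwoPi_add]; congr 1; field_simp; ring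
    have e4 : expTwoPi (N : ℂ) = 1 := by exact_mod_cast expTwoPi_intCast N
    simp only [hD, hL]
    rw [appell_add_one, e4, mordellSum_add_one hN κ V hT, e1, ← e3]
    linear_combination (-(1 / T) * (expTwoPi (N * V ^ 2 / T) *
      expTwoPi (N * (-1 / T) + 2 * N * ((V + 1) / T))) * ∑ l ∈ Finset.range (2 * N),
        thetaSum N (κ - 2 * N + l) 0 ((V + 1) / T) (-1 / T)) * Complex.I_sq
  have hD2 : ∀ z, ∀ᶠ V in 𝓝[≠] z, D (V + T) = expTwoPi (N * T + 2 * N * V + κ) * D V := by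
    intro z
    filter_upwards [eventually_lattice_ne hT z] with V hV
    have hLT : L (V + T) = expTwoPi (N * T + 2 * N * V + κ) * L V := by
      simp only [hL]
      rw [add_div, div_self hT0, appell_add_one]
      have : expTwoPi (N * (V + T) ^ 2 / T) * expTwoPi κ =
          expTwoPi (N * T + 2 * N * V + κ) * expTwoPi (N * V ^ 2 / T) := by
        rw [← expTwoPi_add, ← expTwoPi_add]; congr 1; field_simp; ring
      linear_combination (1 / T * appell N κ 0 (V / T) (-1 / T)) * this
    have hA : appell N N (-κ) (V + T) T = expTwoPi (N * T + 2 * N * V + κ) *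
        (appell N N (-κ) V T + ∑ j ∈ Finset.Ico (-(N : ℤ)) N, thetaSum N j (-κ) V T) := by
      rw [appell_add_period, sub_neg_eq_add]
      congr 1
      have := appell_sub_nat hN N (-κ) hT hV (2 * N)
      push_cast at this
      rw [this, sum_Ico_neg_eq_sum_range]
      congr 1
      refine Finset.sum_congr rfl fun i _ => ?_
      congr 1
      push_cast; ring
    simp only [hD]
    rw [hLT, hA, mordellSum_add_period hN κ V hT]
    linear_combination (-expTwoPi (N * T + 2 * N * V + κ) *
      ∑ j ∈ Finset.Ico (-(N : ℤ)) N, thetaSum N j (-κ) V T) * Complex.I_sq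
  -- `thetaEta` contributes exponent -1 and D contributes 2N, so the total exponent 2N - 1 is
  -- positive and the constant is zero.
  obtain ⟨C, hC, hC0⟩ := quasiperiodic_const hT hrem (u := -1)
    (c := -expTwoPi (N * T + κ - T / 2)) (m := 2 * N - 1)
    (by simp) (neg_ne_zero.2 (expTwoPi_ne_zero _)) (Or.inl (by linarith))
    (fun z => (hD1 z).mono fun V hV => by rw [hV, thetaEta_add_one _ hT]; ring)
    (fun z => (hD2 z).mono fun V hV => by
      rw [hV, thetaEta_add_self _ hT]
      have : expTwoPi (N * T + κ - T / 2) * expTwoPi (((2 * N - 1 : ℝ) : ℂ) * V) =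
          expTwoPi (-V - T / 2) * expTwoPi (N * T + 2 * N * V + κ) := by
        rw [← expTwoPi_add, ← expTwoPi_add]; congr 1; push_cast; ring
      linear_combination (thetaEta V T * D V) * this)
  have hC' := hC0 (by linarith)
  filter_upwards [hC z, eventually_lattice_ne hT z] with V h1 h2
  rw [hC'] at h1
  have h3 := (mul_eq_zero.1 h1).resolve_left (thetaEta_ne_zero hT h2)
  simp only [hD, hL] at h3
  linear_combination h3

/-! ### Decomposition of Ψ into residue-class blocks. -/

/-- `a r - s`. -/
def kap (p p' : ℕ) (r s : ℤ) : ℝ := p' / p * r - s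

/-- The series `∑ e^{2πi(a x² τ + μ (v + x τ))} / (1 - e^{2πi(v + x τ)})` over `x ≡ θ mod p`. -/
def appellBlock (p p' : ℕ) (μ : ℝ) (θ : ℤ) (v τ : ℂ) : ℂ :=
  expTwoPi (-2 * ratio p p' * θ * v - ratio p p' * θ ^ 2 * τ) *
    appell p' ((μ + 2 * (p' / p) * θ : ℝ) : ℂ) 0 (v + θ * τ) (p * τ)

/-- The renormalization of `Psi` at `v + θ τ`. -/
def psiBlock (p p' : ℕ) (r s θ : ℤ) (v τ : ℂ) : ℂ :=
  appellBlock p p' (kap p p' (r - 2 * θ) s) θ v τ -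
    appellBlock p p' (kap p p' (r - 2 * θ) s) (θ - r) v τ

theorem natCast_mul_im_pos {p : ℕ} (hp : 0 < p) {τ : ℂ} (hτ : 0 < τ.im) : 0 < ((p : ℂ) * τ).im := by
  simp; positivity

theorem psi_eq_appell (p p' : ℕ) (hp : 0 < p) (hp' : 0 < p') (r s : ℤ) (u : ℂ) {τ : ℂ}
    (hτ : 0 < τ.im) :
    Psi p p' r s u τ =
      expTwoPi ((kap p p' r s : ℂ) ^ 2 / (4 * ratio p p') * τ - kap p p' r s * u) *
        appell p' (kap p p' r s) 0 u (p * τ) -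
      expTwoPi ((kap p p' (-r) s : ℂ) ^ 2 / (4 * ratio p p') * τ - kap p p' (-r) s * (u - r * τ)) *
        appell p' (kap p p' (-r) s) 0 (u - r * τ) (p * τ) := by
  have hT := natCast_mul_im_pos hp hτ
  have h1 : (p : ℂ) ≠ 0 := by exact_mod_cast hp.ne'
  have h2 : (p' : ℂ) ≠ 0 := by exact_mod_cast hp'.ne'
  rw [appell, appell, ← tsum_mul_left, ← tsum_mul_left, ← Summable.tsum_sub
    ((summable_appell hp' _ _ _ hT).mul_left _) ((summable_appell hp' _ _ _ hT).mul_left _), Psi]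
  refine tsum_congr fun n => ?_
  rw [← mul_div_assoc, ← mul_div_assoc, appellExp, appellExp, ← expTwoPi_add, ← expTwoPi_add]
  have e1 : u + (p * n : ℂ) * τ = u + n * (p * τ) := by ring
  have e2 : u + ((p * n : ℂ) - r) * τ = u - r * τ + n * (p * τ) := by ring
  rw [e1, e2]
  congr 3
  · rw [kap, ratio]; push_cast; field_simp; ring
  · rw [kap, ratio]; push_cast; field_simp; ring

/-- Completing the square after the shift by θτ gives both halves of Ψ the same μ = a(r-2θ) - s:
adding 2aθ recovers ar - s, and adding 2a(θ-r) recovers -ar - s. -/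
theorem psiBlock_eq (p p' : ℕ) (hp : 0 < p) (hp' : 0 < p') (r s θ : ℤ) (v : ℂ) {τ : ℂ}
    (hτ : 0 < τ.im) :
    psiBlock p p' r s θ v τ = expTwoPi (kap p p' (r - 2 * θ) s * v -
      (kap p p' (r - 2 * θ) s : ℂ) ^ 2 / (4 * ratio p p') * τ) * Psi p p' r s (v + θ * τ) τ := by
  have h1 : (p : ℂ) ≠ 0 := by exact_mod_cast hp.ne'
  have h2 : (p' : ℂ) ≠ 0 := by exact_mod_cast hp'.ne'
  have k1 : kap p p' (r - 2 * θ) s + 2 * (p' / p) * θ = kap p p' r s := by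
    simp only [kap]; push_cast; ring
  have k2 : kap p p' (r - 2 * θ) s + 2 * (p' / p) * ((θ - r : ℤ) : ℝ) = kap p p' (-r) s := by
    simp only [kap]; push_cast; ring
  rw [psi_eq_appell p p' hp hp' r s _ hτ, psiBlock, appellBlock, appellBlock, k1, k2, mul_sub,
    ← mul_assoc, ← mul_assoc, ← expTwoPi_add, ← expTwoPi_add]
  congr 2
  · congr 1; simp only [kap, ratio]; push_cast; field_simp; ring
  · congr 1; simp only [kap, ratio]; push_cast; field_simp; ring
  · push_cast; ring_nf

/-- The modular inversion formula for one residue class. -/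
theorem appellBlock_inversion (p p' : ℕ) (hp : 0 < p) (hp' : 0 < p') (μ : ℝ) (θ : ℤ) {τ : ℂ}
    (hτ : 0 < τ.im) (z : ℂ) : ∀ᶠ v in 𝓝[≠] z,
    1 / τ * expTwoPi (ratio p p' * v ^ 2 / τ) * appellBlock p p' μ θ (v / τ) (-1 / τ) =
      1 / p * (appell p' p' (-((μ + 2 * (p' / p) * θ : ℝ) : ℂ)) ((v - θ) / p) (τ / p) -
        I * mordellSum p' ((μ + 2 * (p' / p) * θ : ℝ) : ℂ) ((v - θ) / p) (τ / p)) := by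
  have h1 : (p : ℂ) ≠ 0 := by exact_mod_cast hp.ne'
  have h2 : (p' : ℂ) ≠ 0 := by exact_mod_cast hp'.ne'
  have hτ0 : τ ≠ 0 := by rintro rfl; simp at hτ
  have hT : 0 < (τ / p : ℂ).im := by
    rw [Complex.div_natCast_im]; positivity
  have h := appell_inversion hp' (κ := μ + 2 * (p' / p) * θ) hT ((p : ℂ)⁻¹ * (z + (-θ : ℂ)))
  rw [← map_mul_punctured (inv_ne_zero h1), ← map_add_punctured, eventually_map, eventually_map] at h
  refine h.mono fun v hv => ?_
  have e0 : (p : ℂ)⁻¹ * (v + (-θ : ℂ)) = (v - θ) / p := by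
    rw [inv_mul_eq_div]; rfl
  rw [e0] at hv
  rw [← hv, appellBlock]
  have e1 : (v - θ) / p / (τ / p) = v / τ + θ * (-1 / τ) := by field_simp; ring
  have e2 : -1 / (τ / p) = p * (-1 / τ) := by field_simp
  rw [e1, e2]
  have e3 : expTwoPi (ratio p p' * v ^ 2 / τ) *
      expTwoPi (-2 * ratio p p' * θ * (v / τ) - ratio p p' * θ ^ 2 * (-1 / τ)) =
      expTwoPi (p' * ((v - θ) / p) ^ 2 / (τ / p)) := by
    rw [← expTwoPi_add]; congr 1; rw [ratio]; field_simp; ring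
  rw [← e3]
  field_simp

/-- Writing the block as a sum over all integers with an indicator allows blocks with different θ to
be added termwise in x. -/
theorem hasSum_appellBlock (p p' : ℕ) (hp : 0 < p) (hp' : 0 < p') (μ : ℝ) (θ : ℤ) (v : ℂ) {τ : ℂ}
    (hτ : 0 < τ.im) :
    HasSum (fun x : ℤ => if (p : ℤ) ∣ x - θ then
      expTwoPi (ratio p p' * x ^ 2 * τ + μ * (v + x * τ)) / (1 - expTwoPi (v + x * τ)) else 0)
      (appellBlock p p' μ θ v τ) := by
  have h1 : (p : ℂ) ≠ 0 := by exact_mod_cast hp.ne'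
  have hp0 : (p : ℤ) ≠ 0 := by exact_mod_cast hp.ne'
  have hT := natCast_mul_im_pos hp hτ
  have hinj : Function.Injective fun k : ℤ => θ + p * k := fun k l h =>
    mul_left_cancel₀ hp0 (add_left_cancel h)
  rw [← hinj.hasSum_iff]
  · have hs := (summable_appell hp' ((μ + 2 * (p' / p) * θ : ℝ) : ℂ) 0 (v + θ * τ) hT).hasSum.mul_left
      (expTwoPi (-2 * ratio p p' * θ * v - ratio p p' * θ ^ 2 * τ))
    rw [appellBlock, appell]
    refine Eq.mpr (congrArg (fun F => HasSum F _) (funext fun k => ?_)) hs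
    simp only [Function.comp_apply, add_sub_cancel_left, dvd_mul_right, if_true]
    rw [← mul_div_assoc, appellExp, ← expTwoPi_add]
    have e1 : v + ((θ + p * k : ℤ) : ℂ) * τ = v + θ * τ + k * (p * τ) := by push_cast; ring
    rw [e1]
    congr 2
    rw [ratio]; push_cast; field_simp; ring
  · intro x hx
    rw [if_neg]
    rintro ⟨k, hk⟩
    exact hx ⟨k, by simp only; omega⟩

/-! ### The discrete part: sums over the discrete spectrum. -/

/-- `2i sin(π a r y)` for integers `y`. -/
def sinCoef (p p' : ℕ) (r y : ℤ) : ℂ :=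
  expTwoPi (ratio p p' * r * y / 2) - expTwoPi (-(ratio p p' * r * y / 2))

theorem sinCoef_neg (p p' : ℕ) (r y : ℤ) : sinCoef p p' r (-y) = -sinCoef p p' r y := by
  rw [sinCoef, sinCoef, neg_sub]; push_cast; ring_nf

theorem sinCoef_add (p p' : ℕ) (hp : 0 < p) (r y k : ℤ) :
    sinCoef p p' r (y + 2 * p * k) = sinCoef p p' r y := by
  have h1 : (p : ℂ) ≠ 0 := by exact_mod_cast hp.ne'
  rw [sinCoef, sinCoef]
  congr 1
  · refine expTwoPi_eq_of_sub_int (p' * r * k) ?_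
    rw [ratio]; push_cast; field_simp
  · refine expTwoPi_eq_of_sub_int (-(p' * r * k)) ?_
    rw [ratio]; push_cast; field_simp; ring

theorem sinCoef_eq_zero (p p' : ℕ) (hp : 0 < p) (r k : ℤ) : sinCoef p p' r (p * k) = 0 := by
  have h1 : (p : ℂ) ≠ 0 := by exact_mod_cast hp.ne'
  rw [sinCoef, sub_eq_zero]
  refine expTwoPi_eq_of_sub_int (p' * r * k) ?_
  rw [ratio]; push_cast; field_simp; ring

theorem sinCoef_eq_sin (p p' : ℕ) (r y : ℤ) :
    sinCoef p p' r y = 2 * I * Complex.sin (Real.pi * ratio p p' * r * y) := by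
  rw [sinCoef, expTwoPi, expTwoPi, Complex.sin]
  have e1 : 2 * Real.pi * I * (ratio p p' * r * y / 2) = Real.pi * ratio p p' * r * y * I := by ring
  have e2 : 2 * Real.pi * I * -(ratio p p' * r * y / 2) = -(Real.pi * ratio p p' * r * y) * I := by ring
  rw [e1, e2]
  linear_combination (cexp (Real.pi * ratio p p' * r * y * I) -
    cexp (-(Real.pi * ratio p p' * r * y) * I)) * Complex.I_sq

/-- The index `m` of an element of the discrete spectra. -/
def spectraIndex (p p' : ℕ) (l : ℤ × ℤ × ℤ) : ℤ := (l.1 - 2 * l.2.2) * p' - l.2.1 * p - p'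

theorem mem_discreteSpectra' (p p' : ℕ) (l : ℤ × ℤ × ℤ) :
    l ∈ discreteSpectra p p' ↔ (1 ≤ l.1 ∧ l.1 ≤ p - 1) ∧ (0 ≤ l.2.1 ∧ l.2.1 ≤ p' - 1) ∧
      (0 ≤ spectraIndex p p' l ∧ spectraIndex p p' l ≤ p - 1) := by
  obtain ⟨r, s, θ⟩ := l
  rw [mem_discreteSpectra]
  simp only [spectraIndex]
  refine and_congr_right fun _ => and_congr_right fun _ => ?_
  constructor
  · rintro ⟨m, hm, h⟩
    have : m = (r - 2 * θ) * p' - s * p - p' := by linarith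
    rwa [← this]
  · intro h
    exact ⟨_, h, by ring⟩

/-- By coprimality the index m fixes s modulo p', hence s, and then ρ = r - 2θ. Only the splitting
of ρ into r and θ remains free in a fibre. -/
theorem spectra_unique (p p' : ℕ) (hp : 0 < p) (hcop : Nat.Coprime p p') {m ρ σ : ℤ}
    (hσ : 0 ≤ σ) (hσ' : σ < p') (hρ : ρ * p' - σ * p = m + p') {l : ℤ × ℤ × ℤ}
    (hl : l ∈ discreteSpectra p p') (h4 : spectraIndex p p' l = m) :
    l.2.1 = σ ∧ l.1 - 2 * l.2.2 = ρ := by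
  have hp' : (0 : ℤ) < p' := by omega
  have hp0 : (0 : ℤ) < p := by omega
  rw [mem_discreteSpectra'] at hl
  obtain ⟨h1, h2, h3⟩ := hl
  rw [spectraIndex] at h4
  have h5 : (l.1 - 2 * l.2.2 - ρ) * p' = (l.2.1 - σ) * p := by linarith
  have h6 : (p' : ℤ) ∣ l.2.1 - σ := by
    have : IsCoprime (p' : ℤ) (p : ℤ) := (Nat.isCoprime_iff_coprime.2 hcop).symm
    exact this.dvd_of_dvd_mul_right ⟨l.1 - 2 * l.2.2 - ρ, by rw [← h5]; ring⟩
  have h7 : l.2.1 - σ = 0 := by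
    apply Int.eq_zero_of_abs_lt_dvd h6
    rw [abs_lt]; constructor <;> omega
  rw [h7, zero_mul] at h5
  have h8 := (mul_eq_zero.1 h5).resolve_right hp'.ne'
  constructor <;> omega

/-- The sum over the elements of the discrete spectra with a given index. -/
theorem sum_discreteSpectra_fiber (p p' : ℕ) (hp : 0 < p) (hcop : Nat.Coprime p p') (r x m ρ σ : ℤ)
    (hσ : 0 ≤ σ) (hσ' : σ < p') (hm : 0 ≤ m) (hm' : m < p) (hρ : ρ * p' - σ * p = m + p') :
    ∑ l ∈ (discreteSpectra p p').filter (fun l => spectraIndex p p' l = m),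
      sinCoef p p' r l.1 * ((if (p : ℤ) ∣ x - l.2.2 then 1 else 0) -
        (if (p : ℤ) ∣ x - (l.2.2 - l.1) then 1 else 0)) = sinCoef p p' r (2 * x + ρ) := by
  have hp' : (0 : ℤ) < p' := by omega
  have hp0 : (0 : ℤ) < p := by omega
  have huniq : ∀ l ∈ (discreteSpectra p p').filter (fun l => spectraIndex p p' l = m),
      l.2.1 = σ ∧ l.1 - 2 * l.2.2 = ρ := fun l hl =>
    spectra_unique p p' hp hcop hσ hσ' hρ (Finset.mem_filter.1 hl).1 (Finset.mem_filter.1 hl).2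
  -- With r' - 2θ' = ρ, the two congruences mod p become 2x + ρ ≡ r' and 2x + ρ ≡ -r' mod 2p.
  have hd1 : ∀ l : ℤ × ℤ × ℤ, l.1 - 2 * l.2.2 = ρ → ((p : ℤ) ∣ x - l.2.2 ↔ (2 * p : ℤ) ∣ 2 * x + ρ - l.1) := by
    intro l hl
    rw [show 2 * x + ρ - l.1 = 2 * (x - l.2.2) by rw [← hl]; ring]
    exact (mul_dvd_mul_iff_left two_ne_zero).symm
  have hd2 : ∀ l : ℤ × ℤ × ℤ, l.1 - 2 * l.2.2 = ρ →
      ((p : ℤ) ∣ x - (l.2.2 - l.1) ↔ (2 * p : ℤ) ∣ 2 * x + ρ + l.1) := by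
    intro l hl
    rw [show 2 * x + ρ + l.1 = 2 * (x - (l.2.2 - l.1)) by rw [← hl]; ring]
    exact (mul_dvd_mul_iff_left two_ne_zero).symm
  set y := 2 * x + ρ with hy
  set y₀ := y % (2 * p) with hy₀
  set q := y / (2 * p) with hq
  have hdm : y = y₀ + 2 * p * q := by rw [hy₀, hq]; exact (Int.emod_add_mul_ediv y (2 * p)).symm
  have hlo : 0 ≤ y₀ := Int.emod_nonneg _ (by omega)
  have hhi : y₀ < 2 * p := Int.emod_lt_of_pos _ (by omega)
  have dv : ∀ c : ℤ, ((2 * p : ℤ) ∣ y - c ↔ (2 * p : ℤ) ∣ y₀ - c) := by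
    intro c
    rw [hdm, show y₀ + 2 * p * q - c = y₀ - c + 2 * p * q by ring]
    exact (Int.dvd_add_left (dvd_mul_right _ _))
  have dv1 : ∀ c : ℤ, 1 ≤ c → c ≤ p - 1 → ((2 * p : ℤ) ∣ y - c ↔ c = y₀) := by
    intro c hc1 hc2
    rw [dv]
    constructor
    · intro h
      have := Int.eq_zero_of_abs_lt_dvd h (by rw [abs_lt]; constructor <;> omega)
      omega
    · rintro rfl; simp
  have dv2 : ∀ c : ℤ, 1 ≤ c → c ≤ p - 1 → ((2 * p : ℤ) ∣ y + c ↔ c = 2 * p - y₀) := by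
    intro c hc1 hc2
    rw [← sub_neg_eq_add, dv, sub_neg_eq_add]
    constructor
    · intro h
      have h' : (2 * p : ℤ) ∣ y₀ + c - 2 * p := (dvd_sub_self_right).2 h
      have := Int.eq_zero_of_abs_lt_dvd h' (by rw [abs_lt]; constructor <;> omega)
      omega
    · rintro rfl; simp
  have hterm : ∀ l ∈ (discreteSpectra p p').filter (fun l => spectraIndex p p' l = m),
      sinCoef p p' r l.1 * ((if (p : ℤ) ∣ x - l.2.2 then 1 else 0) -
        (if (p : ℤ) ∣ x - (l.2.2 - l.1) then 1 else 0)) =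
      sinCoef p p' r l.1 * ((if l.1 = y₀ then 1 else 0) - (if l.1 = 2 * p - y₀ then 1 else 0)) := by
    intro l hl
    have h1 := (huniq l hl).2
    rw [Finset.mem_filter, mem_discreteSpectra'] at hl
    obtain ⟨⟨h2, -, -⟩, -⟩ := hl
    simp only [hd1 l h1, hd2 l h1, dv1 _ h2.1 h2.2, dv2 _ h2.1 h2.2]
  rw [Finset.sum_congr rfl hterm]
  have hmem : ∀ r' : ℤ, 1 ≤ r' → r' ≤ p - 1 → (2 : ℤ) ∣ r' - ρ →
      (r', σ, (r' - ρ) / 2) ∈ (discreteSpectra p p').filter (fun l => spectraIndex p p' l = m) := by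
    intro r' h1 h2 h3
    obtain ⟨k, hk⟩ := h3
    have e : spectraIndex p p' (r', σ, (r' - ρ) / 2) = m := by
      rw [spectraIndex]
      simp only []
      rw [hk, Int.mul_ediv_cancel_left _ two_ne_zero, ← hk]
      linear_combination hρ
    rw [Finset.mem_filter, mem_discreteSpectra']
    refine ⟨⟨⟨h1, h2⟩, ⟨hσ, by simp only []; omega⟩, ?_⟩, e⟩
    rw [e]; omega
  have hsin : sinCoef p p' r y = sinCoef p p' r y₀ := by
    rw [hdm, sinCoef_add p p' hp]
  have hpar : y₀ = 2 * (x - p * q) + ρ := by linarith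
  have hext : ∀ l ∈ (discreteSpectra p p').filter (fun l => spectraIndex p p' l = m), ∀ r' : ℤ,
      l.1 = r' → l = (r', σ, (r' - ρ) / 2) := by
    intro l hl r' hr
    have h1 := huniq l hl
    obtain ⟨a, b, c⟩ := l
    simp only at h1 hr
    obtain ⟨h2, h3⟩ := h1
    subst hr h2
    have : c = (a - ρ) / 2 := by omega
    rw [this]
  -- If 0 < y₀ < p only r' = y₀ contributes; if p < y₀ < 2p only r' = 2p - y₀, with a minus sign
  -- matched by the sine. At y₀ = 0 and y₀ = p no r' qualifies and the sine vanishes. The parity y₀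
  -- ≡ ρ mod 2 makes the corresponding θ' an integer.
  rcases lt_trichotomy y₀ p with hlt | heq | hgt
  · rcases eq_or_lt_of_le hlo with h0 | h0
    · rw [hsin, ← h0, show (0 : ℤ) = p * 0 by ring, sinCoef_eq_zero p p' hp]
      refine Finset.sum_eq_zero fun l hl => ?_
      rw [Finset.mem_filter, mem_discreteSpectra'] at hl
      obtain ⟨⟨h2, -, -⟩, -⟩ := hl
      rw [if_neg (by omega), if_neg (by omega)]; simp
    · have h1 : (2 : ℤ) ∣ y₀ - ρ := ⟨x - p * q, by rw [hpar]; ring⟩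
      rw [Finset.sum_eq_single (y₀, σ, (y₀ - ρ) / 2)]
      · simp only [if_true]
        rw [if_neg (by omega), hsin]; ring
      · intro l hl hne
        have h2 : l.1 ≠ y₀ := fun h => hne (hext l hl y₀ h)
        rw [Finset.mem_filter, mem_discreteSpectra'] at hl
        obtain ⟨⟨h3, -, -⟩, -⟩ := hl
        rw [if_neg h2, if_neg (by omega)]; simp
      · intro h
        exact absurd (hmem y₀ (by omega) (by omega) h1) h
  · rw [hsin, heq, show (p : ℤ) = p * 1 by ring, sinCoef_eq_zero p p' hp]
    refine Finset.sum_eq_zero fun l hl => ?_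
    rw [Finset.mem_filter, mem_discreteSpectra'] at hl
    obtain ⟨⟨h2, -, -⟩, -⟩ := hl
    rw [if_neg (by omega), if_neg (by omega)]; simp
  · have h1 : (2 : ℤ) ∣ 2 * p - y₀ - ρ := ⟨p - (x - p * q) - ρ, by rw [hpar]; ring⟩
    rw [Finset.sum_eq_single (2 * p - y₀, σ, (2 * p - y₀ - ρ) / 2)]
    · simp only [if_true]
      rw [if_neg (by omega), hsin]
      have : sinCoef p p' r (2 * p - y₀) = -sinCoef p p' r y₀ := by
        rw [← sinCoef_neg, ← sinCoef_add p p' hp r (-y₀) 1]; congr 1; ring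
      rw [this]; ring
    · intro l hl hne
      have h2 : l.1 ≠ 2 * p - y₀ := fun h => hne (hext l hl _ h)
      rw [Finset.mem_filter, mem_discreteSpectra'] at hl
      obtain ⟨⟨h3, -, -⟩, -⟩ := hl
      rw [if_neg (by omega), if_neg h2]; simp
    · intro h
      exact absurd (hmem _ (by omega) (by omega) h1) h

theorem exists_spectra_solution (p p' : ℕ) (hp' : 0 < p') (hcop : Nat.Coprime p p') (n : ℤ) :
    ∃ A B : ℤ, 0 ≤ B ∧ B < p' ∧ A * p' + B * p = n := by
  have hc : IsCoprime (p : ℤ) (p' : ℤ) := Nat.isCoprime_iff_coprime.2 hcop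
  obtain ⟨a, b, hab⟩ := hc
  have h0 : (0 : ℤ) < p' := by omega
  refine ⟨b * n + (a * n / p') * p, a * n % p', Int.emod_nonneg _ h0.ne', Int.emod_lt_of_pos _ h0, ?_⟩
  have := Int.emod_add_mul_ediv (a * n) p'
  linear_combination n * hab + (p : ℤ) * this

theorem sum_Ico_int_eq_sum_range (p : ℕ) (f : ℤ → ℂ) :
    ∑ m ∈ Finset.Ico (0 : ℤ) p, f m = ∑ m ∈ Finset.range p, f m := by
  refine Finset.sum_nbij' (fun m => m.toNat) (fun n => (n : ℤ)) ?_ ?_ ?_ ?_ ?_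
  · intro m hm; rw [Finset.mem_Ico] at hm; rw [Finset.mem_range]; omega
  · intro m hm; rw [Finset.mem_range] at hm; rw [Finset.mem_Ico]; omega
  · intro m hm; rw [Finset.mem_Ico] at hm; omega
  · intro m hm; simp
  · intro m hm; rw [Finset.mem_Ico] at hm; rw [Int.toNat_of_nonneg hm.1]

/-- The p spectral indices form a geometric progression converting the denominator 1 - e^{2πiY} of
the blocks at modulus τ into the denominator 1 - e^{2πi(Y/p)} produced by inversion at modulus τ/p.
-/
theorem sum_expTwoPi_geometric (p p' : ℕ) (hp : 0 < p) (Y : ℂ) (hY : expTwoPi (Y / p) ≠ 1) :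
    ∑ m ∈ Finset.Ico (0 : ℤ) p, expTwoPi (((m : ℂ) + p') / p * Y) =
      expTwoPi (ratio p p' * Y) * (1 - expTwoPi Y) / (1 - expTwoPi (Y / p)) := by
  have h1 : (p : ℂ) ≠ 0 := by exact_mod_cast hp.ne'
  rw [sum_Ico_int_eq_sum_range p fun m => expTwoPi (((m : ℂ) + p') / p * Y)]
  have e : ∀ m ∈ Finset.range p, expTwoPi ((((m : ℤ) : ℂ) + p') / p * Y) =
      expTwoPi (ratio p p' * Y) * expTwoPi (Y / p) ^ m := by
    intro m _
    rw [← expTwoPi_nat_mul, ← expTwoPi_add]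
    congr 1; rw [ratio]; push_cast; field_simp; ring
  rw [Finset.sum_congr rfl e, ← Finset.mul_sum, geom_sum_eq hY, ← expTwoPi_nat_mul,
    mul_div_cancel₀ Y h1, mul_div_assoc]
  congr 1
  rw [← neg_sub, ← neg_sub (1 : ℂ) (expTwoPi (Y / p)), neg_div_neg_eq]

theorem expTwoPi_div_ne_one {p : ℕ} (hp : 0 < p) {Y : ℂ} (h : expTwoPi Y ≠ 1) :
    expTwoPi (Y / p) ≠ 1 := by
  have h1 : (p : ℂ) ≠ 0 := by exact_mod_cast hp.ne'
  intro h2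
  apply h
  rw [← mul_div_cancel₀ Y h1, expTwoPi_nat_mul, h2, one_pow]

/-- The summand at `x` of the discrete part of the inversion formula. -/
theorem sum_discreteSpectra_term (p p' : ℕ) (hp : 0 < p) (hp' : 0 < p') (hcop : Nat.Coprime p p')
    (r θ x : ℤ) (X W : ℂ) (hX : expTwoPi X ≠ 1) :
    ∑ l ∈ discreteSpectra p p', sinCoef p p' r l.1 *
        expTwoPi (ratio p p' * (r - 2 * θ) * (l.1 - 2 * l.2.2) / 2) *
        ((if (p : ℤ) ∣ x - l.2.2 then
            expTwoPi (W + (kap p p' (l.1 - 2 * l.2.2) l.2.1 : ℝ) * X) / (1 - expTwoPi X) else 0) -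
          (if (p : ℤ) ∣ x - (l.2.2 - l.1) then
            expTwoPi (W + (kap p p' (l.1 - 2 * l.2.2) l.2.1 : ℝ) * X) / (1 - expTwoPi X) else 0)) =
      expTwoPi (W + ratio p p' * r * x + ratio p p' * (X - (θ - r))) /
          (1 - expTwoPi ((X - (θ - r)) / p)) -
        expTwoPi (W - ratio p p' * r * x + ratio p p' * (X - θ)) /
          (1 - expTwoPi ((X - θ) / p)) := by
  have h1 : (p : ℂ) ≠ 0 := by exact_mod_cast hp.ne'
  have h2 : (p' : ℂ) ≠ 0 := by exact_mod_cast hp'.ne'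
  have hE1 : expTwoPi (X - (θ - r)) = expTwoPi X :=
    expTwoPi_eq_of_sub_int (-(θ - r)) (by push_cast; ring)
  have hE2 : expTwoPi (X - θ) = expTwoPi X :=
    expTwoPi_eq_of_sub_int (-θ) (by push_cast; ring)
  have hmaps : ∀ l ∈ discreteSpectra p p', spectraIndex p p' l ∈ Finset.Ico (0 : ℤ) p := by
    intro l hl
    rw [mem_discreteSpectra'] at hl
    rw [Finset.mem_Ico]; omega
  rw [← Finset.sum_fiberwise_of_maps_to hmaps]
  have hfib : ∀ m ∈ Finset.Ico (0 : ℤ) p,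
      ∑ l ∈ (discreteSpectra p p').filter (fun l => spectraIndex p p' l = m), sinCoef p p' r l.1 *
        expTwoPi (ratio p p' * (r - 2 * θ) * (l.1 - 2 * l.2.2) / 2) *
        ((if (p : ℤ) ∣ x - l.2.2 then
            expTwoPi (W + (kap p p' (l.1 - 2 * l.2.2) l.2.1 : ℝ) * X) / (1 - expTwoPi X) else 0) -
          (if (p : ℤ) ∣ x - (l.2.2 - l.1) then
            expTwoPi (W + (kap p p' (l.1 - 2 * l.2.2) l.2.1 : ℝ) * X) / (1 - expTwoPi X) else 0)) =
      (expTwoPi (W + ratio p p' * r * x) * expTwoPi (((m : ℂ) + p') / p * (X - (θ - r))) -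
        expTwoPi (W - ratio p p' * r * x) * expTwoPi (((m : ℂ) + p') / p * (X - θ))) /
        (1 - expTwoPi X) := by
    intro m hm
    rw [Finset.mem_Ico] at hm
    -- The Bézout representation has +Bp; replacing B > 0 by p' - B and A by A + p changes the sign
    -- of the second term while staying in range.
    obtain ⟨ρ, σ, hσ, hσ', hρ⟩ : ∃ ρ σ : ℤ, 0 ≤ σ ∧ σ < p' ∧ ρ * p' - σ * p = m + p' := by
      obtain ⟨A, B, hB, hB', hAB⟩ := exists_spectra_solution p p' hp' hcop (m + p')
      rcases eq_or_lt_of_le hB with h3 | h3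
      · exact ⟨A, 0, le_rfl, by omega, by rw [← h3] at hAB; linear_combination hAB⟩
      · exact ⟨A + p, p' - B, by omega, by omega, by linear_combination hAB⟩
    have hterm : ∀ l ∈ (discreteSpectra p p').filter (fun l => spectraIndex p p' l = m),
        sinCoef p p' r l.1 * expTwoPi (ratio p p' * (r - 2 * θ) * (l.1 - 2 * l.2.2) / 2) *
        ((if (p : ℤ) ∣ x - l.2.2 then
            expTwoPi (W + (kap p p' (l.1 - 2 * l.2.2) l.2.1 : ℝ) * X) / (1 - expTwoPi X) else 0) -
          (if (p : ℤ) ∣ x - (l.2.2 - l.1) then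
            expTwoPi (W + (kap p p' (l.1 - 2 * l.2.2) l.2.1 : ℝ) * X) / (1 - expTwoPi X) else 0)) =
        (expTwoPi (ratio p p' * (r - 2 * θ) * ρ / 2) *
          (expTwoPi (W + ((m : ℂ) + p') / p * X) / (1 - expTwoPi X))) *
        (sinCoef p p' r l.1 * ((if (p : ℤ) ∣ x - l.2.2 then 1 else 0) -
        (if (p : ℤ) ∣ x - (l.2.2 - l.1) then 1 else 0))) := by
      intro l hl
      rw [Finset.mem_filter] at hl
      obtain ⟨hl, hlm⟩ := hl
      obtain ⟨hu1, hu2⟩ := spectra_unique p p' hp hcop hσ hσ' hρ hl hlm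
      have hk : ((kap p p' (l.1 - 2 * l.2.2) l.2.1 : ℝ) : ℂ) = ((m : ℂ) + p') / p := by
        rw [kap, hu1, hu2, eq_div_iff h1]
        have : (ρ * p' - σ * p : ℂ) = m + p' := by exact_mod_cast hρ
        push_cast; field_simp; linear_combination this
      have hk2 : ((l.1 : ℂ) - 2 * l.2.2) = ρ := by exact_mod_cast hu2
      rw [hk, hk2]
      split_ifs <;> ring
    rw [Finset.sum_congr rfl hterm, ← Finset.mul_sum,
      sum_discreteSpectra_fiber p p' hp hcop r x m ρ σ hσ hσ' hm.1 hm.2 hρ, sinCoef]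
    -- Replacing aρ by (m+p')/p changes the phases only by integer multiples of σ.
    have hρc : ratio p p' * ρ = ((m : ℂ) + p') / p + σ := by
      have : (ρ * p' - σ * p : ℂ) = m + p' := by exact_mod_cast hρ
      rw [ratio]; field_simp; linear_combination this
    rw [← expTwoPi_add, ← expTwoPi_add, mul_sub, sub_div]
    congr 1
    · rw [← mul_div_assoc, div_mul_eq_mul_div, ← expTwoPi_add, ← expTwoPi_add]
      congr 1
      refine expTwoPi_eq_of_sub_int (σ * (r - θ)) ?_
      push_cast; linear_combination (r - θ : ℂ) * hρc
    · rw [← mul_div_assoc, div_mul_eq_mul_div, ← expTwoPi_add, ← expTwoPi_add]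
      congr 1
      refine expTwoPi_eq_of_sub_int (σ * (-θ)) ?_
      push_cast; linear_combination (-θ : ℂ) * hρc
  rw [Finset.sum_congr rfl hfib, ← Finset.sum_div, Finset.sum_sub_distrib, ← Finset.mul_sum,
    ← Finset.mul_sum, sum_expTwoPi_geometric p p' hp _ (expTwoPi_div_ne_one hp (hE1 ▸ hX)),
    sum_expTwoPi_geometric p p' hp _ (expTwoPi_div_ne_one hp (hE2 ▸ hX)), hE1, hE2, sub_div]
  have h3 : 1 - expTwoPi X ≠ 0 := sub_ne_zero.2 (Ne.symm hX)
  congr 1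
  · rw [expTwoPi_add (W + _)]
    field_simp
  · rw [expTwoPi_add (W - _)]
    field_simp

/-- The discrete part of the inversion formula. -/
theorem sum_discreteSpectra_psiBlock (p p' : ℕ) (hp : 0 < p) (hp' : 0 < p')
    (hcop : Nat.Coprime p p') (r s θ : ℤ) (v : ℂ) {τ : ℂ} (hτ : 0 < τ.im)
    (hv : ∀ x : ℤ, expTwoPi (v + x * τ) ≠ 1) :
    appell p' p' (-(kap p p' r s : ℂ)) ((v - θ) / p) (τ / p) -
        appell p' p' (-(kap p p' (-r) s : ℂ)) ((v - (θ - r)) / p) (τ / p) =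
      -∑ l ∈ discreteSpectra p p', sinCoef p p' r l.1 *
        expTwoPi (ratio p p' * (r - 2 * θ) * (l.1 - 2 * l.2.2) / 2) *
        psiBlock p p' l.1 l.2.1 l.2.2 v τ := by
  have h1 : (p : ℂ) ≠ 0 := by exact_mod_cast hp.ne'
  have hT : 0 < (τ / p : ℂ).im := by
    rw [Complex.div_natCast_im]; positivity
  have hR := hasSum_sum (s := discreteSpectra p p') fun l _ =>
    ((hasSum_appellBlock p p' hp hp' (kap p p' (l.1 - 2 * l.2.2) l.2.1) l.2.2 v hτ).sub
      (hasSum_appellBlock p p' hp hp' (kap p p' (l.1 - 2 * l.2.2) l.2.1) (l.2.2 - l.1) v hτ)).mul_left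
      (sinCoef p p' r l.1 * expTwoPi (ratio p p' * (r - 2 * θ) * (l.1 - 2 * l.2.2) / 2))
  have hL := (summable_appell hp' p' (-(kap p p' r s : ℂ)) ((v - θ) / p) hT).hasSum.sub
    (summable_appell hp' p' (-(kap p p' (-r) s : ℂ)) ((v - (θ - r)) / p) hT).hasSum
  rw [← neg_eq_iff_eq_neg, eq_comm]
  refine hR.unique (Eq.mpr (congrArg (fun F => HasSum F _) (funext fun x => ?_)) hL.neg)
  rw [sum_discreteSpectra_term p p' hp hp' hcop r θ x (v + x * τ) _ (hv x), neg_sub]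
  simp only [appellExp]
  congr 1
  · congr 1
    · refine expTwoPi_eq_of_sub_int (-(s * x)) ?_
      rw [kap, ratio]; push_cast; field_simp; ring
    · congr 2; field_simp; ring
  · congr 1
    · refine expTwoPi_eq_of_sub_int (-(s * x)) ?_
      rw [kap, ratio]; push_cast; field_simp; ring
    · congr 2; field_simp; ring

/-! ### The continuous part: folding residues mod 2pp' onto the Kac table. -/

/-- L indices with pairwise incongruent images form a complete residue system, so the sum does not
depend on the choice of representatives. -/
theorem sum_eq_sum_zmod {ι : Type*} (L : ℕ) [NeZero L] (W : ℤ → ℂ)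
    (hW : ∀ n k : ℤ, W (n + L * k) = W n) (S : Finset ι) (f : ι → ℤ)
    (hinj : ∀ i ∈ S, ∀ j ∈ S, (L : ℤ) ∣ f i - f j → i = j) (hcard : S.card = L) :
    ∑ i ∈ S, W (f i) = ∑ x : ZMod L, W x.val := by
  classical
  have hval : ∀ n : ℤ, W ((n : ZMod L).val : ℤ) = W n := by
    intro n
    rw [ZMod.val_intCast, ← hW (n % L) (n / L), Int.emod_add_mul_ediv]
  have hinj' : Set.InjOn (fun i => (f i : ZMod L)) S := by
    intro i hi j hj hij
    refine hinj i hi j hj ?_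
    have h : ((f j : ℤ) : ZMod L) = (f i : ℤ) := hij.symm
    rwa [ZMod.intCast_eq_intCast_iff_dvd_sub] at h
  have himg : S.image (fun i => (f i : ZMod L)) = Finset.univ := by
    apply Finset.eq_univ_of_card
    rw [Finset.card_image_of_injOn hinj', hcard, ZMod.card]
  rw [← himg, Finset.sum_image hinj']
  exact Finset.sum_congr rfl fun i _ => (hval _).symm

/-- Sums of a periodic function over two complete systems of residues agree. -/
theorem sum_grid_eq (p p' : ℕ) (hp : 0 < p) (hp' : 0 < p') (hcop : Nat.Coprime p p') (W : ℤ → ℂ)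
    (hW : ∀ n k : ℤ, W (n + 2 * p * p' * k) = W n) :
    ∑ j ∈ Finset.Ico (-(p' : ℤ)) p', ∑ k ∈ Finset.Ico (0 : ℤ) p, W (j + 2 * p' * k) =
      ∑ A ∈ Finset.Ico (-(p : ℤ)) p, ∑ B ∈ Finset.Ico (0 : ℤ) p', W (A * p' + B * p) := by
  have hp0 : (0 : ℤ) < p := by omega
  have hp0' : (0 : ℤ) < p' := by omega
  have : NeZero (2 * p * p') := ⟨by positivity⟩
  have hW' : ∀ n k : ℤ, W (n + ((2 * p * p' : ℕ) : ℤ) * k) = W n := by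
    intro n k; push_cast; exact hW n k
  rw [← Finset.sum_product', ← Finset.sum_product']
  rw [sum_eq_sum_zmod (2 * p * p') W hW' _ (fun q : ℤ × ℤ => q.1 + 2 * p' * q.2),
    sum_eq_sum_zmod (2 * p * p') W hW' _ (fun q : ℤ × ℤ => q.1 * p' + q.2 * p)]
  · rintro ⟨A, B⟩ h1 ⟨C, D⟩ h2 ⟨k, hk⟩
    simp only [Finset.mem_product, Finset.mem_Ico] at h1 h2 hk
    push_cast at hk
    have hc : IsCoprime (p' : ℤ) (p : ℤ) := (Nat.isCoprime_iff_coprime.2 hcop).symm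
    have d1 : (p' : ℤ) ∣ B - D :=
      hc.dvd_of_dvd_mul_right ⟨2 * p * k - (A - C), by linear_combination hk⟩
    have e1 : B - D = 0 := Int.eq_zero_of_abs_lt_dvd d1 (by rw [abs_lt]; constructor <;> omega)
    have e1' : B = D := by omega
    subst e1'
    have d2 : (2 * p : ℤ) ∣ A - C := by
      refine ⟨k, mul_right_cancel₀ hp0'.ne' ?_⟩
      linear_combination hk
    have e2 := Int.eq_zero_of_abs_lt_dvd d2 (by rw [abs_lt]; constructor <;> omega)
    rw [show A = C by omega]
  · simp only [Finset.card_product, Int.card_Ico, sub_neg_eq_add, sub_zero, Int.toNat_natCast]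
    rw [show ((p : ℤ) + p).toNat = 2 * p by omega]
  · rintro ⟨A, B⟩ h1 ⟨C, D⟩ h2 ⟨k, hk⟩
    simp only [Finset.mem_product, Finset.mem_Ico] at h1 h2 hk
    push_cast at hk
    have d1 : (2 * p' : ℤ) ∣ A - C := ⟨p * k - (B - D), by linear_combination hk⟩
    have e1 : A - C = 0 := Int.eq_zero_of_abs_lt_dvd d1 (by rw [abs_lt]; constructor <;> omega)
    have e1' : A = C := by omega
    subst e1'
    have d2 : (p : ℤ) ∣ B - D := by
      refine ⟨k, mul_left_cancel₀ (mul_pos two_pos hp0').ne' ?_⟩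
      linear_combination hk
    have e2 := Int.eq_zero_of_abs_lt_dvd d2 (by rw [abs_lt]; constructor <;> omega)
    rw [show B = D by omega]
  · simp only [Finset.card_product, Int.card_Ico, sub_neg_eq_add, sub_zero, Int.toNat_natCast]
    rw [show ((p' : ℤ) + p').toNat = 2 * p' by omega]; ring

theorem sum_Ico_neg_eq {p : ℕ} (hp : 0 < p) (f : ℤ → ℂ) :
    ∑ A ∈ Finset.Ico (-(p : ℤ)) p, f A =
      f (-p) + f 0 + ∑ A ∈ Finset.Icc (1 : ℤ) (p - 1), (f A + f (-A)) := by
  have h1 : Finset.Ico (-(p : ℤ)) p = insert (-(p : ℤ)) (insert 0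
      (Finset.Icc (1 : ℤ) (p - 1) ∪ (Finset.Icc (1 : ℤ) (p - 1)).image (fun A => -A))) := by
    ext A
    simp only [Finset.mem_Ico, Finset.mem_insert, Finset.mem_union, Finset.mem_Icc, Finset.mem_image]
    constructor
    · intro h
      rcases lt_trichotomy A 0 with h0 | h0 | h0
      · by_cases h2 : A = -p
        · exact Or.inl h2
        · exact Or.inr (Or.inr (Or.inr ⟨-A, by omega, by omega⟩))
      · exact Or.inr (Or.inl h0)
      · exact Or.inr (Or.inr (Or.inl (by omega)))
    · rintro (h | h | h | ⟨B, h, h2⟩) <;> omega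
  rw [h1, Finset.sum_insert, Finset.sum_insert, Finset.sum_union, Finset.sum_image,
    Finset.sum_add_distrib, add_assoc]
  · intro a _ b _ h; simpa using h
  · rw [Finset.disjoint_left]
    intro a ha hb
    rw [Finset.mem_image] at hb
    obtain ⟨b, hb, rfl⟩ := hb
    rw [Finset.mem_Icc] at ha hb
    omega
  · simp only [Finset.mem_union, Finset.mem_Icc, Finset.mem_image]
    rintro (h | ⟨B, h, h2⟩) <;> omega
  · simp only [Finset.mem_insert, Finset.mem_union, Finset.mem_Icc, Finset.mem_image]
    rintro (h | h | ⟨B, h, h2⟩) <;> omega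

theorem sum_Ico_zero_eq {p : ℕ} (hp : 0 < p) (f : ℤ → ℂ) :
    ∑ B ∈ Finset.Ico (0 : ℤ) p, f B = f 0 + ∑ B ∈ Finset.Icc (1 : ℤ) (p - 1), f B := by
  have h1 : Finset.Ico (0 : ℤ) p = insert 0 (Finset.Icc (1 : ℤ) (p - 1)) := by
    ext A
    simp only [Finset.mem_Ico, Finset.mem_insert, Finset.mem_Icc]
    omega
  rw [h1, Finset.sum_insert (by simp)]

/-- The rectangle is the disjoint union of `kacSet` and its point reflection. -/
theorem sum_rectangle_eq (p p' : ℕ) (hcop : Nat.Coprime p p') (g : ℤ × ℤ → ℂ) :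
    ∑ q ∈ Finset.Icc (1 : ℤ) (p - 1) ×ˢ Finset.Icc (1 : ℤ) (p' - 1), g q =
      ∑ q ∈ kacSet p p', (g q + g (p - q.1, p' - q.2)) := by
  rw [← Finset.sum_filter_add_sum_filter_not _ (fun q : ℤ × ℤ => q.1 * p' + q.2 * p ≤ p * p'),
    Finset.sum_add_distrib]
  congr 1
  refine Finset.sum_nbij' (fun q => ((p : ℤ) - q.1, (p' : ℤ) - q.2))
    (fun q => ((p : ℤ) - q.1, (p' : ℤ) - q.2)) ?_ ?_ ?_ ?_ ?_
  · rintro ⟨A, B⟩ h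
    simp only [kacSet, Finset.mem_filter, Finset.mem_product, Finset.mem_Icc, not_le] at h ⊢
    refine ⟨⟨by omega, by omega⟩, by nlinarith⟩
  · rintro ⟨A, B⟩ h
    simp only [kacSet, Finset.mem_filter, Finset.mem_product, Finset.mem_Icc, not_le] at h ⊢
    refine ⟨⟨by omega, by omega⟩, ?_⟩
    -- Coprimality keeps the points with 1 ≤ A ≤ p - 1 off the line Ap' + Bp = pp', so the point
    -- reflection exchanges `kacSet` with its complement in the rectangle.
    have hne : A * p' + B * p ≠ p * p' := by
      intro h2
      have hc : IsCoprime (p : ℤ) (p' : ℤ) := Nat.isCoprime_iff_coprime.2 hcop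
      have hd : (p : ℤ) ∣ A := hc.dvd_of_dvd_mul_right ⟨p' - B, by linear_combination h2⟩
      have := Int.le_of_dvd (by omega) hd
      omega
    have := lt_of_le_of_ne h.2 hne
    nlinarith
  · rintro ⟨A, B⟩ _; simp
  · rintro ⟨A, B⟩ _; simp
  · rintro ⟨A, B⟩ _; simp

theorem thetaCoef_zero_add (N : ℕ) (T : ℂ) (n k : ℤ) :
    thetaCoef N 0 T (n + 2 * N * k) = thetaCoef N 0 T n := by
  rw [thetaCoef, thetaCoef, ← (Equiv.addLeft k).tsum_eq fun i : ℤ =>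
    expTwoPi (((n + 2 * N * i : ℤ) : ℂ) ^ 2 * T / (4 * N) - 0 * ((n + 2 * N * i : ℤ) : ℂ) / (2 * N))]
  refine tsum_congr fun i => ?_
  have e : n + 2 * N * k + 2 * N * i = n + 2 * N * (Equiv.addLeft k i) := by
    simp; ring
  rw [e]

theorem thetaCoef_zero_neg (N : ℕ) (T : ℂ) (n : ℤ) : thetaCoef N 0 T (-n) = thetaCoef N 0 T n := by
  rw [thetaCoef, thetaCoef, ← (Equiv.neg ℤ).tsum_eq fun i : ℤ =>
    expTwoPi (((n + 2 * N * i : ℤ) : ℂ) ^ 2 * T / (4 * N) - 0 * ((n + 2 * N * i : ℤ) : ℂ) / (2 * N))]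
  refine tsum_congr fun i => ?_
  congr 1
  simp only [Equiv.neg_apply]; push_cast; ring

/-- `2i sin(π r n / p)`. -/
def sinFrac (p : ℕ) (r n : ℤ) : ℂ := expTwoPi (r * n / (2 * p)) - expTwoPi (-(r * n / (2 * p)))

theorem sinFrac_neg (p : ℕ) (r n : ℤ) : sinFrac p r (-n) = -sinFrac p r n := by
  rw [sinFrac, sinFrac, neg_sub]; push_cast; ring_nf

theorem expTwoPi_half_int (n : ℤ) : expTwoPi (n / 2) = (-1) ^ n := by
  rw [← expTwoPi_half, ← expTwoPi_int_mul]; congr 1; ring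

theorem neg_one_zpow_neg (n : ℤ) : (-1 : ℂ) ^ (-n) = (-1) ^ n := by
  rw [zpow_neg, ← inv_zpow]; norm_num

theorem sinFrac_grid (p p' : ℕ) (hp : 0 < p) (r A B : ℤ) :
    sinFrac p r (A * p' + B * p) = (-1) ^ (r * B) * sinCoef p p' r A := by
  have h1 : (p : ℂ) ≠ 0 := by exact_mod_cast hp.ne'
  have e1 : ((r : ℂ) * ((A * p' + B * p : ℤ) : ℂ) / (2 * p)) =
      ((r * B : ℤ) : ℂ) / 2 + ratio p p' * r * A / 2 := by
    rw [ratio]; push_cast; field_simp; ring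
  have e2 : -(((r * B : ℤ) : ℂ) / 2 + ratio p p' * r * A / 2) =
      ((-(r * B) : ℤ) : ℂ) / 2 + -(ratio p p' * r * A / 2) := by push_cast; ring
  rw [sinFrac, e1, e2, expTwoPi_add, expTwoPi_add, expTwoPi_half_int, expTwoPi_half_int,
    neg_one_zpow_neg, sinCoef]
  ring

theorem sinFrac_add (p p' : ℕ) (hp : 0 < p) (r n k : ℤ) :
    sinFrac p r (n + 2 * p * p' * k) = sinFrac p r n := by
  have h1 : (p : ℂ) ≠ 0 := by exact_mod_cast hp.ne'
  rw [sinFrac, sinFrac]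
  congr 1
  · refine expTwoPi_eq_of_sub_int (r * p' * k) ?_
    push_cast; field_simp
  · refine expTwoPi_eq_of_sub_int (-(r * p' * k)) ?_
    push_cast; field_simp; ring

/-- Folding a weighted theta series onto `kacSet`. -/
theorem sum_fold_kacSet (p p' : ℕ) (hp : 0 < p) (hp' : 0 < p') (hcop : Nat.Coprime p p') (r : ℤ)
    (F Θ : ℤ → ℂ) (hF : ∀ n k : ℤ, F (n + 2 * p' * k) = F n)
    (hΘ : ∀ n k : ℤ, Θ (n + 2 * p * p' * k) = Θ n) (hΘn : ∀ n, Θ (-n) = Θ n) :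
    ∑ j ∈ Finset.Ico (-(p' : ℤ)) p', ∑ k ∈ Finset.Ico (0 : ℤ) p,
        F (j + 2 * p' * k) * sinFrac p r (j + 2 * p' * k) * Θ (j + 2 * p' * k) =
      ∑ q ∈ kacSet p p', (-1) ^ (r * q.2) * sinCoef p p' r q.1 *
        (F (q.1 * p' + q.2 * p) - F (q.1 * p' - q.2 * p)) *
        (Θ (q.1 * p' + q.2 * p) - Θ (q.1 * p' - q.2 * p)) := by
  have hW : ∀ n k : ℤ, (fun n => F n * sinFrac p r n * Θ n) (n + 2 * p * p' * k) =
      (fun n => F n * sinFrac p r n * Θ n) n := by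
    intro n k
    simp only []
    rw [sinFrac_add p p' hp, hΘ, show n + 2 * p * p' * k = n + 2 * p' * (p * k) by ring, hF]
  rw [sum_grid_eq p p' hp hp' hcop (fun n => F n * sinFrac p r n * Θ n) hW]
  set W : ℤ → ℂ := fun n => F n * sinFrac p r n * Θ n with hWdef
  -- The rows A = 0 and A = -p drop out because the sine vanishes there.
  have hz0 : ∀ B : ℤ, W (0 * p' + B * p) = 0 := by
    intro B
    simp only [hWdef]
    rw [sinFrac_grid p p' hp, show (0 : ℤ) = p * 0 by ring, sinCoef_eq_zero p p' hp]; ring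
  have hzp : ∀ B : ℤ, W (-p * p' + B * p) = 0 := by
    intro B
    simp only [hWdef]
    rw [sinFrac_grid p p' hp, show -(p : ℤ) = p * (-1) by ring, sinCoef_eq_zero p p' hp]; ring
  rw [sum_Ico_neg_eq hp]
  rw [Finset.sum_eq_zero fun B _ => hzp B, Finset.sum_eq_zero fun B _ => hz0 B, zero_add, zero_add]
  have hA : ∀ A ∈ Finset.Icc (1 : ℤ) (p - 1),
      (∑ B ∈ Finset.Ico (0 : ℤ) p', W (A * p' + B * p)) +
        ∑ B ∈ Finset.Ico (0 : ℤ) p', W (-A * p' + B * p) =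
      ∑ B ∈ Finset.Icc (1 : ℤ) (p' - 1), (W (A * p' + B * p) + W (-A * p' + B * p)) := by
    intro A _
    rw [sum_Ico_zero_eq hp', sum_Ico_zero_eq hp', Finset.sum_add_distrib]
    -- The column B = 0 cancels between A and -A: F agrees by periodicity, Θ is even and the sine is
    -- odd. This removes exactly the residues n divisible by p', whose Mordell pole may obstruct the
    -- line Im = -1/2.
    have : W (-A * p' + 0 * p) = -W (A * p' + 0 * p) := by
      simp only [hWdef]
      rw [zero_mul, add_zero, add_zero, show -A * (p' : ℤ) = -(A * p') by ring, sinFrac_neg, hΘn]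
      rw [← hF (-(A * p')) A, show -(A * p') + 2 * p' * A = A * p' by ring]
      ring
    rw [this]; ring
  rw [Finset.sum_congr rfl hA, ← Finset.sum_product', sum_rectangle_eq p p' hcop]
  refine Finset.sum_congr rfl fun q _ => ?_
  obtain ⟨A, B⟩ := q
  simp only [hWdef]
  -- Four grid points correspond to each (A, B): itself, (-A, B), (p-A, p'-B) and (-(p-A), p'-B). F
  -- and Θ take only their values at Ap' ± Bp, and the signs of the sine make the sum factor into a
  -- product of differences.
  have f1 : F (-A * p' + B * p) = F (A * p' + B * p) := by
    rw [← hF (-A * p' + B * p) A]; congr 1; ring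
  have f2 : F ((p - A) * p' + (p' - B) * p) = F (A * p' - B * p) := by
    rw [← hF (A * p' - B * p) (p - A)]; congr 1; ring
  have f3 : F (-(p - A) * p' + (p' - B) * p) = F (A * p' - B * p) := by
    congr 1; ring
  have t1 : Θ (-A * p' + B * p) = Θ (A * p' - B * p) := by
    rw [← hΘn]; congr 1; ring
  have t2 : Θ ((p - A) * p' + (p' - B) * p) = Θ (A * p' + B * p) := by
    rw [← hΘn (A * p' + B * p), ← hΘ (-(A * p' + B * p)) 1]; congr 1; ring
  have t3 : Θ (-(p - A) * p' + (p' - B) * p) = Θ (A * p' - B * p) := by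
    congr 1; ring
  have s1 : sinFrac p r (-A * p' + B * p) = -((-1) ^ (r * B) * sinCoef p p' r A) := by
    rw [sinFrac_grid p p' hp, sinCoef_neg]; ring
  have s2 : sinFrac p r ((p - A) * p' + (p' - B) * p) = -((-1) ^ (r * B) * sinCoef p p' r A) := by
    rw [← sinFrac_grid p p' hp, ← sinFrac_neg, ← sinFrac_add p p' hp r (-(A * p' + B * p)) 1]
    congr 1; ring
  have s3 : sinFrac p r (-(p - A) * p' + (p' - B) * p) = (-1) ^ (r * B) * sinCoef p p' r A := by
    rw [show -(p - A) * p' + (p' - B) * p = A * p' + (-B) * (p : ℤ) by ring, sinFrac_grid p p' hp,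
      mul_neg, neg_one_zpow_neg]
  rw [f1, f2, f3, t1, t2, t3, s1, s2, s3, sinFrac_grid p p' hp]
  ring

/-- Because κp is an integer, the linear phase is constant on each class mod 2pp'. It leaves the
series, and the remaining theta constants no longer depend on κ. -/
theorem thetaCoef_split (p p' : ℕ) (hp : 0 < p) (hp' : 0 < p') (κ : ℂ) (c : ℤ) (hκ : κ * p = c)
    {τ : ℂ} (hτ : 0 < τ.im) (j : ℤ) :
    thetaCoef p' κ (τ / p) j = ∑ i ∈ Finset.Ico (0 : ℤ) p,
      expTwoPi (-κ * ((j + 2 * p' * i : ℤ) : ℂ) / (2 * p')) *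
        thetaCoef (p * p') 0 τ (j + 2 * p' * i) := by
  have h1 : (p : ℂ) ≠ 0 := by exact_mod_cast hp.ne'
  have h2 : (p' : ℂ) ≠ 0 := by exact_mod_cast hp'.ne'
  have hp0 : (p' : ℤ) ≠ 0 := by exact_mod_cast hp'.ne'
  have hT : 0 < (τ / p : ℂ).im := by
    rw [Complex.div_natCast_im]; positivity
  have hinj : Function.Injective fun k : ℤ => j + 2 * p' * k := fun k l h =>
    mul_left_cancel₀ (mul_ne_zero two_ne_zero hp0) (add_left_cancel h)
  have hs := (summable_thetaCoef hp' κ hT).comp_injective hinj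
  have h := tsum_eq_sum_residues hs 0 hp
  rw [zero_add] at h
  rw [thetaCoef]
  refine h.trans (Finset.sum_congr rfl fun i _ => ?_)
  rw [thetaCoef, ← tsum_mul_left]
  refine tsum_congr fun k => ?_
  rw [← expTwoPi_add]
  refine expTwoPi_eq_of_sub_int (-(c * k)) ?_
  push_cast
  rw [← hκ]
  field_simp
  ring

theorem mordell_nu_add_int (A : ℂ) (ν y : ℝ) (k : ℤ) (β : ℂ) :
    mordell A (ν + k) y β = mordell A ν y β := by
  simp only [mordell, mordellFun_add_int]

/-- The continuous part of the inversion formula, before contour shifts. -/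
theorem mordellSum_sub (p p' : ℕ) (hp : 0 < p) (hp' : 0 < p') (hcop : Nat.Coprime p p')
    (r s : ℤ) (V₁ V₂ β : ℂ) (h₁ : 2 * p' * V₁ + kap p p' r s = β)
    (h₂ : 2 * p' * V₂ + kap p p' (-r) s = β) {τ : ℂ} (hτ : 0 < τ.im) (F Θ : ℤ → ℂ)
    (hF : F = fun n : ℤ => expTwoPi (s * n / (2 * p')) *
      mordell (p' * (τ / p)) ((n : ℝ) / (2 * p')) (mordellLine p') β)
    (hΘ : Θ = thetaCoef (p * p') 0 τ) :
    mordellSum p' (kap p p' r s) V₁ (τ / p) - mordellSum p' (kap p p' (-r) s) V₂ (τ / p) =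
      -∑ q ∈ kacSet p p', (-1) ^ (r * q.2) * sinCoef p p' r q.1 *
        (F (q.1 * p' + q.2 * p) - F (q.1 * p' - q.2 * p)) *
        (Θ (q.1 * p' + q.2 * p) - Θ (q.1 * p' - q.2 * p)) := by
  have h1 : (p : ℂ) ≠ 0 := by exact_mod_cast hp.ne'
  have h2 : (p' : ℂ) ≠ 0 := by exact_mod_cast hp'.ne'
  have h2r : (p' : ℝ) ≠ 0 := by exact_mod_cast hp'.ne'
  have hM : ∀ n k : ℤ, mordell (p' * (τ / p)) (((n + 2 * p' * k : ℤ) : ℝ) / (2 * p'))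
      (mordellLine p') β = mordell (p' * (τ / p)) ((n : ℝ) / (2 * p')) (mordellLine p') β := by
    intro n k
    rw [← mordell_nu_add_int _ ((n : ℝ) / (2 * p')) _ k]
    congr 1
    push_cast; field_simp
  rw [← sum_fold_kacSet p p' hp hp' hcop r F Θ]
  · rw [mordellSum, mordellSum, h₁, h₂, ← Finset.sum_sub_distrib, ← Finset.sum_neg_distrib]
    refine Finset.sum_congr rfl fun j _ => ?_
    rw [thetaCoef_split p p' hp hp' _ (p' * r - s * p) (by rw [kap]; push_cast; field_simp) hτ,
      thetaCoef_split p p' hp hp' _ (p' * (-r) - s * p) (by rw [kap]; push_cast; field_simp) hτ,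
      Finset.sum_mul, Finset.sum_mul, ← Finset.sum_sub_distrib, ← Finset.sum_neg_distrib]
    refine Finset.sum_congr rfl fun i _ => ?_
    rw [hF, hΘ]
    simp only []
    rw [hM]
    -- The parameters ar - s and -ar - s give a common phase in s times e^{∓πirn/p}; their
    -- difference is minus the sine factor.
    have e1 : expTwoPi (-(kap p p' r s : ℂ) * ((j + 2 * p' * i : ℤ) : ℂ) / (2 * p')) =
        expTwoPi (s * ((j + 2 * p' * i : ℤ) : ℂ) / (2 * p')) *
          expTwoPi (-(r * ((j + 2 * p' * i : ℤ) : ℂ) / (2 * p))) := by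
      rw [← expTwoPi_add]; congr 1; rw [kap]; push_cast; field_simp; ring
    have e2 : expTwoPi (-(kap p p' (-r) s : ℂ) * ((j + 2 * p' * i : ℤ) : ℂ) / (2 * p')) =
        expTwoPi (s * ((j + 2 * p' * i : ℤ) : ℂ) / (2 * p')) *
          expTwoPi (r * ((j + 2 * p' * i : ℤ) : ℂ) / (2 * p)) := by
      rw [← expTwoPi_add]; congr 1; rw [kap]; push_cast; field_simp; ring
    rw [e1, e2, sinFrac]
    ring
  · intro n k
    rw [hF]
    simp only []
    rw [hM]
    congr 1
    refine expTwoPi_eq_of_sub_int (s * k) ?_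
    push_cast; field_simp
  · intro n k
    rw [hΘ, ← thetaCoef_zero_add (p * p') τ n k]
    congr 1; push_cast; ring
  · intro n
    rw [hΘ, thetaCoef_zero_neg]

/-! ### The hyperbolic kernel and the BPZ characters. -/

theorem cos_int_mul_pi (n : ℤ) : Complex.cos (n * Real.pi) = (-1) ^ n := by
  have h1 : cexp (n * Real.pi * I) = (-1) ^ n := by
    rw [← expTwoPi_half_int, expTwoPi]; congr 1; ring
  have h2 : cexp (-(n * Real.pi) * I) = (-1) ^ n := by
    rw [← neg_one_zpow_neg, ← expTwoPi_half_int, expTwoPi]; congr 1; push_cast; ring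
  rw [Complex.cos, h1, h2]; ring

/-- The hyperbolic kernel of the atypical-typical `S`-data. -/
def kacKernel (p p' : ℕ) (s r' s' : ℤ) (x : ℝ) : ℂ :=
  (Complex.sin (Real.pi * s * s' / ratio p p') * cexp (2 * Real.pi * x) +
      Complex.sin (2 * Real.pi * lam p p' r' ((1 + s) * s'))) /
    (Complex.cosh (2 * Real.pi * x) - Complex.cos (2 * Real.pi * lam p p' r' s'))

/-- The common denominator (1 + σy⁻¹ζ⁻¹)(1 + σy⁻¹ζ), multiplied by y/2, is a hyperbolic cosine minus
a cosine once y = e^{2πx}, ζ = e^{iα} and σ = ±1. -/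
theorem kernel_partial_fractions {y ζ Z σ : ℂ} (hy : y ≠ 0) (hζ : ζ ≠ 0) (hZ : Z ≠ 0)
    (hσ : σ ^ 2 = 1) (h₁ : 1 + σ * y⁻¹ * ζ⁻¹ ≠ 0) (h₂ : 1 + σ * y⁻¹ * ζ ≠ 0) :
    Z / (1 + σ * y⁻¹ * ζ⁻¹) - Z⁻¹ / (1 + σ * y⁻¹ * ζ) =
      I * (((Z⁻¹ - Z) * I / 2 * y + σ * ((Z⁻¹ * ζ⁻¹ - Z * ζ) * I / 2)) /
        ((y + y⁻¹) / 2 - -σ * ((ζ + ζ⁻¹) / 2))) := by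
  have hD : (y + y⁻¹) / 2 - -σ * ((ζ + ζ⁻¹) / 2) =
      y / 2 * ((1 + σ * y⁻¹ * ζ⁻¹) * (1 + σ * y⁻¹ * ζ)) := by
    field_simp
    linear_combination (-ζ) * hσ
  have hN : I * ((Z⁻¹ - Z) * I / 2 * y + σ * ((Z⁻¹ * ζ⁻¹ - Z * ζ) * I / 2)) =
      y / 2 * (Z * (1 + σ * y⁻¹ * ζ) - (1 + σ * y⁻¹ * ζ⁻¹) * Z⁻¹) := by
    field_simp
    linear_combination (y * ζ - Z ^ 2 * y * ζ + σ - σ * Z ^ 2 * ζ ^ 2) * Complex.I_sq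
  rw [div_sub_div _ _ h₁ h₂, ← mul_div_assoc, hN, hD, mul_div_mul_left _ _ (by simpa using hy)]

/-- On the line Im = -1/2 the half period turns 1 - e^{2πi(iY-ν)} into 1 + (-1)^A e^{-2πx} e^{∓iα}
with α = πB/a, so the two Mordell kernels are the partial fractions of the S-kernel. -/
theorem kacKernel_eq (p p' : ℕ) (hp : 0 < p) (hp' : 0 < p') (s A B : ℤ) (x : ℝ)
    (h₁ : expTwoPi (I * (x + ((-1 / 2 : ℝ) : ℂ) * I) -
      (((A * p' + B * p : ℤ) / (2 * p') : ℝ) : ℂ)) ≠ 1)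
    (h₂ : expTwoPi (I * (x + ((-1 / 2 : ℝ) : ℂ) * I) -
      (((A * p' - B * p : ℤ) / (2 * p') : ℝ) : ℂ)) ≠ 1) :
    expTwoPi (s * ((A * p' + B * p : ℤ) : ℂ) / (2 * p')) /
        (1 - expTwoPi (I * (x + ((-1 / 2 : ℝ) : ℂ) * I) -
          (((A * p' + B * p : ℤ) / (2 * p') : ℝ) : ℂ))) -
      expTwoPi (s * ((A * p' - B * p : ℤ) : ℂ) / (2 * p')) /
        (1 - expTwoPi (I * (x + ((-1 / 2 : ℝ) : ℂ) * I) -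
          (((A * p' - B * p : ℤ) / (2 * p') : ℝ) : ℂ))) =
      I * (-1) ^ (A * s) * kacKernel p p' s A B x := by
  have hpc : (p : ℂ) ≠ 0 := by exact_mod_cast hp.ne'
  have hpc' : (p' : ℂ) ≠ 0 := by exact_mod_cast hp'.ne'
  set α : ℂ := Real.pi * B / ratio p p' with hα
  set y := cexp (2 * Real.pi * x) with hy
  set ζ := cexp (α * I) with hζ
  set Z := cexp (s * α * I) with hZ
  set σ : ℂ := (-1) ^ A with hσ
  have hσ2 : σ ^ 2 = 1 := by
    rw [hσ, ← zpow_natCast, ← zpow_mul, mul_comm, zpow_mul]; simp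
  have e1 : expTwoPi (I * (x + ((-1 / 2 : ℝ) : ℂ) * I) -
      (((A * p' + B * p : ℤ) / (2 * p') : ℝ) : ℂ)) = -(σ * y⁻¹ * ζ⁻¹) := by
    have : I * (x + ((-1 / 2 : ℝ) : ℂ) * I) - (((A * p' + B * p : ℤ) / (2 * p') : ℝ) : ℂ) =
        1 / 2 + (((-A : ℤ) : ℂ) / 2 + (I * x + -(B / (2 * ratio p p')))) := by
      rw [ratio]; push_cast; field_simp; linear_combination (-p' : ℂ) * Complex.I_sq
    rw [this, expTwoPi_add, expTwoPi_add, expTwoPi_add, expTwoPi_half, expTwoPi_half_int,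
      neg_one_zpow_neg, hy, hζ, ← Complex.exp_neg, ← Complex.exp_neg, expTwoPi, expTwoPi,
      ← hσ]
    rw [show 2 * Real.pi * I * (I * x) = -(2 * Real.pi * (x : ℂ)) by
      linear_combination (2 * Real.pi * x : ℂ) * Complex.I_sq,
      show 2 * Real.pi * I * -(B / (2 * ratio p p')) = -(α * I) by rw [hα]; ring]
    ring
  have e2 : expTwoPi (I * (x + ((-1 / 2 : ℝ) : ℂ) * I) -
      (((A * p' - B * p : ℤ) / (2 * p') : ℝ) : ℂ)) = -(σ * y⁻¹ * ζ) := by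
    have : I * (x + ((-1 / 2 : ℝ) : ℂ) * I) - (((A * p' - B * p : ℤ) / (2 * p') : ℝ) : ℂ) =
        1 / 2 + (((-A : ℤ) : ℂ) / 2 + (I * x + (B / (2 * ratio p p')))) := by
      rw [ratio]; push_cast; field_simp; linear_combination (-p' : ℂ) * Complex.I_sq
    rw [this, expTwoPi_add, expTwoPi_add, expTwoPi_add, expTwoPi_half, expTwoPi_half_int,
      neg_one_zpow_neg, hy, hζ, ← Complex.exp_neg, expTwoPi, expTwoPi, ← hσ]
    rw [show 2 * Real.pi * I * (I * x) = -(2 * Real.pi * (x : ℂ)) by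
      linear_combination (2 * Real.pi * x : ℂ) * Complex.I_sq,
      show 2 * Real.pi * I * (B / (2 * ratio p p')) = α * I by rw [hα]; ring]
    ring
  have e3 : expTwoPi (s * ((A * p' + B * p : ℤ) : ℂ) / (2 * p')) = (-1) ^ (A * s) * Z := by
    have : (s : ℂ) * ((A * p' + B * p : ℤ) : ℂ) / (2 * p') =
        ((A * s : ℤ) : ℂ) / 2 + s * B / (2 * ratio p p') := by
      rw [ratio]; push_cast; field_simp
    rw [this, expTwoPi_add, expTwoPi_half_int, hZ, expTwoPi]
    congr 2; rw [hα]; ring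
  have e4 : expTwoPi (s * ((A * p' - B * p : ℤ) : ℂ) / (2 * p')) = (-1) ^ (A * s) * Z⁻¹ := by
    have : (s : ℂ) * ((A * p' - B * p : ℤ) : ℂ) / (2 * p') =
        ((A * s : ℤ) : ℂ) / 2 + -(s * B / (2 * ratio p p')) := by
      rw [ratio]; push_cast; field_simp; ring
    rw [this, expTwoPi_add, expTwoPi_half_int, hZ, expTwoPi, ← Complex.exp_neg]
    congr 2; rw [hα]; ring
  -- The angles 2πλ of the S-kernel are π(A-1) minus multiples of α; these reflections extract the
  -- sign (-1)^A.
  have hs : ∀ w : ℂ, Complex.sin (Real.pi * (A - 1) - w) = σ * Complex.sin w := by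
    intro w
    rw [Complex.sin_sub, show (Real.pi * ((A : ℂ) - 1)) = ((A - 1 : ℤ) : ℂ) * Real.pi by
      push_cast; ring, Complex.sin_int_mul_pi, cos_int_mul_pi, hσ, zpow_sub₀ (by norm_num)]
    simp; ring
  have hc : ∀ w : ℂ, Complex.cos (Real.pi * (A - 1) - w) = -σ * Complex.cos w := by
    intro w
    rw [Complex.cos_sub, show (Real.pi * ((A : ℂ) - 1)) = ((A - 1 : ℤ) : ℂ) * Real.pi by
      push_cast; ring, Complex.sin_int_mul_pi, cos_int_mul_pi, hσ, zpow_sub₀ (by norm_num)]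
    simp; ring
  have k1 : Complex.sin (Real.pi * s * B / ratio p p') = (Z⁻¹ - Z) * I / 2 := by
    rw [show Real.pi * s * B / ratio p p' = s * α by rw [hα]; ring, Complex.sin, hZ,
      ← Complex.exp_neg, neg_mul]
  have k2 : Complex.sin (2 * Real.pi * lam p p' A ((1 + s) * B)) =
      σ * ((Z⁻¹ * ζ⁻¹ - Z * ζ) * I / 2) := by
    rw [show 2 * Real.pi * lam p p' A ((1 + s) * B) = Real.pi * (A - 1) - (s * α + α) by
      rw [hα, lam]; push_cast; ring, hs, Complex.sin, hZ, hζ, ← Complex.exp_neg, ← Complex.exp_neg,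
      ← Complex.exp_add, ← Complex.exp_add]
    ring_nf
  have k3 : Complex.cos (2 * Real.pi * lam p p' A B) = -σ * ((ζ + ζ⁻¹) / 2) := by
    rw [show 2 * Real.pi * lam p p' A B = Real.pi * (A - 1) - α by
      rw [hα, lam]; ring, hc, Complex.cos, hζ, ← Complex.exp_neg, neg_mul α I]
  have k4 : Complex.cosh (2 * Real.pi * x) = (y + y⁻¹) / 2 := by
    rw [Complex.cosh, hy, ← Complex.exp_neg]
  rw [kacKernel, k1, k2, k3, k4, e3, e4, e1, e2, sub_neg_eq_add, sub_neg_eq_add, mul_div_assoc,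
    mul_div_assoc, ← mul_sub, kernel_partial_fractions (Complex.exp_ne_zero _)
    (Complex.exp_ne_zero _) (Complex.exp_ne_zero _) hσ2]
  · ring
  · intro h; apply h₁; rw [e1]; linear_combination -h
  · intro h; apply h₂; rw [e2]; linear_combination -h

/-- Poles lie at heights in (1/2N)ℤ, and only -1/2 itself belongs to [-1/2, `mordellLine N`]. A pole
there requires n to be an odd multiple of N. -/
theorem div_add_ne_int {N : ℕ} (hN : 0 < N) {n : ℤ} (h : ¬ (N : ℤ) ∣ n) (k : ℤ) (y : ℝ)
    (h₁ : -1 / 2 ≤ y) (h₂ : y ≤ mordellLine N) : (n : ℝ) / (2 * N) + y ≠ k := by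
  intro hk
  have hNr : (0 : ℝ) < N := by exact_mod_cast hN
  have hy : y = k - n / (2 * N) := by linarith
  have e1 : y * (2 * N) = 2 * N * k - n := by rw [hy]; field_simp
  have e2 : mordellLine N * (2 * N) = -N + 1 / 2 := by rw [mordellLine]; field_simp; ring
  have h3 : -(N : ℝ) ≤ 2 * N * k - n := by
    rw [← e1]; nlinarith
  have h4 : (2 * N * k - n : ℝ) ≤ -N + 1 / 2 := by
    rw [← e1, ← e2]; exact mul_le_mul_of_nonneg_right h₂ (by positivity)
  have h5 : (2 * N * k - n : ℝ) < ((-N + 1 : ℤ) : ℝ) := by push_cast; linarith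
  have h6 : -(N : ℤ) ≤ 2 * N * k - n := by exact_mod_cast h3
  have h7 : 2 * (N : ℤ) * k - n < -N + 1 := by exact_mod_cast h5
  have h8 : n = N * (2 * k + 1) := by linarith [show 2 * (N : ℤ) * k - n = -N by omega]
  exact h ⟨_, h8⟩

theorem not_dvd_grid (p p' : ℕ) (hcop : Nat.Coprime p p') {A B : ℤ} (h₁ : 1 ≤ B)
    (h₂ : B ≤ p' - 1) : ¬ (p' : ℤ) ∣ A * p' + B * p ∧ ¬ (p' : ℤ) ∣ A * p' - B * p := by
  have hc : IsCoprime (p' : ℤ) (p : ℤ) := (Nat.isCoprime_iff_coprime.2 hcop).symm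
  have h3 : ¬ (p' : ℤ) ∣ B * p := fun h => by
    have := Int.le_of_dvd (by omega) (hc.dvd_of_dvd_mul_right h)
    omega
  refine ⟨fun h => h3 ?_, fun h => h3 ?_⟩
  · exact (Int.dvd_add_right (Dvd.intro_left _ rfl)).1 h
  · exact (dvd_sub_right (Dvd.intro_left _ rfl)).1 h

/-- The Gaussian on the line `Im X = -1/2` appearing in the typical characters. -/
def lineGauss (p p' : ℕ) (β τ : ℂ) (x : ℝ) : ℂ :=
  expTwoPi (ratio p p' * (x - I / 2) ^ 2 * τ + I * β * (x - I / 2))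

theorem kacKernel_mul_lineGauss (p p' : ℕ) (hp : 0 < p) (hp' : 0 < p') (hcop : Nat.Coprime p p')
    (s : ℤ) {q : ℤ × ℤ} (hq : q ∈ kacSet p p') (β : ℂ) (τ : ℂ) (x : ℝ) :
    expTwoPi (s * ((q.1 * p' + q.2 * p : ℤ) : ℂ) / (2 * p')) *
        mordellFun (p' * (τ / p)) (((q.1 * p' + q.2 * p : ℤ) : ℝ) / (2 * p')) β
          (x + ((-1 / 2 : ℝ) : ℂ) * I) -
      expTwoPi (s * ((q.1 * p' - q.2 * p : ℤ) : ℂ) / (2 * p')) *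
        mordellFun (p' * (τ / p)) (((q.1 * p' - q.2 * p : ℤ) : ℝ) / (2 * p')) β
          (x + ((-1 / 2 : ℝ) : ℂ) * I) =
      I * (-1) ^ (q.1 * s) * (kacKernel p p' s q.1 q.2 x * lineGauss p p' β τ x) := by
  have h1 : (p : ℂ) ≠ 0 := by exact_mod_cast hp.ne'
  simp only [kacSet, Finset.mem_filter, Finset.mem_product, Finset.mem_Icc] at hq
  have hn := not_dvd_grid p p' hcop (A := q.1) hq.1.2.1 hq.1.2.2
  have hb := mordellLine_bounds hp'
  have hg : ∀ n : ℤ, ¬ (p' : ℤ) ∣ n →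
      expTwoPi (I * (x + ((-1 / 2 : ℝ) : ℂ) * I) - (((n : ℝ) / (2 * p') : ℝ) : ℂ)) ≠ 1 := by
    intro n hn h0
    obtain ⟨k, hk⟩ := mordellFun_pole h0
    refine div_add_ne_int hp' hn k (-1 / 2) le_rfl (by linarith) ?_
    rw [← hk]; simp
  have key := kacKernel_eq p p' hp hp' s q.1 q.2 x (hg _ hn.1) (hg _ hn.2)
  have hG : expTwoPi (p' * (τ / p) * (x + ((-1 / 2 : ℝ) : ℂ) * I) ^ 2 +
      I * β * (x + ((-1 / 2 : ℝ) : ℂ) * I)) = lineGauss p p' β τ x := by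
    rw [lineGauss, ratio]; congr 1; push_cast; field_simp; ring
  rw [mordellFun, mordellFun, hG, ← mul_assoc, ← key]
  ring

/-- The integrand is a linear combination of two Mordell integrands, each with Gaussian decay and no
pole on the line Im = -1/2. Absolute convergence in the theorem comes from here. -/
theorem integrable_kacKernel_mul (p p' : ℕ) (hp : 0 < p) (hp' : 0 < p') (hcop : Nat.Coprime p p')
    (s : ℤ) {q : ℤ × ℤ} (hq : q ∈ kacSet p p') (β : ℂ) {τ : ℂ} (hτ : 0 < τ.im) :
    Integrable fun x : ℝ => kacKernel p p' s q.1 q.2 x * lineGauss p p' β τ x := by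
  have hA : 0 < ((p' : ℂ) * (τ / p)).im := by
    rw [← mul_div_assoc, Complex.div_natCast_im]; exact div_pos (natCast_mul_im_pos hp' hτ) (by positivity)
  have hq' := hq
  simp only [kacSet, Finset.mem_filter, Finset.mem_product, Finset.mem_Icc] at hq'
  have hn := not_dvd_grid p p' hcop (A := q.1) hq'.1.2.1 hq'.1.2.2
  have hb := mordellLine_bounds hp'
  have hi : ∀ n : ℤ, ¬ (p' : ℤ) ∣ n → Integrable fun x : ℝ =>
      mordellFun (p' * (τ / p)) ((n : ℝ) / (2 * p')) β (x + ((-1 / 2 : ℝ) : ℂ) * I) :=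
    fun n hn => integrable_mordellFun hA (by norm_num [abs_le])
      (fun k => div_add_ne_int hp' hn k _ le_rfl (by linarith)) β
  have h := (((hi _ hn.1).const_mul (expTwoPi (s * ((q.1 * p' + q.2 * p : ℤ) : ℂ) / (2 * p')))).sub
    ((hi _ hn.2).const_mul (expTwoPi (s * ((q.1 * p' - q.2 * p : ℤ) : ℂ) / (2 * p'))))).const_mul
      ((I * (-1) ^ (q.1 * s))⁻¹)
  refine h.congr (Eventually.of_forall fun x => ?_)
  have hne : I * (-1) ^ (q.1 * s) ≠ 0 := mul_ne_zero Complex.I_ne_zero (zpow_ne_zero _ (by norm_num))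
  simp only [Pi.sub_apply]
  rw [kacKernel_mul_lineGauss p p' hp hp' hcop s hq β τ, inv_mul_cancel_left₀ hne]

/-- Since p' divides neither Ap' + Bp nor Ap' - Bp, both contours descend from `mordellLine p'` to
Im = -1/2 without crossing a pole, and there the integrands combine. -/
theorem mordell_grid_sub (p p' : ℕ) (hp : 0 < p) (hp' : 0 < p') (hcop : Nat.Coprime p p')
    (s : ℤ) {q : ℤ × ℤ} (hq : q ∈ kacSet p p') (β : ℂ) {τ : ℂ} (hτ : 0 < τ.im) :
    expTwoPi (s * ((q.1 * p' + q.2 * p : ℤ) : ℂ) / (2 * p')) *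
        mordell (p' * (τ / p)) (((q.1 * p' + q.2 * p : ℤ) : ℝ) / (2 * p')) (mordellLine p') β -
      expTwoPi (s * ((q.1 * p' - q.2 * p : ℤ) : ℂ) / (2 * p')) *
        mordell (p' * (τ / p)) (((q.1 * p' - q.2 * p : ℤ) : ℝ) / (2 * p')) (mordellLine p') β =
      I * (-1) ^ (q.1 * s) * ∫ x : ℝ, kacKernel p p' s q.1 q.2 x * lineGauss p p' β τ x := by
  have hA : 0 < ((p' : ℂ) * (τ / p)).im := by
    rw [← mul_div_assoc, Complex.div_natCast_im]; exact div_pos (natCast_mul_im_pos hp' hτ) (by positivity)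
  have hq' := hq
  simp only [kacSet, Finset.mem_filter, Finset.mem_product, Finset.mem_Icc] at hq'
  have hn := not_dvd_grid p p' hcop (A := q.1) hq'.1.2.1 hq'.1.2.2
  have hb := mordellLine_bounds hp'
  have hi : ∀ n : ℤ, ¬ (p' : ℤ) ∣ n → Integrable fun x : ℝ =>
      mordellFun (p' * (τ / p)) ((n : ℝ) / (2 * p')) β (x + ((-1 / 2 : ℝ) : ℂ) * I) :=
    fun n hn => integrable_mordellFun hA (by norm_num [abs_le])
      (fun k => div_add_ne_int hp' hn k _ le_rfl (by linarith)) β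
  have hsh : ∀ n : ℤ, ¬ (p' : ℤ) ∣ n →
      mordell (p' * (τ / p)) ((n : ℝ) / (2 * p')) (mordellLine p') β =
        mordell (p' * (τ / p)) ((n : ℝ) / (2 * p')) (-1 / 2) β :=
    fun n hn => (mordell_shift_of_no_pole hA (by linarith) (by norm_num) (by linarith)
      (fun k y h1 h2 => div_add_ne_int hp' hn k y h1 h2) β).symm
  rw [hsh _ hn.1, hsh _ hn.2, mordell, mordell, ← integral_const_mul, ← integral_const_mul,
    ← integral_const_mul, ← integral_sub ((hi _ hn.1).const_mul _) ((hi _ hn.2).const_mul _)]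
  exact integral_congr_ae (Eventually.of_forall fun x =>
    kacKernel_mul_lineGauss p p' hp hp' hcop s hq β τ x)

/-- The exponents of χ are n²τ/(4pp') along the classes of ±Ap' - Bp mod 2pp'; evenness of the theta
constants replaces -Ap' - Bp by Ap' + Bp. -/
theorem eta_mul_chi (p p' : ℕ) (hp : 0 < p) (hp' : 0 < p') (A B : ℤ) {τ : ℂ} (hτ : 0 < τ.im) :
    ModularForm.eta τ * chi p p' A B τ =
      thetaCoef (p * p') 0 τ (A * p' - B * p) - thetaCoef (p * p') 0 τ (A * p' + B * p) := by
  have h1 : (p : ℂ) ≠ 0 := by exact_mod_cast hp.ne'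
  have h2 : (p' : ℂ) ≠ 0 := by exact_mod_cast hp'.ne'
  have hpp : 0 < p * p' := Nat.mul_pos hp hp'
  have hne : ((p * p' : ℕ) : ℤ) ≠ 0 := by exact_mod_cast hpp.ne'
  have hinj : ∀ j : ℤ, Function.Injective fun k : ℤ => j + 2 * (p * p' : ℕ) * k := fun j k l h =>
    mul_left_cancel₀ (mul_ne_zero two_ne_zero hne) (add_left_cancel h)
  have hs := fun j => (summable_thetaCoef hpp 0 hτ).comp_injective (hinj j)
  have hneg : thetaCoef (p * p') 0 τ (A * p' + B * p) =
      thetaCoef (p * p') 0 τ (-A * p' - B * p) := by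
    rw [← thetaCoef_zero_neg]; congr 1; ring
  rw [hneg, chi, ← mul_assoc, mul_one_div_cancel (eta_ne_zero hτ), one_mul]
  refine Eq.trans (tsum_congr fun n => ?_)
    (Summable.tsum_sub (hs (A * p' - B * p)) (hs (-A * p' - B * p)))
  congr 2
  · push_cast; field_simp; ring
  · push_cast; field_simp; ring

/-! ### Inversion of the renormalized Ψ. -/

/-- The modular inversion formula for the renormalized `Psi`. -/
theorem psiBlock_inversion (p p' : ℕ) (hp : 0 < p) (hp' : 0 < p') (hcop : Nat.Coprime p p')
    (r s θ : ℤ) {τ : ℂ} (hτ : 0 < τ.im) (z : ℂ) : ∀ᶠ v in 𝓝[≠] z,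
    1 / τ * expTwoPi (ratio p p' * v ^ 2 / τ) * psiBlock p p' r s θ (v / τ) (-1 / τ) =
      1 / p * (-∑ l ∈ discreteSpectra p p', sinCoef p p' r l.1 *
          expTwoPi (ratio p p' * (r - 2 * θ) * (l.1 - 2 * l.2.2) / 2) *
            psiBlock p p' l.1 l.2.1 l.2.2 v τ +
        ∑ q ∈ kacSet p p', (-1) ^ (q.1 * s + r * q.2) * sinCoef p p' r q.1 *
          (ModularForm.eta τ * chi p p' q.1 q.2 τ) *
          ∫ x : ℝ, kacKernel p p' s q.1 q.2 x *
            lineGauss p p' (2 * ratio p p' * v + kap p p' (r - 2 * θ) s) τ x) := by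
  have h1 : (p : ℂ) ≠ 0 := by exact_mod_cast hp.ne'
  have h2 : (p' : ℂ) ≠ 0 := by exact_mod_cast hp'.ne'
  have k1 : kap p p' (r - 2 * θ) s + 2 * (p' / p) * θ = kap p p' r s := by
    simp only [kap]; push_cast; ring
  have k2 : kap p p' (r - 2 * θ) s + 2 * (p' / p) * ((θ - r : ℤ) : ℝ) = kap p p' (-r) s := by
    simp only [kap]; push_cast; ring
  filter_upwards [appellBlock_inversion p p' hp hp' (kap p p' (r - 2 * θ) s) θ hτ z,
    appellBlock_inversion p p' hp hp' (kap p p' (r - 2 * θ) s) (θ - r) hτ z,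
    eventually_lattice_ne hτ z] with v hv1 hv2 hv
  rw [k1] at hv1
  rw [k2] at hv2
  have hd := sum_discreteSpectra_psiBlock p p' hp hp' hcop r s θ v hτ hv
  have hm := mordellSum_sub p p' hp hp' hcop r s ((v - θ) / p) ((v - ((θ - r : ℤ) : ℂ)) / p)
    (2 * ratio p p' * v + kap p p' (r - 2 * θ) s)
    (by simp only [kap, ratio]; push_cast; field_simp; ring)
    (by simp only [kap, ratio]; push_cast; field_simp; ring) hτ _ _ rfl rfl
  rw [psiBlock, mul_sub, hv1, hv2, ← mul_sub, ← hd]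
  congr 1
  have hK : ∑ q ∈ kacSet p p', (-1) ^ (q.1 * s + r * q.2) * sinCoef p p' r q.1 *
          (ModularForm.eta τ * chi p p' q.1 q.2 τ) *
          ∫ x : ℝ, kacKernel p p' s q.1 q.2 x *
            lineGauss p p' (2 * ratio p p' * v + kap p p' (r - 2 * θ) s) τ x =
      -I * (mordellSum p' (kap p p' r s) ((v - θ) / p) (τ / p) -
        mordellSum p' (kap p p' (-r) s) ((v - ((θ - r : ℤ) : ℂ)) / p) (τ / p)) := by
    rw [hm, neg_mul_neg, Finset.mul_sum]
    refine Finset.sum_congr rfl fun q hq => ?_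
    rw [mordell_grid_sub p p' hp hp' hcop s hq _ hτ, eta_mul_chi p p' hp hp' _ _ hτ,
      zpow_add₀ (by norm_num)]
    linear_combination ((-1) ^ (r * q.2) * sinCoef p p' r q.1 * (-1) ^ (q.1 * s) *
      (∫ x : ℝ, kacKernel p p' s q.1 q.2 x *
        lineGauss p p' (2 * ratio p p' * v + kap p p' (r - 2 * θ) s) τ x) *
      (thetaCoef (p * p') 0 τ (q.1 * p' - q.2 * p) -
        thetaCoef (p * p') 0 τ (q.1 * p' + q.2 * p))) * Complex.I_sq
  rw [hK]
  push_cast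
  ring

/-! ### Characters as theta function times block. -/

theorem appellBlock_add_one (p p' : ℕ) (μ : ℝ) (θ : ℤ) (v τ : ℂ) :
    appellBlock p p' μ θ (v + 1) τ = expTwoPi μ * appellBlock p p' μ θ v τ := by
  rw [appellBlock, appellBlock, show v + 1 + θ * τ = v + θ * τ + 1 by ring, appell_add_one,
    ← mul_assoc, ← mul_assoc, ← expTwoPi_add, ← expTwoPi_add]
  congr 2
  rw [ratio]; push_cast; ring

theorem psiBlock_add_one (p p' : ℕ) (r s θ : ℤ) (v τ : ℂ) :
    psiBlock p p' r s θ (v + 1) τ =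
      expTwoPi (kap p p' (r - 2 * θ) s) * psiBlock p p' r s θ v τ := by
  rw [psiBlock, psiBlock, appellBlock_add_one, appellBlock_add_one, mul_sub]

theorem removableAt_thetaEta_mul_appellBlock (p p' : ℕ) (hp : 0 < p) (hp' : 0 < p') (μ : ℝ) (θ : ℤ)
    {τ : ℂ} (hτ : 0 < τ.im) (z : ℂ) :
    RemovableAt (fun v => thetaEta v τ * appellBlock p p' μ θ v τ) z := by
  have hd := differentiable_thetaEta hτ
  have h := removableAt_mul_appell hp' ((μ + 2 * (p' / p) * θ : ℝ) : ℂ) 0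
    (natCast_mul_im_pos hp hτ) (F := fun w => thetaEta (w - θ * τ) τ) (hd.comp (by fun_prop))
    (fun V x hV => thetaEta_eq_zero hτ (x * p + θ) (by rw [← hV]; congr 1; push_cast; ring))
    (z + θ * τ)
  have h2 : Differentiable ℂ fun v =>
      expTwoPi (-2 * ratio p p' * θ * v - ratio p p' * θ ^ 2 * τ) := by fun_prop
  refine ((h2.removableAt z).mul h.comp_add).congr (Eventually.of_forall fun v => ?_)
  simp only [appellBlock, add_sub_cancel_right]
  ring

theorem removableAt_thetaEta_mul_psiBlock (p p' : ℕ) (hp : 0 < p) (hp' : 0 < p') (r s θ : ℤ)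
    {τ : ℂ} (hτ : 0 < τ.im) (z : ℂ) :
    RemovableAt (fun v => thetaEta v τ * psiBlock p p' r s θ v τ) z := by
  have h := removableAt_thetaEta_mul_appellBlock p p' hp hp' (kap p p' (r - 2 * θ) s)
  have h2 : Differentiable ℂ fun _ : ℂ => (-1 : ℂ) := differentiable_const _
  refine ((h θ hτ z).add ((h2.removableAt z).mul (h (θ - r) hτ z))).congr
    (Eventually.of_forall fun v => ?_)
  simp only [psiBlock]
  ring

/-- All four theta functions are half-period translates of ϑ₁₁. Including (-1)^{εε'} lets a single
phase cover the four cases. -/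
theorem theta_eq_thetaEta (ε ε' : ℤ) (hε : ε = 0 ∨ ε = 1) (hε' : ε' = 0 ∨ ε' = 1) (u : ℂ) {τ : ℂ}
    (hτ : 0 < τ.im) :
    (-1) ^ (ε * ε') * theta ε ε' u τ = -ModularForm.eta τ ^ 3 *
      (expTwoPi ((1 - ε') / 4 + (1 - ε) * (u / 2 + τ / 8)) *
        thetaEta (u + (1 - ε) / 2 * τ + (1 - ε') / 2) τ) := by
  rcases hε with rfl | rfl
  · rw [theta_zero_left ε' hε' u hτ]
    have e1 : u + (1 - ((0 : ℤ) : ℂ)) / 2 * τ + (1 - ε') / 2 = u + τ / 2 + (1 - ε') / 2 := by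
      push_cast; ring
    have e2 : (1 - (ε' : ℂ)) / 4 + (1 - ((0 : ℤ) : ℂ)) * (u / 2 + τ / 8) =
        u / 2 + τ / 8 + (1 - ε') / 4 := by push_cast; ring
    rw [e1, e2, zero_mul, zpow_zero]; ring
  · rw [theta_one_left ε' hε' u hτ]
    have e1 : u + (1 - ((1 : ℤ) : ℂ)) / 2 * τ + (1 - ε') / 2 = u + (1 - ε') / 2 := by
      push_cast; ring
    rw [e1]
    rcases hε' with rfl | rfl
    · have e3 : (1 - ((0 : ℤ) : ℂ)) / 4 + (1 - ((1 : ℤ) : ℂ)) * (u / 2 + τ / 8) =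
          1 / 2 + -(1 - ((0 : ℤ) : ℂ)) / 4 := by push_cast; ring
      rw [e3, expTwoPi_add, expTwoPi_half]; simp
    · simp [expTwoPi_zero]

/-- The atypical expression in terms of `ϑ₁₁ / η³` and the renormalized `Psi`. -/
theorem atypicalExpr_eq (p p' : ℕ) (hp : 0 < p) (hp' : 0 < p') (ε ε' : ℤ) (hε : ε = 0 ∨ ε = 1)
    (hε' : ε' = 0 ∨ ε' = 1) (r s θ : ℤ) {τ : ℂ} (u t : ℂ) (hτ : 0 < τ.im) :
    atypicalExpr p p' ε ε' r s θ τ u t =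
      -expTwoPi ((1 - ε') / 4 + (1 - 2 * ratio p p') * ((1 - ε) * (u / 2 + τ / 8) + 3 * t) -
        kap p p' (r - 2 * θ) s * (1 - ε') / 2) *
      (thetaEta (u + (1 - ε) / 2 * τ + (1 - ε') / 2) τ *
        psiBlock p p' r s θ (u + (1 - ε) / 2 * τ + (1 - ε') / 2) τ) := by
  have h1 : (p : ℂ) ≠ 0 := by exact_mod_cast hp.ne'
  have h2 : (p' : ℂ) ≠ 0 := by exact_mod_cast hp'.ne'
  have hη := eta_ne_zero hτ
  -- As ε is 0 or 1, 1 - ε is idempotent; this is what lets the quadratic exponents match.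
  have hδ : (1 - ε : ℂ) ^ 2 = 1 - ε := by rcases hε with rfl | rfl <;> simp
  set y := u + (1 - ε) / 2 * τ + (1 - ε') / 2 with hy
  have hμ : (kap p p' (r - 2 * θ) s : ℂ) = 2 * ratio p p' * (lam p p' r s - θ + 1 / 2) := by
    simp only [kap, lam, ratio]; push_cast; field_simp; ring
  have ha : ratio p p' ≠ 0 := div_ne_zero h2 h1
  set μ : ℂ := ((kap p p' (r - 2 * θ) s : ℝ) : ℂ) with hμ'
  set a := ratio p p' with ha'
  have hl : lam p p' r s - θ = μ / (2 * a) - 1 / 2 := by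
    rw [hμ]; field_simp; ring
  rw [psiBlock_eq p p' hp hp' r s θ y hτ, atypicalExpr, hl, ← hμ']
  have hth := theta_eq_thetaEta ε ε' hε hε' u hτ
  rw [← hy] at hth
  have e1 : -expTwoPi ((1 - ε') / 4 + (1 - 2 * a) * ((1 - ε) * (u / 2 + τ / 8) + 3 * t) -
        μ * (1 - ε') / 2) * (thetaEta y τ * (expTwoPi (μ * y - μ ^ 2 / (4 * a) * τ) *
          Psi p p' r s (y + θ * τ) τ)) =
      expTwoPi (-a * (μ / (2 * a) - 1 / 2 + ε / 2) ^ 2 * τ) *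
      expTwoPi (2 * a * (μ / (2 * a) - 1 / 2 + ε / 2) * u) * expTwoPi (3 * (1 - 2 * a) * t) *
      (-expTwoPi ((1 - ε') / 4 + (1 - ε) * (u / 2 + τ / 8)) * thetaEta y τ) *
        Psi p p' r s (y + θ * τ) τ := by
    have : expTwoPi ((1 - ε') / 4 + (1 - 2 * a) * ((1 - ε) * (u / 2 + τ / 8) + 3 * t) -
        μ * (1 - ε') / 2) * expTwoPi (μ * y - μ ^ 2 / (4 * a) * τ) =
      expTwoPi (-a * (μ / (2 * a) - 1 / 2 + ε / 2) ^ 2 * τ) *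
      expTwoPi (2 * a * (μ / (2 * a) - 1 / 2 + ε / 2) * u) * expTwoPi (3 * (1 - 2 * a) * t) *
      expTwoPi ((1 - ε') / 4 + (1 - ε) * (u / 2 + τ / 8)) := by
      simp only [← expTwoPi_add]
      congr 1
      rw [hy]
      field_simp
      linear_combination (32 * a ^ 2 * τ : ℂ) * hδ
    linear_combination (-thetaEta y τ * Psi p p' r s (y + θ * τ) τ) * this
  rw [e1]
  have e2 : (-1) ^ (ε * ε') * (theta ε ε' u τ / ModularForm.eta τ ^ 3) =
      -expTwoPi ((1 - ε') / 4 + (1 - ε) * (u / 2 + τ / 8)) * thetaEta y τ := by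
    rw [← mul_div_assoc, hth]; field_simp
  rw [← e2]
  ring

theorem typicalChar_eq (p p' : ℕ) (ε ε' : ℤ) (hε : ε = 0 ∨ ε = 1)
    (hε' : ε' = 0 ∨ ε' = 1) (r s : ℤ) (x : ℂ) {τ : ℂ} (u t : ℂ) (hτ : 0 < τ.im) :
    typicalChar p p' ε ε' r s x τ u t =
      -expTwoPi ((1 - ε') / 4 + (1 - ε) * (u / 2 + τ / 8) + 3 * (1 - 2 * ratio p p') * t +
        ratio p p' * (x - I * ε / 2) ^ 2 * τ + 2 * I * ratio p p' * (x - I * ε / 2) * u) *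
      thetaEta (u + (1 - ε) / 2 * τ + (1 - ε') / 2) τ *
        (ModularForm.eta τ * chi p p' r s τ) := by
  have hη := eta_ne_zero hτ
  have hth := theta_eq_thetaEta ε ε' hε hε' u hτ
  have e2 : (-1) ^ (ε * ε') * (theta ε ε' u τ / ModularForm.eta τ ^ 2) = -ModularForm.eta τ *
      (expTwoPi ((1 - ε') / 4 + (1 - ε) * (u / 2 + τ / 8)) *
        thetaEta (u + (1 - ε) / 2 * τ + (1 - ε') / 2) τ) := by
    rw [← mul_div_assoc, hth]; field_simp
  simp only [expTwoPi_add ((1 - ε') / 4 + (1 - ε) * (u / 2 + τ / 8) + 3 * (1 - 2 * ratio p p') * t +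
    ratio p p' * (x - I * ε / 2) ^ 2 * τ), expTwoPi_add ((1 - ε') / 4 + (1 - ε) * (u / 2 + τ / 8) +
    3 * (1 - 2 * ratio p p') * t), expTwoPi_add ((1 - ε') / 4 + (1 - ε) * (u / 2 + τ / 8)) (3 * _ * t)]
  rw [typicalChar]
  linear_combination (expTwoPi (ratio p p' * (x - I * ε / 2) ^ 2 * τ) *
    expTwoPi (2 * I * ratio p p' * (x - I * ε / 2) * u) *
    expTwoPi (3 * (1 - 2 * ratio p p') * t) * chi p p' r s τ) * e2

theorem removableAt_atypicalExpr (p p' : ℕ) (hp : 0 < p) (hp' : 0 < p') (ε ε' : ℤ)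
    (hε : ε = 0 ∨ ε = 1) (hε' : ε' = 0 ∨ ε' = 1) (r s θ : ℤ) {τ : ℂ} (u t : ℂ) (hτ : 0 < τ.im) :
    RemovableAt (fun v => atypicalExpr p p' ε ε' r s θ τ v t) u := by
  have h := (removableAt_thetaEta_mul_psiBlock p p' hp hp' r s θ hτ
    (u + ((1 - ε) / 2 * τ + (1 - ε') / 2))).comp_add
  have h2 : Differentiable ℂ fun v => -expTwoPi ((1 - ε') / 4 +
      (1 - 2 * ratio p p') * ((1 - ε) * (v / 2 + τ / 8) + 3 * t) -
        kap p p' (r - 2 * θ) s * (1 - ε') / 2) := by fun_prop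
  refine ((h2.removableAt u).mul h).congr (Eventually.of_forall fun v => ?_)
  simp only []
  rw [atypicalExpr_eq p p' hp hp' ε ε' hε hε' r s θ v t hτ, ← add_assoc]

theorem tendsto_atypicalExpr (p p' : ℕ) (hp : 0 < p) (hp' : 0 < p') (ε ε' : ℤ)
    (hε : ε = 0 ∨ ε = 1) (hε' : ε' = 0 ∨ ε' = 1) (r s θ : ℤ) {τ : ℂ} (u t : ℂ) (hτ : 0 < τ.im) :
    Tendsto (fun v => atypicalExpr p p' ε ε' r s θ τ v t) (𝓝[≠] u)
      (𝓝 (atypicalChar p p' ε ε' r s θ τ u t)) :=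
  (removableAt_atypicalExpr p p' hp hp' ε ε' hε hε' r s θ u t hτ).tendsto_limUnder

/-! ### The S-transformation. -/

theorem inversion_phase (ε ε' : ℤ) (hε : ε = 0 ∨ ε = 1) (hε' : ε' = 0 ∨ ε' = 1) :
    -I ^ (-(ε * ε')) * expTwoPi ((1 - ε) / 4) =
      (-1) ^ (1 - ε) * I * expTwoPi ((1 - ε') / 4 - (1 - ε) * (1 - ε') / 4) := by
  rcases hε with rfl | rfl <;> rcases hε' with rfl | rfl <;>
    simp [expTwoPi_quarter, expTwoPi_zero, -one_div]

/-- Inversion naturally produces the argument v + (1-ε')τ/2 - (1-ε)/2, whereas the characters of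
type (ε', ε) use +(1-ε)/2. The integer discrepancy 1 - ε is corrected here for the theta factor and
in `psiBlock_sub` for the block. -/
theorem thetaEta_sub (ε : ℤ) (hε : ε = 0 ∨ ε = 1) (y : ℂ) {τ : ℂ} (hτ : 0 < τ.im) :
    thetaEta (y - (1 - ε)) τ = (-1) ^ (1 - ε) * thetaEta y τ := by
  rcases hε with rfl | rfl
  · have := thetaEta_add_one (y - 1) hτ
    rw [sub_add_cancel] at this
    simp [this]
  · simp

theorem psiBlock_sub (p p' : ℕ) (r s θ ε : ℤ) (hε : ε = 0 ∨ ε = 1) (y τ : ℂ) :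
    psiBlock p p' r s θ y τ =
      expTwoPi (kap p p' (r - 2 * θ) s * (1 - ε)) * psiBlock p p' r s θ (y - (1 - ε)) τ := by
  rcases hε with rfl | rfl
  · have := psiBlock_add_one p p' r s θ (y - 1) τ
    rw [sub_add_cancel] at this
    simp [this]
  · simp [expTwoPi_zero]

/-- The common prefactor of all terms in the inversion formula. -/
def inversionFactor (p p' : ℕ) (ε ε' : ℤ) (μ : ℝ) (τ t v : ℂ) : ℂ :=
  -(-1) ^ (1 - ε) * expTwoPi ((1 - ε') / 4 - μ * (1 - ε') / 2 -
    (1 - 2 * ratio p p') * ((1 - ε) * (1 - ε')) / 4 +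
    (1 - 2 * ratio p p') * ((1 - ε') * (v / 2 + τ / 8) + 3 * t)) *
    thetaEta (v + (1 - ε') / 2 * τ + (1 - ε) / 2) τ

/-- The third argument is frozen at u while v varies, because the value at u is a limit v → u with t
- u²/(6τ) fixed. The resulting factor in v² - u² tends to 1. -/
theorem atypicalExpr_inversion (p p' : ℕ) (hp : 0 < p) (hp' : 0 < p') (ε ε' : ℤ)
    (hε : ε = 0 ∨ ε = 1) (hε' : ε' = 0 ∨ ε' = 1) (r s θ : ℤ) {τ : ℂ} (u v t : ℂ) (hτ : 0 < τ.im) :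
    atypicalExpr p p' ε ε' r s θ (-1 / τ) (v / τ) (t - u ^ 2 / (6 * τ)) =
      expTwoPi ((1 - 2 * ratio p p') * (v ^ 2 - u ^ 2) / (2 * τ)) *
      (inversionFactor p p' ε ε' (kap p p' (r - 2 * θ) s) τ t v *
        (1 / τ * expTwoPi (ratio p p' * (v + (1 - ε') / 2 * τ - (1 - ε) / 2) ^ 2 / τ) *
          psiBlock p p' r s θ ((v + (1 - ε') / 2 * τ - (1 - ε) / 2) / τ) (-1 / τ))) := by
  have hτ0 : τ ≠ 0 := by rintro rfl; simp at hτ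
  have hδ : (1 - ε : ℂ) ^ 2 = 1 - ε := by rcases hε with rfl | rfl <;> simp
  have hδ' : (1 - ε' : ℂ) ^ 2 = 1 - ε' := by rcases hε' with rfl | rfl <;> simp
  set Y := v + (1 - ε') / 2 * τ - (1 - ε) / 2 with hY
  have eY : v / τ + (1 - ε) / 2 * (-1 / τ) + (1 - ε') / 2 = Y / τ := by
    rw [hY]; field_simp; ring
  have eY' : v + (1 - ε') / 2 * τ + (1 - ε) / 2 - (1 - ε) = Y := by rw [hY]; ring
  have hsub := thetaEta_sub ε hε (v + (1 - ε') / 2 * τ + (1 - ε) / 2) hτ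
  rw [eY'] at hsub
  rw [atypicalExpr_eq p p' hp hp' ε ε' hε hε' r s θ _ _ (im_neg_one_div_pos hτ), eY,
    thetaEta_inversion Y hτ, hsub, inversionFactor]
  set μ : ℂ := ((kap p p' (r - 2 * θ) s : ℝ) : ℂ)
  set a := ratio p p'
  have key : expTwoPi ((1 - ε') / 4 + (1 - 2 * a) *
        ((1 - ε) * (v / τ / 2 + -1 / τ / 8) + 3 * (t - u ^ 2 / (6 * τ))) - μ * (1 - ε') / 2) *
        expTwoPi (Y ^ 2 / (2 * τ)) =
      expTwoPi ((1 - 2 * a) * (v ^ 2 - u ^ 2) / (2 * τ)) *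
        expTwoPi ((1 - ε') / 4 - μ * (1 - ε') / 2 - (1 - 2 * a) * ((1 - ε) * (1 - ε')) / 4 +
    (1 - 2 * a) * ((1 - ε') * (v / 2 + τ / 8) + 3 * t)) * expTwoPi (a * Y ^ 2 / τ) := by
    simp only [← expTwoPi_add]
    congr 1
    rw [hY]
    field_simp
    linear_combination (192 * (1 - 2 * a)) * hδ + (192 * (1 - 2 * a) * τ ^ 2) * hδ'
  linear_combination (-(-1) ^ (1 - ε) * (1 / τ) * thetaEta (v + (1 - ε') / 2 * τ + (1 - ε) / 2) τ *
    psiBlock p p' r s θ (Y / τ) (-1 / τ)) * key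

/-- Extracting the prefactor common to all terms reduces each discrete term to the corresponding one
of `psiBlock_inversion`. -/
theorem sAA_mul_atypicalExpr (p p' : ℕ) (hp : 0 < p) (hp' : 0 < p') (ε ε' : ℤ)
    (hε : ε = 0 ∨ ε = 1) (hε' : ε' = 0 ∨ ε' = 1) (r s θ r' s' θ' : ℤ) {τ : ℂ} (v t : ℂ)
    (hτ : 0 < τ.im) :
    sAA p p' ε ε' r s θ r' s' θ' * atypicalExpr p p' ε' ε r' s' θ' τ v t =
      inversionFactor p p' ε ε' (kap p p' (r - 2 * θ) s) τ t v * (1 / p * -(sinCoef p p' r r' *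
        expTwoPi (ratio p p' * (r - 2 * θ) * (r' - 2 * θ') / 2) *
        psiBlock p p' r' s' θ' (v + (1 - ε') / 2 * τ - (1 - ε) / 2) τ)) := by
  have h1 : (p : ℂ) ≠ 0 := by exact_mod_cast hp.ne'
  set Y := v + (1 - ε') / 2 * τ - (1 - ε) / 2 with hY
  have eY' : v + (1 - ε') / 2 * τ + (1 - ε) / 2 - (1 - ε) = Y := by rw [hY]; ring
  rw [atypicalExpr_eq p p' hp hp' ε' ε hε' hε r' s' θ' _ _ hτ, psiBlock_sub p p' r' s' θ' ε hε, eY',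
    inversionFactor, sAA, sinCoef_eq_sin]
  have hc : cexp (Real.pi * I * ratio p p' * (r - 2 * θ - 1 + ε) * (r' - 2 * θ' - 1 + ε')) =
      expTwoPi (ratio p p' * (r - 2 * θ - (1 - ε)) * (r' - 2 * θ' - (1 - ε')) / 2) := by
    rw [expTwoPi]; congr 1; ring
  have hs : ((-1 : ℂ)) ^ ((1 - ε') * s + (1 - ε) * s') =
      expTwoPi (((1 - ε') * s + (1 - ε) * s') / 2) := by
    rw [← expTwoPi_half_int]; congr 1; push_cast; ring
  rw [hc, hs]
  have ph := inversion_phase ε ε' hε hε'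
  have hk1 : ((kap p p' (r - 2 * θ) s : ℝ) : ℂ) = ratio p p' * (r - 2 * θ) - s := by
    rw [kap, ratio]; push_cast; ring
  have hk2 : ((kap p p' (r' - 2 * θ') s' : ℝ) : ℂ) = ratio p p' * (r' - 2 * θ') - s' := by
    rw [kap, ratio]; push_cast; ring
  rw [hk1, hk2]
  set a := ratio p p'
  set G := (1 - 2 * a) * ((1 - ε') * (v / 2 + τ / 8) + 3 * t) with hG
  have k1 : expTwoPi (((1 - ε') * s + (1 - ε) * s') / 2) *
      expTwoPi (a * (r - 2 * θ - (1 - ε)) * (r' - 2 * θ' - (1 - ε')) / 2) *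
      (expTwoPi ((1 - ε) / 4 + G - (a * (r' - 2 * θ') - s') * (1 - ε) / 2) *
        expTwoPi ((a * (r' - 2 * θ') - s') * (1 - ε))) =
      expTwoPi ((1 - ε) / 4) * expTwoPi (G + a * (r - 2 * θ) * (r' - 2 * θ') / 2 -
        (a * (r - 2 * θ) - s) * (1 - ε') / 2 + a * ((1 - ε) * (1 - ε')) / 2) := by
    simp only [← expTwoPi_add]
    congr 1
    ring
  have k2 : expTwoPi ((1 - ε') / 4 - (a * (r - 2 * θ) - s) * (1 - ε') / 2 -
      (1 - 2 * a) * ((1 - ε) * (1 - ε')) / 4 + G) *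
      expTwoPi (a * (r - 2 * θ) * (r' - 2 * θ') / 2) =
      expTwoPi ((1 - ε') / 4 - (1 - ε) * (1 - ε') / 4) *
      expTwoPi (G + a * (r - 2 * θ) * (r' - 2 * θ') / 2 -
        (a * (r - 2 * θ) - s) * (1 - ε') / 2 + a * ((1 - ε) * (1 - ε')) / 2) := by
    simp only [← expTwoPi_add]
    congr 1
    ring
  set S := Complex.sin (Real.pi * a * r * r')
  set Q := thetaEta (v + (1 - ε') / 2 * τ + (1 - ε) / 2) τ * psiBlock p p' r' s' θ' Y τ with hQ
  set E := expTwoPi (G + a * (r - 2 * θ) * (r' - 2 * θ') / 2 -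
        (a * (r - 2 * θ) - s) * (1 - ε') / 2 + a * ((1 - ε) * (1 - ε')) / 2)
  linear_combination (-I ^ (-(ε * ε')) * (2 / p) * S * Q) * k1 + ((2 / p) * S * Q * E) * ph -
    ((-1) ^ (1 - ε) * (2 / p) * I * S * Q) * k2

/-- For ε' = 0 the Gaussian of the typical function sits on the real line. Completing the square
with the shift (1-ε')τ/2 of v moves it to Im = -1/2, so both values of ε' lead to the same
`lineGauss`. -/
theorem sAT_mul_typicalChar (p p' : ℕ) (hp : 0 < p) (hp' : 0 < p') (ε ε' : ℤ)
    (hε : ε = 0 ∨ ε = 1) (hε' : ε' = 0 ∨ ε' = 1) (r s θ r' s' : ℤ) {τ : ℂ} (v t : ℂ)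
    (hτ : 0 < τ.im) (x : ℝ) :
    sAT p p' ε ε' r s θ r' s' x * typicalChar p p' ε' ε r' s' x τ v t =
      inversionFactor p p' ε ε' (kap p p' (r - 2 * θ) s) τ t v * (1 / p *
        ((-1) ^ (r' * s + r * s') * sinCoef p p' r r' * (ModularForm.eta τ * chi p p' r' s' τ))) *
        (kacKernel p p' s r' s' x * lineGauss p p' (2 * ratio p p' *
          (v + (1 - ε') / 2 * τ - (1 - ε) / 2) + kap p p' (r - 2 * θ) s) τ x) := by
  have h1 : (p : ℂ) ≠ 0 := by exact_mod_cast hp.ne'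
  have h2 : (p' : ℂ) ≠ 0 := by exact_mod_cast hp'.ne'
  have hδ' : (1 - ε' : ℂ) ^ 2 = 1 - ε' := by rcases hε' with rfl | rfl <;> simp
  rw [typicalChar_eq p p' ε' ε hε' hε r' s' x v t hτ, inversionFactor, sinCoef_eq_sin, lineGauss]
  have hμ : (kap p p' (r - 2 * θ) s : ℂ) = 2 * ratio p p' * (lam p p' r s - θ + 1 / 2) := by
    simp only [kap, lam, ratio]; push_cast; field_simp; ring
  have hc : cexp (-4 * Real.pi * ratio p p' * (lam p p' r s - θ + ε / 2) * (x - I * ε' / 2)) =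
      expTwoPi (I * (kap p p' (r - 2 * θ) s - ratio p p' * (1 - ε)) * (x - I * ε' / 2)) := by
    rw [hμ, expTwoPi]; congr 1
    linear_combination (-(4 * Real.pi * ratio p p' * (lam p p' r s - θ + ε / 2) *
      (x - I * ε' / 2)) : ℂ) * Complex.I_sq
  have hker : sAT p p' ε ε' r s θ r' s' x = -(I ^ (-(ε * ε')) * (-1) ^ (r' * s + r * s') *
      (2 / (p : ℂ)) * Complex.sin (Real.pi * ratio p p' * r * r') * kacKernel p p' s r' s' x *
      expTwoPi (I * (kap p p' (r - 2 * θ) s - ratio p p' * (1 - ε)) * (x - I * ε' / 2))) := by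
    rw [sAT, hc, kacKernel]
  rw [hker]
  have ph := inversion_phase ε ε' hε hε'
  set μ : ℂ := ((kap p p' (r - 2 * θ) s : ℝ) : ℂ)
  set a := ratio p p'
  set E := expTwoPi ((1 - ε') * (v / 2 + τ / 8) + 3 * (1 - 2 * a) * t +
    a * (x - I * ε' / 2) ^ 2 * τ + 2 * I * a * (x - I * ε' / 2) * v +
    I * (μ - a * (1 - ε)) * (x - I * ε' / 2)) with hE
  have k1 : expTwoPi (I * (μ - a * (1 - ε)) * (x - I * ε' / 2)) *
      expTwoPi ((1 - ε) / 4 + (1 - ε') * (v / 2 + τ / 8) + 3 * (1 - 2 * a) * t +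
        a * (x - I * ε' / 2) ^ 2 * τ + 2 * I * a * (x - I * ε' / 2) * v) =
      expTwoPi ((1 - ε) / 4) * E := by
    rw [hE]
    simp only [← expTwoPi_add]
    congr 1
    ring
  have k2 : expTwoPi ((1 - ε') / 4 - μ * (1 - ε') / 2 - (1 - 2 * a) * ((1 - ε) * (1 - ε')) / 4 +
      (1 - 2 * a) * ((1 - ε') * (v / 2 + τ / 8) + 3 * t)) *
      expTwoPi (a * (x - I / 2) ^ 2 * τ + I * (2 * a * (v + (1 - ε') / 2 * τ - (1 - ε) / 2) + μ) *
        (x - I / 2)) = expTwoPi ((1 - ε') / 4 - (1 - ε) * (1 - ε') / 4) * E := by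
    rw [hE]
    simp only [← expTwoPi_add]
    congr 1
    have hI := Complex.I_sq
    linear_combination (a * τ / 4) * hδ' + (ε' * μ / 2 + ε' * a * ε / 2 + ε' * a * v +
      ε' * a * τ / 2 - ε' * a / 2 - ε' ^ 2 * a * τ / 4 - μ / 2 - a * ε / 2 - a * v - a * τ / 4 +
      a / 2) * hI
  set S := Complex.sin (Real.pi * a * r * r')
  set Q := (-1) ^ (r' * s + r * s') * (2 / (p : ℂ)) * S * kacKernel p p' s r' s' x *
    thetaEta (v + (1 - ε') / 2 * τ + (1 - ε) / 2) τ * (ModularForm.eta τ * chi p p' r' s' τ) with hQ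
  linear_combination (I ^ (-(ε * ε')) * Q) * k1 - (Q * E) * ph +
    ((-1) ^ (1 - ε) * I * Q) * k2

/-- Continuity in β is inherited from the holomorphic Mordell integrals; it is needed to let v → u
in the continuous part. -/
theorem continuous_integral_kacKernel (p p' : ℕ) (hp : 0 < p) (hp' : 0 < p')
    (hcop : Nat.Coprime p p') (s : ℤ) {q : ℤ × ℤ} (hq : q ∈ kacSet p p') {τ : ℂ} (hτ : 0 < τ.im) :
    Continuous fun β : ℂ => ∫ x : ℝ, kacKernel p p' s q.1 q.2 x * lineGauss p p' β τ x := by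
  have hA : 0 < ((p' : ℂ) * (τ / p)).im := by
    rw [← mul_div_assoc, Complex.div_natCast_im]
    exact div_pos (natCast_mul_im_pos hp' hτ) (by positivity)
  have hne : I * (-1 : ℂ) ^ (q.1 * s) ≠ 0 :=
    mul_ne_zero Complex.I_ne_zero (zpow_ne_zero _ (by norm_num))
  have h := fun n : ℤ =>
    (differentiable_mordell hA (abs_mordellLine_le hp') (mordellLine_ne hp' n)).continuous
  have e : (fun β : ℂ => ∫ x : ℝ, kacKernel p p' s q.1 q.2 x * lineGauss p p' β τ x) = fun β =>
      (I * (-1 : ℂ) ^ (q.1 * s))⁻¹ * (expTwoPi (s * ((q.1 * p' + q.2 * p : ℤ) : ℂ) / (2 * p')) *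
        mordell (p' * (τ / p)) (((q.1 * p' + q.2 * p : ℤ) : ℝ) / (2 * p')) (mordellLine p') β -
      expTwoPi (s * ((q.1 * p' - q.2 * p : ℤ) : ℂ) / (2 * p')) *
        mordell (p' * (τ / p)) (((q.1 * p' - q.2 * p : ℤ) : ℝ) / (2 * p')) (mordellLine p') β) := by
    funext β
    rw [mordell_grid_sub p p' hp hp' hcop s hq β hτ, inv_mul_cancel_left₀ hne]
  rw [e]
  exact continuous_const.mul ((continuous_const.mul (h _)).sub (continuous_const.mul (h _)))

theorem integrable_sAT_mul_typicalChar (p p' : ℕ) (hp : 0 < p) (hp' : 0 < p')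
    (hcop : Nat.Coprime p p') (ε ε' : ℤ) (hε : ε = 0 ∨ ε = 1) (hε' : ε' = 0 ∨ ε' = 1)
    (r s θ : ℤ) {q : ℤ × ℤ} (hq : q ∈ kacSet p p') {τ : ℂ} (v t : ℂ) (hτ : 0 < τ.im) :
    Integrable fun x : ℝ => sAT p p' ε ε' r s θ q.1 q.2 x *
      typicalChar p p' ε' ε q.1 q.2 x τ v t := by
  simp only [sAT_mul_typicalChar p p' hp hp' ε ε' hε hε' r s θ q.1 q.2 v t hτ]
  exact (integrable_kacKernel_mul p p' hp hp' hcop s hq _ hτ).const_mul _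

theorem eventually_atypicalExpr_inversion (p p' : ℕ) (hp : 0 < p) (hp' : 0 < p')
    (hcop : Nat.Coprime p p') (ε ε' : ℤ) (hε : ε = 0 ∨ ε = 1) (hε' : ε' = 0 ∨ ε' = 1)
    (r s θ : ℤ) {τ : ℂ} (u t : ℂ) (hτ : 0 < τ.im) : ∀ᶠ v in 𝓝[≠] u,
    atypicalExpr p p' ε ε' r s θ (-1 / τ) (v / τ) (t - u ^ 2 / (6 * τ)) =
      expTwoPi ((1 - 2 * ratio p p') * (v ^ 2 - u ^ 2) / (2 * τ)) *
      (∑ l ∈ discreteSpectra p p', sAA p p' ε ε' r s θ l.1 l.2.1 l.2.2 *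
          atypicalExpr p p' ε' ε l.1 l.2.1 l.2.2 τ v t +
        ∑ q ∈ kacSet p p', ∫ x : ℝ, sAT p p' ε ε' r s θ q.1 q.2 x *
          typicalChar p p' ε' ε q.1 q.2 x τ v t) := by
  have h := psiBlock_inversion p p' hp hp' hcop r s θ hτ (u + ((1 - ε') / 2 * τ - (1 - ε) / 2))
  rw [← map_add_punctured, eventually_map] at h
  refine h.mono fun v hv => ?_
  rw [← add_sub_assoc] at hv
  rw [atypicalExpr_inversion p p' hp hp' ε ε' hε hε' r s θ u v t hτ, hv]
  congr 1
  rw [mul_add, mul_add, ← Finset.sum_neg_distrib, Finset.mul_sum, Finset.mul_sum, Finset.mul_sum,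
    Finset.mul_sum]
  congr 1
  · refine Finset.sum_congr rfl fun l _ => ?_
    rw [sAA_mul_atypicalExpr p p' hp hp' ε ε' hε hε' r s θ _ _ _ v t hτ]
  · refine Finset.sum_congr rfl fun q _ => ?_
    simp only [sAT_mul_typicalChar p p' hp hp' ε ε' hε hε' r s θ q.1 q.2 v t hτ]
    rw [integral_const_mul]
    ring

/-- Both sides are limits along v → u, v ≠ u, of expressions already identified on a punctured
neighbourhood, so uniqueness of limits suffices. -/
theorem atypicalChar_inversion (p p' : ℕ) (hp : 0 < p) (hp' : 0 < p')
    (hcop : Nat.Coprime p p') (ε ε' : ℤ) (hε : ε = 0 ∨ ε = 1) (hε' : ε' = 0 ∨ ε' = 1)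
    (r s θ : ℤ) {τ : ℂ} (u t : ℂ) (hτ : 0 < τ.im) :
    atypicalChar p p' ε ε' r s θ (-1 / τ) (u / τ) (t - u ^ 2 / (6 * τ)) =
      ∑ l ∈ discreteSpectra p p', sAA p p' ε ε' r s θ l.1 l.2.1 l.2.2 *
          atypicalChar p p' ε' ε l.1 l.2.1 l.2.2 τ u t +
        ∑ q ∈ kacSet p p', ∫ x : ℝ, sAT p p' ε ε' r s θ q.1 q.2 x *
          typicalChar p p' ε' ε q.1 q.2 x τ u t := by
  have hτ0 : τ ≠ 0 := by rintro rfl; simp at hτ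
  have hL := tendsto_atypicalExpr p p' hp hp' ε ε' hε hε' r s θ (τ⁻¹ * u) (t - u ^ 2 / (6 * τ))
    (im_neg_one_div_pos hτ)
  rw [← map_mul_punctured (inv_ne_zero hτ0), tendsto_map'_iff] at hL
  have hint : ∀ q ∈ kacSet p p', Tendsto (fun v => ∫ x : ℝ, sAT p p' ε ε' r s θ q.1 q.2 x *
      typicalChar p p' ε' ε q.1 q.2 x τ v t) (𝓝[≠] u) (𝓝 (∫ x : ℝ, sAT p p' ε ε' r s θ q.1 q.2 x *
      typicalChar p p' ε' ε q.1 q.2 x τ u t)) := by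
    intro q hq
    have hc : Continuous fun v => ∫ x : ℝ, sAT p p' ε ε' r s θ q.1 q.2 x *
        typicalChar p p' ε' ε q.1 q.2 x τ v t := by
      simp only [sAT_mul_typicalChar p p' hp hp' ε ε' hε hε' r s θ q.1 q.2 _ t hτ,
        integral_const_mul]
      have h1 := (continuous_integral_kacKernel p p' hp hp' hcop s hq hτ).comp
        (show Continuous fun v : ℂ => 2 * ratio p p' * (v + (1 - ε') / 2 * τ - (1 - ε) / 2) +
          kap p p' (r - 2 * θ) s by fun_prop)
      have h2 := (differentiable_thetaEta hτ).continuous.comp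
        (show Continuous fun v : ℂ => v + (1 - ε') / 2 * τ + (1 - ε) / 2 by fun_prop)
      refine Continuous.mul (Continuous.mul ?_ continuous_const) h1
      unfold inversionFactor
      exact Continuous.mul (by fun_prop) h2
    exact (hc.tendsto u).mono_left nhdsWithin_le_nhds
  have hE : Tendsto (fun v => expTwoPi ((1 - 2 * ratio p p') * (v ^ 2 - u ^ 2) / (2 * τ)))
      (𝓝[≠] u) (𝓝 1) := by
    have hc : Continuous fun v => expTwoPi ((1 - 2 * ratio p p') * (v ^ 2 - u ^ 2) / (2 * τ)) := by
      fun_prop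
    have := hc.tendsto u
    simp only [sub_self, mul_zero, zero_div, expTwoPi_zero] at this
    exact this.mono_left nhdsWithin_le_nhds
  have hR := hE.mul ((tendsto_finsetSum (discreteSpectra p p') fun l _ =>
    (tendsto_atypicalExpr p p' hp hp' ε' ε hε' hε l.1 l.2.1 l.2.2 u t hτ).const_mul
      (sAA p p' ε ε' r s θ l.1 l.2.1 l.2.2)).add (tendsto_finsetSum (kacSet p p') hint))
  rw [one_mul] at hR
  rw [div_eq_inv_mul u τ]
  refine tendsto_nhds_unique (hL.congr' ?_) hR
  filter_upwards [eventually_atypicalExpr_inversion p p' hp hp' hcop ε ε' hε hε' r s θ u t hτ]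
    with v hv
  rw [← hv, Function.comp_apply, div_eq_inv_mul v τ]

/-! ### The T-transformation. -/

theorem thetaEta_tau_add_one (v τ : ℂ) : thetaEta v (τ + 1) = thetaEta v τ := by
  have h : ∀ w : ℂ, qPoch (τ + 1 + w) (τ + 1) = qPoch (τ + w) τ := by
    intro w
    rw [qPoch, qPoch]
    refine tprod_congr fun n => ?_
    congr 1
    refine expTwoPi_eq_of_sub_int (n + 1) ?_
    push_cast; ring
  have h0 := h 0
  rw [add_zero, add_zero] at h0
  simp only [thetaEta, sub_eq_add_neg, h, h0]

theorem appell_add_nat (N p : ℕ) (κ V T : ℂ) (c : ℤ) (hκ : κ * p = c) :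
    appell N κ 0 V (T + p) = appell N κ 0 V T := by
  rw [appell, appell]
  refine tsum_congr fun x => ?_
  have e1 : expTwoPi (V + x * (T + p)) = expTwoPi (V + x * T) :=
    expTwoPi_eq_of_sub_int (x * p) (by push_cast; ring)
  rw [e1, appellExp, appellExp]
  congr 1
  refine expTwoPi_eq_of_sub_int (N * x ^ 2 * p + x * c) ?_
  push_cast
  linear_combination (x : ℂ) * hκ

theorem appell_add_int (N : ℕ) (κ ν V T : ℂ) (n : ℤ) :
    appell N κ ν (V + n) T = expTwoPi (κ * n) * appell N κ ν V T := by
  rw [appell, appell, ← tsum_mul_left]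
  refine tsum_congr fun x => ?_
  have e1 : expTwoPi (V + n + x * T) = expTwoPi (V + x * T) :=
    expTwoPi_eq_of_sub_int n (by ring)
  rw [e1, ← mul_div_assoc, appellExp, appellExp, ← expTwoPi_add]
  congr 2; ring

theorem appellBlock_tau_add_one (p p' : ℕ) (μ : ℝ) (θ : ℤ) (v τ : ℂ) (c : ℤ)
    (hμ : ((μ + 2 * (p' / p) * θ : ℝ) : ℂ) * p = c) :
    appellBlock p p' μ θ v (τ + 1) =
      expTwoPi (ratio p p' * θ ^ 2 + μ * θ) * appellBlock p p' μ θ v τ := by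
  rw [appellBlock, appellBlock, show v + θ * (τ + 1) = v + θ * τ + θ by ring,
    show (p : ℂ) * (τ + 1) = p * τ + p by ring, appell_add_nat _ _ _ _ _ c hμ, appell_add_int,
    ← mul_assoc, ← mul_assoc, ← expTwoPi_add, ← expTwoPi_add]
  congr 2
  rw [ratio]; push_cast; ring

/-- The phases aθ² + μθ and a(θ-r)² + μ(θ-r) of the two blocks differ by the integer rs, so the
difference of blocks is multiplied by one phase. -/
theorem psiBlock_tau_add_one (p p' : ℕ) (hp : 0 < p) (r s θ : ℤ) (v τ : ℂ) :
    psiBlock p p' r s θ v (τ + 1) =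
      expTwoPi (ratio p p' * θ ^ 2 + kap p p' (r - 2 * θ) s * θ) * psiBlock p p' r s θ v τ := by
  have h1 : (p : ℂ) ≠ 0 := by exact_mod_cast hp.ne'
  rw [psiBlock, psiBlock, mul_sub,
    appellBlock_tau_add_one p p' _ θ v τ (p' * r - s * p)
      (by rw [kap]; push_cast; field_simp; ring),
    appellBlock_tau_add_one p p' _ (θ - r) v τ (-p' * r - s * p)
      (by rw [kap]; push_cast; field_simp; ring)]
  congr 2
  refine expTwoPi_eq_of_sub_int (r * s) ?_
  rw [kap, ratio]; push_cast; ring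

theorem atypicalExpr_tau_add_one (p p' : ℕ) (hp : 0 < p) (hp' : 0 < p') (ε ε' : ℤ)
    (hε : ε = 0 ∨ ε = 1) (hε' : ε' = 0 ∨ ε' = 1) (r s θ : ℤ) {τ : ℂ} (u t : ℂ) (hτ : 0 < τ.im) :
    atypicalExpr p p' ε ε' r s θ (τ + 1) u t =
      expTwoPi ((ratio p p' * r - s) * (θ + (1 - ε) / 2) - ratio p p' * (θ + (1 - ε) / 2) ^ 2 -
        (1 - ε) / 8) * atypicalExpr p p' ε (ε * ε' + (1 - ε) * (1 - ε')) r s θ τ u t := by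
  have hτ' : 0 < (τ + 1).im := by simpa using hτ
  have h1 : (p : ℂ) ≠ 0 := by exact_mod_cast hp.ne'
  have hε'' : ε * ε' + (1 - ε) * (1 - ε') = 0 ∨ ε * ε' + (1 - ε) * (1 - ε') = 1 := by
    rcases hε with rfl | rfl <;> rcases hε' with rfl | rfl <;> simp
  have hk : (kap p p' (r - 2 * θ) s : ℂ) = ratio p p' * (r - 2 * θ) - s := by
    rw [kap, ratio]; push_cast; ring
  rw [atypicalExpr_eq p p' hp hp' ε ε' hε hε' r s θ u t hτ',
    atypicalExpr_eq p p' hp hp' ε _ hε hε'' r s θ u t hτ, thetaEta_tau_add_one,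
    psiBlock_tau_add_one p p' hp]
  -- The three cases below differ only in phases: y and y'' are the arguments before and after
  -- rewriting, C is the phase gained between them, and k is an integer discrepancy. Only ε = ε' = 0
  -- needs a genuine unit translation of y.
  have main : ∀ (y y'' A B C : ℂ) (k : ℤ),
      thetaEta y τ * psiBlock p p' r s θ y τ =
        expTwoPi C * (thetaEta y'' τ * psiBlock p p' r s θ y'' τ) →
      A + (ratio p p' * θ ^ 2 + kap p p' (r - 2 * θ) s * θ) + C = B + k →
      ∀ D, B = (ratio p p' * r - s) * (θ + (1 - ε) / 2) - ratio p p' * (θ + (1 - ε) / 2) ^ 2 -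
        (1 - ε) / 8 + D →
      -expTwoPi A * (thetaEta y τ * (expTwoPi (ratio p p' * θ ^ 2 +
        kap p p' (r - 2 * θ) s * θ) * psiBlock p p' r s θ y τ)) =
      expTwoPi ((ratio p p' * r - s) * (θ + (1 - ε) / 2) - ratio p p' * (θ + (1 - ε) / 2) ^ 2 -
        (1 - ε) / 8) * (-expTwoPi D * (thetaEta y'' τ * psiBlock p p' r s θ y'' τ)) := by
    intro y y'' A B C k hy hAB D hD
    have e := expTwoPi_eq_of_sub_int k hAB
    rw [hD, expTwoPi_add, expTwoPi_add, expTwoPi_add _ D] at e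
    linear_combination (-(expTwoPi A * expTwoPi (ratio p p' * θ ^ 2 +
      kap p p' (r - 2 * θ) s * θ))) * hy - (thetaEta y'' τ * psiBlock p p' r s θ y'' τ) * e
  rcases hε with rfl | rfl
  · rcases hε' with rfl | rfl
    · refine main _ _ _ _ (1 / 2 + kap p p' (r - 2 * θ) s) 1 ?_ ?_ _ rfl
      · have e1 : u + (1 - ((0 : ℤ) : ℂ)) / 2 * (τ + 1) + (1 - ((0 : ℤ) : ℂ)) / 2 =
            u + (1 - ((0 : ℤ) : ℂ)) / 2 * τ +
              (1 - ((0 * 0 + (1 - 0) * (1 - 0) : ℤ) : ℂ)) / 2 + 1 := by push_cast; ring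
        rw [e1, thetaEta_add_one _ hτ, psiBlock_add_one, expTwoPi_add, expTwoPi_half]
        ring
      · rw [hk]; push_cast; ring
    · refine main _ _ _ _ 0 0 ?_ ?_ _ rfl
      · have e1 : u + (1 - ((0 : ℤ) : ℂ)) / 2 * (τ + 1) + (1 - ((1 : ℤ) : ℂ)) / 2 =
            u + (1 - ((0 : ℤ) : ℂ)) / 2 * τ +
              (1 - ((0 * 1 + (1 - 0) * (1 - 1) : ℤ) : ℂ)) / 2 := by push_cast; ring
        rw [e1, expTwoPi_zero, one_mul]
      · rw [hk]; push_cast; ring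
  · refine main _ _ _ _ 0 0 ?_ ?_ _ rfl
    · have e1 : u + (1 - ((1 : ℤ) : ℂ)) / 2 * (τ + 1) + (1 - ε') / 2 =
          u + (1 - ((1 : ℤ) : ℂ)) / 2 * τ +
            (1 - ((1 * ε' + (1 - 1) * (1 - ε') : ℤ) : ℂ)) / 2 := by push_cast; ring
      rw [e1, expTwoPi_zero]
      exact (one_mul _).symm
    · rw [hk]; push_cast; ring

theorem atypicalChar_tau_add_one (p p' : ℕ) (hp : 0 < p) (hp' : 0 < p') (ε ε' : ℤ)
    (hε : ε = 0 ∨ ε = 1) (hε' : ε' = 0 ∨ ε' = 1) (r s θ : ℤ) {τ : ℂ} (u t : ℂ) (hτ : 0 < τ.im) :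
    atypicalChar p p' ε ε' r s θ (τ + 1) u t =
      expTwoPi ((ratio p p' * r - s) * (θ + (1 - ε) / 2) - ratio p p' * (θ + (1 - ε) / 2) ^ 2 -
        (1 - ε) / 8) * atypicalChar p p' ε (ε * ε' + (1 - ε) * (1 - ε')) r s θ τ u t := by
  have hε'' : ε * ε' + (1 - ε) * (1 - ε') = 0 ∨ ε * ε' + (1 - ε) * (1 - ε') = 1 := by
    rcases hε with rfl | rfl <;> rcases hε' with rfl | rfl <;> simp
  refine tendsto_nhds_unique (tendsto_atypicalExpr p p' hp hp' ε ε' hε hε' r s θ u t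
    (τ := τ + 1) (by simpa using hτ)) ?_
  simp only [atypicalExpr_tau_add_one p p' hp hp' ε ε' hε hε' r s θ _ t hτ]
  exact (tendsto_atypicalExpr p p' hp hp' ε _ hε hε'' r s θ u t hτ).const_mul _

end N2Char

end

theorem mainTheorem1 (p p' : ℕ) (hp : 2 ≤ p) (hp' : 1 ≤ p') (hcop : Nat.Coprime p p')
    (ε ε' : ℤ) (hε : ε = 0 ∨ ε = 1) (hε' : ε' = 0 ∨ ε' = 1)
    (r s θ : ℤ) (hr : 1 ≤ r) (hr' : r ≤ p - 1) (hs : 0 ≤ s) (hs' : s ≤ p' - 1)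
    (τ u t : ℂ) (hτ : 0 < τ.im) :
    Tendsto (fun v => N2Char.atypicalExpr p p' ε ε' r s θ τ v t) (𝓝[≠] u)
        (𝓝 (N2Char.atypicalChar p p' ε ε' r s θ τ u t)) ∧
      (∀ μ ∈ N2Char.kacSet p p',
        Integrable fun x : ℝ =>
          N2Char.sAT p p' ε ε' r s θ μ.1 μ.2 x *
            N2Char.typicalChar p p' ε' ε μ.1 μ.2 x τ u t) ∧
      N2Char.atypicalChar p p' ε ε' r s θ (-1 / τ) (u / τ) (t - u ^ 2 / (6 * τ)) =
        ∑ l ∈ N2Char.discreteSpectra p p',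
            N2Char.sAA p p' ε ε' r s θ l.1 l.2.1 l.2.2 *
              N2Char.atypicalChar p p' ε' ε l.1 l.2.1 l.2.2 τ u t +
          ∑ μ ∈ N2Char.kacSet p p',
            ∫ x : ℝ, N2Char.sAT p p' ε ε' r s θ μ.1 μ.2 x *
              N2Char.typicalChar p p' ε' ε μ.1 μ.2 x τ u t ∧
      N2Char.atypicalChar p p' ε ε' r s θ (τ + 1) u t =
        N2Char.expTwoPi
            ((N2Char.ratio p p' * r - s) * (θ + (1 - ε) / 2) - N2Char.ratio p p' * (θ + (1 - ε) / 2) ^ 2 -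
              (1 - ε) / 8) *
          N2Char.atypicalChar p p' ε (ε * ε' + (1 - ε) * (1 - ε')) r s θ τ u t := by
  have hp0 : 0 < p := by omega
  have hp0' : 0 < p' := hp'
  exact ⟨N2Char.tendsto_atypicalExpr p p' hp0 hp0' ε ε' hε hε' r s θ u t hτ,
    fun μ hμ => N2Char.integrable_sAT_mul_typicalChar p p' hp0 hp0' hcop ε ε' hε hε' r s θ hμ u t hτ,
    N2Char.atypicalChar_inversion p p' hp0 hp0' hcop ε ε' hε hε' r s θ u t hτ,
    N2Char.atypicalChar_tau_add_one p p' hp0 hp0' ε ε' hε hε' r s θ u t hτ⟩
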